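/- **Conventions.** $G=\mathrm{SU}(2)$ with Haar probability measure, $h_\varphi=\mathrm{diag}(e^{i\varphi/2},e^{-i\varphi/2})$, $a_\theta=\begin{pmatrix}\cos\frac\theta2&-\sin\frac\theta2\\ \sin\frac\theta2&\cos\frac\theta2\end{pmatrix}$, $\Delta(\theta)=\sin(\theta/2)$, $d_j=2j+1$, $D^j$ the Wigner matrices on $V^j$, $\chi_j$ their characters ($2j\in\mathbb N$). The Drinfeld double $D(G)$ is spanned by elements $f\otimes g$, with coproduct $\Delta(f\otimes g)(x_1,x_2)=f(x_1x_2)\,g\otimes g$ and $R=\int dg\,(\delta_g\otimes e)\otimes(1\otimes g)$. The representation $(\theta,s)$, $0<\theta<2\pi$, $2s\in\mathbb Z$, acts on $\{\varphi\in L^2(G):\varphi(xh_\xi)=e^{is\xi}\varphi(x)\}$ by $(f\otimes g)\varphi(x)=f(xh_\theta x^{-1})\varphi(g^{-1}x)$; the representation $(0,j)$ acts on $V^j$ by $f(e)D^j(g)$. Coloured braids are evaluated through the braiding $\sigma R$ and its inverse, and a tangle is evaluated as a braid with one strand closed: a strand $(0,j)$ is closed by the trace over $V^j$; a strand $(\theta,0)$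 is closed by the reduced trace, that is, the operator is diagonal (its trace over $\mathrm{span}\{D^I_{m0}\}_m$ is $(2I+1)$ times an operator independent of $I\in\mathbb N$) and that operator is the evaluation. Colouring a circle by $\Omega=\sum_j d_j\,(0,j)$ or $\Omega^*=\int_0^{2\pi}\frac{d\theta}{\pi}\Delta(\theta)^2\,(\theta,0)$ means taking the corresponding combination of evaluations. Identities that contain $\Omega$ around a strand $(\theta,s)$ are identities of distributions in $\theta\in[0,2\pi]$: after integration against $\frac{d\theta}\pi\Delta(\theta)^2f(\theta)$, $f$ smooth, the sum over $j$ converges unconditionally and strongly on the carrier space, which does not depend on $\theta$; $\delta(h_\theta)$ is the distribution $f\mapsto f(0)$. **Proposition.** For all spins, all parameters in $(0,2\pi)$, and both orientations of the circles, all closures of flux strands below are of diagonal operators and: 1. *(Sliding)* (a) Let a strand $(\theta,s)$ be encircled by $\Omega$, and let a strand $(0,j)$ cross the strand $(\theta,s)$ once before and once after the circle, with arbitrary crossing signs, so that it passes the strand on one side, or on the other, or links it with either sign. All four tangles have the same evaluation, equal to $\delta(h_\theta)\,\mathrm{Id}$. (b) Let a strand $(0,j)$ be encircled by $\Omega^*$,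 and let a strand $(\theta,s)$ (in particular $(\theta,0)$) pass it or link it in the same four ways. All four tangles have the same evaluation. 2. *(Killing)* A circle $\Omega^*$ around a strand $(0,j)$ evaluates to $\delta_{j,0}\,\mathrm{Id}$. A circle $\Omega$ around a strand $(\theta,s)$ (in particular $(\theta,0)$) evaluates to $\delta(h_\theta)\,\mathrm{Id}$. 3. *(Fusion of $(0,j_1),(0,j_2)$)* Let $C^{j_1j_2j_3}:V^{j_1}\otimes V^{j_2}\to V^{j_3}$ be given by the $\mathrm{SU}(2)$ Clebsch–Gordan coefficients, normalised by $\sum_{m_1m_2m_3}|C^{j_1j_2j_3}_{m_1m_2m_3}|^2=1$ when $(j_1,j_2,j_3)$ is admissible and zero otherwise. These maps intertwine $D(G)$, and $$\mathrm{ev}\big[\text{circle }(\theta,0)\text{ around }(0,j_1),(0,j_2)\big]=\sum_{j_3}d_{j_3}\,(C^{j_1j_2j_3})^{*}\;\mathrm{ev}\big[\text{circle }(\theta,0)\text{ around }(0,j_3)\big]\;C^{j_1j_2j_3}.$$ 4. *(Fusion of $(\theta_1,0),(\theta_2,0)$)* For $|\theta_1-\theta_2|\le\theta_3\le\theta_1+\theta_2$,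 $\theta_1+\theta_2+\theta_3\le4\pi$, let $\theta\in[0,\pi]$ be given by $\cos\frac{\theta_3}2=\cos\frac{\theta_1}2\cos\frac{\theta_2}2-\cos\theta\sin\frac{\theta_1}2\sin\frac{\theta_2}2$. There is $w=w(\theta_3)\in G$ with $h_{\theta_1}a_\theta h_{\theta_2}a_\theta^{-1}=wh_{\theta_3}w^{-1}$. For any choice of $w$, the Clebsch–Gordan kernel $$C_{x_1x_2x_3}=\Big(4\sin\tfrac{\theta_1}2\sin\tfrac{\theta_2}2\sin\tfrac{\theta_3}2\Big)^{-1/2}\int_{U(1)^3}d\xi_1d\xi_2d\xi_3\,e^{-is_3\xi_3}\,\delta_{x_3h_{\xi_3}}(x_1h_{\xi_1}w)\,\delta_{x_2h_{\xi_2}}(x_1h_{\xi_1}a_\theta)$$ (normalised measures on $U(1)=\{h_\xi\}$; zero for other $\theta_3$) defines $D(G)$-intertwiners $C_{\theta_3,s_3}:\Phi\mapsto\int dx_1dx_2\,C_{x_1x_2x_3}\Phi(x_1,x_2)$ from the carrier space of $(\theta_1,0)\otimes(\theta_2,0)$ to that of $(\theta_3,s_3)$, for almost every $\theta_3\in(0,2\pi)$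 and all $s_3$, and for all $\Psi,\Phi$ in the carrier space of $(\theta_1,0)\otimes(\theta_2,0)$ $$\Big\langle\Psi,\mathrm{ev}\big[\text{circle }(0,j)\text{ around }(\theta_1,0),(\theta_2,0)\big]\Phi\Big\rangle=\int_0^{2\pi}\sin^2\!\tfrac{\theta_3}2\,d\theta_3\sum_{s_3\in\frac12\mathbb Z}\Big\langle C_{\theta_3,s_3}\Psi,\ \mathrm{ev}\big[\text{circle }(0,j)\text{ around }(\theta_3,s_3)\big]\,C_{\theta_3,s_3}\Phi\Big\rangle,$$ where the sum converges absolutely for almost every $\theta_3$ and the integral converges. -/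

import Mathlib

open MeasureTheory Filter Topology
open scoped ContDiff ENNReal

noncomputable section

namespace DoubleSU2

/-! ### The group `SU(2)` and its normalised Haar measure -/

/-- The group `SU(2)`. -/
abbrev SU2 := Matrix.specialUnitaryGroup (Fin 2) ℂ

instance : MeasurableSpace SU2 := borel SU2

instance : BorelSpace SU2 := ⟨rfl⟩

instance : IsTopologicalGroup SU2 where
  continuous_inv := by
    refine Continuous.subtype_mk ?_ _
    exact continuous_subtype_val.star

instance : CompactSpace SU2 := by
  have hK : IsCompact (Set.pi Set.univ fun _ : Fin 2 => Set.pi Set.univ fun _ : Fin 2 =>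
      Metric.closedBall (0 : ℂ) 1) :=
    isCompact_univ_pi fun _ => isCompact_univ_pi fun _ => isCompact_closedBall 0 1
  have h : (Matrix.specialUnitaryGroup (Fin 2) ℂ : Set (Matrix (Fin 2) (Fin 2) ℂ)) =
      {A | A * star A = 1} ∩ {A | A.det = 1} := by
    ext A
    exact Matrix.mem_specialUnitaryGroup_iff.trans
      (and_congr_left fun _ => Matrix.mem_unitaryGroup_iff)
  have hC : IsClosed (Matrix.specialUnitaryGroup (Fin 2) ℂ : Set (Matrix (Fin 2) (Fin 2) ℂ)) := by
    rw [h]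
    exact (isClosed_eq (continuous_id.mul continuous_id.star) continuous_const).inter
      (isClosed_eq continuous_id.matrix_det continuous_const)
  have hS : (Matrix.specialUnitaryGroup (Fin 2) ℂ : Set (Matrix (Fin 2) (Fin 2) ℂ)) ⊆
      Set.pi Set.univ fun _ : Fin 2 => Set.pi Set.univ fun _ : Fin 2 =>
        Metric.closedBall (0 : ℂ) 1 := by
    intro A hA i _ j _
    have := entry_norm_bound_of_unitary (Matrix.specialUnitaryGroup_le_unitaryGroup hA) i j
    simpa using this
  exact isCompact_iff_compactSpace.mp (IsCompact.of_isClosed_subset hK hC hS)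

/-- The Haar probability measure of `SU(2)`. -/
def haar : Measure SU2 := Measure.haarMeasure ⊤

/-- The diagonal element `h_φ = diag(e^{iφ/2}, e^{-iφ/2})`. -/
def h (φ : ℝ) : SU2 :=
  ⟨!![Complex.exp (Complex.I * φ / 2), 0; 0, Complex.exp (-(Complex.I * φ / 2))], by
    rw [Matrix.mem_specialUnitaryGroup_iff, Matrix.mem_unitaryGroup_iff]
    refine ⟨?_, ?_⟩
    · ext i j
      fin_cases i <;> fin_cases j <;>
        simp [Matrix.mul_apply, Fin.sum_univ_two, Matrix.star_apply, ← Complex.exp_conj,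
          ← Complex.exp_add, neg_div, Complex.conj_ofNat]
    · simp [Matrix.det_fin_two, ← Complex.exp_add]⟩

/-- The rotation `a_θ` with half-angle `θ/2`. -/
def a (θ : ℝ) : SU2 :=
  ⟨!![(Real.cos (θ / 2) : ℂ), -(Real.sin (θ / 2) : ℂ);
      (Real.sin (θ / 2) : ℂ), (Real.cos (θ / 2) : ℂ)], by
    have hcs : (Real.cos (θ / 2) : ℂ) * Real.cos (θ / 2) +
        (Real.sin (θ / 2) : ℂ) * Real.sin (θ / 2) = 1 := by
      have := Real.cos_sq_add_sin_sq (θ / 2)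
      rw [sq, sq] at this
      exact_mod_cast this
    rw [Matrix.mem_specialUnitaryGroup_iff, Matrix.mem_unitaryGroup_iff]
    refine ⟨?_, ?_⟩
    · ext i j
      fin_cases i <;> fin_cases j <;>
        simp [-Complex.ofReal_cos, -Complex.ofReal_sin, Matrix.mul_apply, Fin.sum_univ_two,
          Matrix.star_apply, Complex.conj_ofReal] <;>
        first
          | linear_combination hcs
          | ring
    · rw [Matrix.det_fin_two_of]
      linear_combination hcs⟩

/-- The weight `Δ(θ)² = sin²(θ/2)`. -/
def deltaSq (θ : ℝ) : ℝ := Real.sin (θ / 2) ^ 2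

/-! ### Wigner matrices and Clebsch-Gordan coefficients of `SU(2)`

A spin `j` is recorded by the natural number `n = 2j`; the index `k ∈ {0, …, n}` stands for the
magnetic number `m = j - k`. -/

/-- The Wigner matrix `D^{n/2}(g)`: the matrix of the substitution `X ↦ g₀₀ X + g₁₀ Y`,
`Y ↦ g₀₁ X + g₁₁ Y` on homogeneous polynomials of degree `n`, in the orthonormal basis
`√(n choose k) X^{n-k} Y^k` (below, `X` is set to `1` and the variable is `Y`). -/
def wigner (n : ℕ) (g : SU2) : Matrix (Fin (n + 1)) (Fin (n + 1)) ℂ := fun k l =>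
  (Real.sqrt ((n.choose l : ℝ) / (n.choose k : ℝ)) : ℂ) *
    ((Polynomial.C (g.1 0 0) + Polynomial.C (g.1 1 0) * Polynomial.X) ^ (n - (l : ℕ)) *
      (Polynomial.C (g.1 0 1) + Polynomial.C (g.1 1 1) * Polynomial.X) ^ (l : ℕ)).coeff (k : ℕ)

/-- The Clebsch-Gordan coefficient `C^{j₁ j₂ j₃}_{m₁ m₂ m₃}` for `V^{j₁} ⊗ V^{j₂} → V^{j₃}`, by the
van der Waerden-Racah formula, normalised by `∑ |C|² = 1` over all of `m₁, m₂, m₃`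
(that is, `(2j₃+1)^{-1/2}` times the coefficient of the unitary change of basis). -/
def cg (n₁ n₂ n₃ k₁ k₂ k₃ : ℕ) : ℝ :=
  let p := (n₁ + n₂ - n₃) / 2
  let q := (n₁ + n₃ - n₂) / 2
  let r := (n₂ + n₃ - n₁) / 2
  if Even (n₁ + n₂ + n₃) ∧ n₃ ≤ n₁ + n₂ ∧ n₁ ≤ n₂ + n₃ ∧ n₂ ≤ n₁ + n₃ ∧ k₁ + k₂ = p + k₃ then
    Real.sqrt (((n₁.factorial * n₂.factorial * n₃.factorial : ℕ) : ℝ) /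
        ((p.factorial * q.factorial * r.factorial * (p + q + r + 1).factorial : ℕ) : ℝ)) *
      (∑ i ∈ Finset.range (p + 1), if i ≤ k₁ ∧ p ≤ k₂ + i then
        (-1 : ℝ) ^ i * (p.choose i : ℝ) * (q.choose (k₁ - i) : ℝ) * (r.choose (k₂ + i - p) : ℝ)
        else 0) /
      Real.sqrt ((n₁.choose k₁ * n₂.choose k₂ * n₃.choose k₃ : ℕ) : ℝ)
  else 0

/-! ### Irreducible representations of the double `D(SU(2))`

The colour of a strand is `(θ, s)` or `(0, j)`. It is given by a `Kind` together with a real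
number `θ`, kept apart because the carrier space of `(θ, s)` does not depend on `θ`. -/

/-- `flux n` with the parameter `θ` is the representation `(θ, s)`, `s = n/2`;
`spin n` is the representation `(0, j)`, `j = n/2` (its parameter is not used). -/
inductive Kind
  | flux (n : ℤ)
  | spin (n : ℕ)

/-- Elements of the carrier space are functions on this set: functions on `SU(2)` for `(θ, s)`,
vectors of `V^j` for `(0, j)`. -/
def Kind.Point : Kind → Type
  | .flux _ => SU2
  | .spin n => Fin (n + 1)

instance Kind.measurableSpacePoint : (k : Kind) → MeasurableSpace k.Point
  | .flux _ => inferInstanceAs (MeasurableSpace SU2)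
  | .spin n => inferInstanceAs (MeasurableSpace (Fin (n + 1)))

/-- Haar measure for `(θ, s)`, counting measure on the orthonormal basis of `V^j`. -/
def Kind.measure : (k : Kind) → Measure k.Point
  | .flux _ => haar
  | .spin n => (Measure.count : Measure (Fin (n + 1)))

/-- The action of the group element `1 ⊗ g` of the double. -/
def Kind.act : (k : Kind) → SU2 → (k.Point → ℂ) → k.Point → ℂ
  | .flux _, g, φ => fun x : SU2 => φ (g⁻¹ * x : SU2)
  | .spin n, g, v => (wigner n g).mulVec v

/-- The function part `f ⊗ e` of the double acts as multiplication by `f (hol x)`: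
`f(x h_θ x⁻¹)` on `(θ, s)` and `f(e)` on `(0, j)`. -/
def Kind.hol : (k : Kind) → ℝ → k.Point → SU2
  | .flux _, θ, x => (show SU2 from x) * h θ * (show SU2 from x)⁻¹
  | .spin _, _, _ => 1

/-- Right translation by `h_ξ` (only for `(θ, s)`). -/
def Kind.rotate : (k : Kind) → ℝ → k.Point → k.Point
  | .flux _, ξ, x => (show SU2 from x) * h ξ
  | .spin _, _, x => x

/-- The covariance factor `e^{isξ}` (only for `(θ, s)`). -/
def Kind.phase : Kind → ℝ → ℂ
  | .flux n, ξ => Complex.exp (Complex.I * n * ξ / 2)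
  | .spin _, _ => 1

/-! ### States on several strands -/

/-- Arguments of a wave function on `N` strands of kinds `c`. -/
abbrev Config {N : ℕ} (c : Fin N → Kind) : Type := ∀ b, (c b).Point

/-- Wave functions on `N` strands, before square integrability and covariance are imposed. -/
abbrev State {N : ℕ} (c : Fin N → Kind) : Type := Config c → ℂ

/-- Maps between wave functions. -/
abbrev Op {N : ℕ} (c : Fin N → Kind) : Type := State c → State c

/-- The product measure. -/
def configMeasure {N : ℕ} (c : Fin N → Kind) : Measure (Config c) :=
  Measure.pi fun b => (c b).measure

/-- `Φ` lies in the tensor product of the carrier spaces of the strands: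
`Φ` is square integrable and `Φ(…, x_b h_ξ, …) = e^{i s_b ξ} Φ(…, x_b, …)` on every strand `b`
of type `(θ_b, s_b)`. -/
structure IsCarrier {N : ℕ} (c : Fin N → Kind) (Φ : State c) : Prop where
  measurable : Measurable Φ
  memLp : MemLp Φ 2 (configMeasure c)
  covariant : ∀ (b : Fin N) (ξ : ℝ) (x : Config c),
    Φ (Function.update x b ((c b).rotate ξ (x b))) = (c b).phase ξ * Φ x

/-- The Hermitian inner product. -/
def braket {N : ℕ} (c : Fin N → Kind) (Ψ Φ : State c) : ℂ :=
  ∫ x, (starRingEnd ℂ) (Ψ x) * Φ x ∂(configMeasure c)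

/-- `1 ⊗ g` acting on strand `b` only. -/
def slotAct {N : ℕ} (c : Fin N → Kind) (b : Fin N) (g : SU2) : Op c := fun Φ x =>
  (c b).act g (fun p => Φ (Function.update x b p)) (x b)

/-- The action of `f ⊗ g ∈ D(SU(2))` on a tensor product, by the iterated coproduct
`Δ(f ⊗ g)(x₁, …, x_N) = f(x₁ ⋯ x_N) g ⊗ ⋯ ⊗ g`. -/
def doubleAct {N : ℕ} (c : Fin N → Kind) (θ : Fin N → ℝ) (f : SU2 → ℂ) (g : SU2) : Op c :=
  fun Φ x => f (List.ofFn fun b => (c b).hol (θ b) (x b)).prod *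
    (List.finRange N).foldr (fun b Ψ => slotAct c b g Ψ) Φ x

/-- The `R`-matrix `R = ∫ dg (δ_g ⊗ e) ⊗ (1 ⊗ g)`, its first leg on strand `b₁` and its second
leg on strand `b₂`. -/
def rMatrix {N : ℕ} (c : Fin N → Kind) (θ : Fin N → ℝ) (b₁ b₂ : Fin N) : Op c := fun Φ x =>
  slotAct c b₂ ((c b₁).hol (θ b₁) (x b₁)) Φ x

/-- `R⁻¹ = ∫ dg (δ_g ⊗ e) ⊗ (1 ⊗ g⁻¹)`. -/
def rMatrixInv {N : ℕ} (c : Fin N → Kind) (θ : Fin N → ℝ) (b₁ b₂ : Fin N) : Op c := fun Φ x =>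
  slotAct c b₂ ((c b₁).hol (θ b₁) (x b₁))⁻¹ Φ x

/-- The crossing of two neighbouring strands, `l` on the left and `r` on the right: the braiding
`σR` (`true`) or its inverse `R⁻¹σ` (`false`). As strands keep their labels, the flip `σ` is
recorded in the permutation of `braidEval`, not in the operator. -/
def crossing {N : ℕ} (c : Fin N → Kind) (θ : Fin N → ℝ) (sign : Bool) (l r : Fin N) : Op c :=
  if sign then rMatrix c θ l r else rMatrixInv c θ r l

/-- A braid word on `m + 1` strands: `(i, true)` is the generator at positions `i, i + 1`,
`(i, false)` its inverse. The head of the list is the first crossing. -/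
abbrev BraidWord (m : ℕ) : Type := List (Fin m × Bool)

/-- Reshetikhin-Turaev evaluation of a coloured braid; `p i` is the label of the strand which is at
position `i` when the braid starts. -/
def braidEval {m : ℕ} (c : Fin (m + 1) → Kind) (θ : Fin (m + 1) → ℝ) :
    BraidWord m → Equiv.Perm (Fin (m + 1)) → Op c
  | [], _, Φ => Φ
  | (i, sign) :: w, p, Φ =>
      braidEval c θ w (p * Equiv.swap i.castSucc i.succ)
        (crossing c θ sign (p i.castSucc) (p i.succ) Φ)

/-! ### Closing the first strand -/

/-- The configuration with `x` on the first strand and `y` on the others. -/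
def consConfig {m : ℕ} {A : Kind} {c : Fin m → Kind} (x : A.Point) (y : Config c) :
    Config (Matrix.vecCons A c) :=
  Fin.cons (α := fun b => (Matrix.vecCons A c b).Point) x y

/-- The state `e ⊗ Φ`. -/
def tensorState {m : ℕ} {A : Kind} {c : Fin m → Kind} (e : A.Point → ℂ) (Φ : State c) :
    State (Matrix.vecCons A c) :=
  fun x => e (x 0) * Φ (fun b => x b.succ)

/-- Partial trace over a first strand of colour `(0, n/2)`. -/
def spinTrace {m : ℕ} (n : ℕ) {c : Fin m → Kind} (T : Op (Matrix.vecCons (.spin n) c)) : Op c :=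
  fun Φ y => ∑ k : Fin (n + 1),
    T (tensorState (A := .spin n) (fun l : Fin (n + 1) => if l = k then 1 else 0) Φ)
      (consConfig (A := .spin n) k y)

/-- The orthonormal basis `√(2I+1) D^I_{m0}` of the block `I` of the carrier space of `(θ, 0)`. -/
def blockBasis (I : ℕ) (m : Fin (2 * I + 1)) (x : SU2) : ℂ :=
  (Real.sqrt (2 * I + 1) : ℂ) * wigner (2 * I) x m ⟨I, by omega⟩

/-- Partial trace over the block `I` of a first strand of colour `(θ, 0)`. -/
def blockTrace {m : ℕ} (I : ℕ) {c : Fin m → Kind} (T : Op (Matrix.vecCons (.flux 0) c)) : Op c :=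
  fun Φ y => ∑ k : Fin (2 * I + 1), ∫ x : SU2,
    (starRingEnd ℂ) (blockBasis I k x) *
      T (tensorState (A := .flux 0) (blockBasis I k) Φ) (consConfig (A := .flux 0) x y) ∂haar

/-- The reduced trace over `(θ, 0)`. For a diagonal operator this is the common value of
`(2I+1)⁻¹` times the trace over the block `I`; it is read off at `I = 0`. -/
def reducedTrace {m : ℕ} {c : Fin m → Kind} (T : Op (Matrix.vecCons (.flux 0) c)) : Op c :=
  blockTrace 0 T

/-- Diagonal operators: the trace over the block `I` is `2I+1` times an operator which does not
depend on `I`. -/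
def IsDiagonal {m : ℕ} {c : Fin m → Kind} (T : Op (Matrix.vecCons (.flux 0) c)) : Prop :=
  ∀ (I : ℕ) (Φ : State c), IsCarrier c Φ → ∀ y,
    blockTrace I T Φ y = (2 * I + 1) * reducedTrace T Φ y

/-- The braid `w` with first strand coloured by `(t, 0)` and the others by `(c, θ)`. -/
def fluxBraid {m : ℕ} (t : ℝ) (c : Fin m → Kind) (θ : Fin m → ℝ) (w : BraidWord m) :
    Op (Matrix.vecCons (.flux 0) c) :=
  braidEval (Matrix.vecCons (.flux 0) c) (Matrix.vecCons t θ) w 1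

/-- Evaluation of the tangle obtained by closing the first strand, of colour `(t, 0)`. -/
def evalFlux {m : ℕ} (t : ℝ) (c : Fin m → Kind) (θ : Fin m → ℝ) (w : BraidWord m) : Op c :=
  reducedTrace (fluxBraid t c θ w)

/-- Evaluation of the tangle obtained by closing the first strand, of colour `(0, n/2)`. -/
def evalSpin {m : ℕ} (n : ℕ) (c : Fin m → Kind) (θ : Fin m → ℝ) (w : BraidWord m) : Op c :=
  spinTrace n (braidEval (Matrix.vecCons (.spin n) c) (Matrix.vecCons 0 θ) w 1)

/-! ### The tangles

The first strand of each braid is the one that is closed to a circle. -/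

/-- A circle around one strand; the sign is the relative orientation. -/
def circleWord (δ : Bool) : BraidWord 1 := [(0, δ), (0, δ)]

/-- A circle around two parallel strands. -/
def aroundTwoWord (δ : Bool) : BraidWord 2 := [(0, δ), (1, δ), (1, δ), (0, δ)]

/-- The last strand is encircled by the (closed) first strand, with relative orientation `δ`; on
its way to the circle and back it crosses the middle strand, with signs `ε` and `ε'`. For
`ε ≠ ε'` the middle strand passes on one side or the other of the last strand, not linked with it;
for `ε = ε'` it links the last strand, positively or negatively, next to the circle. -/
def slideWord (δ ε ε' : Bool) : BraidWord 2 := [(1, ε), (0, δ), (0, δ), (1, ε')]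

/-! ### The colours `Ω` and `Ω*` -/

/-- Colouring by `Ω* = ∫_{[0,2π]} (dθ/π) Δ²(θ) (θ, 0)`. -/
def omegaStar {X : Type} (E : ℝ → X → ℂ) (y : X) : ℂ :=
  ∫ t in (0 : ℝ)..(2 * Real.pi), ((deltaSq t / Real.pi : ℝ) : ℂ) * E t y

/-- Pairing of a distribution on the conjugacy classes `θ ∈ [0, 2π]` with a test function `f`, for
the measure `(dθ/π) Δ²(θ)`. -/
def testAgainst {X : Type} (f : ℝ → ℂ) (E : ℝ → X → ℂ) (y : X) : ℂ :=
  ∫ t in (0 : ℝ)..(2 * Real.pi), ((deltaSq t / Real.pi : ℝ) : ℂ) * (f t * E t y)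

/-- `∑_k F k = L`, unconditionally, in the `L²` norm. -/
def HasSumL2 {X : Type} [MeasurableSpace X] (μ : Measure X) (F : ℕ → X → ℂ) (L : X → ℂ) : Prop :=
  Tendsto (fun s : Finset ℕ => eLpNorm (fun y => ∑ k ∈ s, F k y - L y) 2 μ) atTop (𝓝 0)

/-- `∑_j d_j E_j = L` as distributions in `θ ∈ [0, 2π]` with values in operators on the carrier
space: the colouring by `Ω = ∑_j d_j (0, j)` gives `L`, where `E k θ` is the operator for the
colour `j = k/2`, and `L f` is `L` tested against `f`. -/
def OmegaEvaluatesTo {N : ℕ} (c : Fin N → Kind) (E : ℕ → ℝ → Op c) (L : (ℝ → ℂ) → Op c) : Prop :=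
  ∀ (f : ℝ → ℂ), ContDiff ℝ ∞ f → ∀ Φ : State c, IsCarrier c Φ →
    (∀ (k : ℕ) (y : Config c), IntervalIntegrable (fun t => E k t Φ y) volume 0 (2 * Real.pi)) ∧
    HasSumL2 (configMeasure c)
      (fun k y => testAgainst f (fun t y => ((k : ℂ) + 1) * E k t Φ y) y) (L f Φ)

/-- The distribution `δ(h_θ) Id`, where `∫_{[0,2π]} (dθ/π) Δ²(θ) f(θ) δ(h_θ) = f(0)`. -/
def deltaId {N : ℕ} (c : Fin N → Kind) (f : ℝ → ℂ) : Op c := fun Φ y => f 0 * Φ y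

/-! ### Clebsch-Gordan maps of the double -/

/-- The Clebsch-Gordan map `(0, j₁) ⊗ (0, j₂) → (0, j₃)`. -/
def spinCG (n₁ n₂ n₃ : ℕ) (Φ : State ![.spin n₁, .spin n₂]) : State ![.spin n₃] := fun x =>
  ∑ k₁ : Fin (n₁ + 1), ∑ k₂ : Fin (n₂ + 1),
    (cg n₁ n₂ n₃ k₁ k₂ (show Fin (n₃ + 1) from x 0) : ℂ) *
      Φ (consConfig (A := .spin n₁) k₁ (consConfig (A := .spin n₂) k₂ fun b => b.elim0))

/-- The map `(0, j₃) → (0, j₁) ⊗ (0, j₂)` with the conjugate (real) coefficients. -/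
def spinCGDual (n₁ n₂ n₃ : ℕ) (Φ : State ![.spin n₃]) : State ![.spin n₁, .spin n₂] := fun x =>
  ∑ k₃ : Fin (n₃ + 1),
    (cg n₁ n₂ n₃ (show Fin (n₁ + 1) from x 0) (show Fin (n₂ + 1) from x 1) k₃ : ℂ) *
      Φ (consConfig (A := .spin n₃) k₃ fun b => b.elim0)

/-- The class angles which occur in products of elements of the classes `θ₁` and `θ₂`. -/
def Admissible (θ₁ θ₂ θ₃ : ℝ) : Prop :=
  |θ₁ - θ₂| ≤ θ₃ ∧ θ₃ ≤ θ₁ + θ₂ ∧ θ₁ + θ₂ + θ₃ ≤ 4 * Real.pi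

/-- The angle `θ ∈ [0, π]` with
`cos(θ₃/2) = cos(θ₁/2) cos(θ₂/2) - cos θ sin(θ₁/2) sin(θ₂/2)`. -/
def relAngle (θ₁ θ₂ θ₃ : ℝ) : ℝ :=
  Real.arccos ((Real.cos (θ₁ / 2) * Real.cos (θ₂ / 2) - Real.cos (θ₃ / 2)) /
    (Real.sin (θ₁ / 2) * Real.sin (θ₂ / 2)))

/-- `w` is a choice, for every admissible `θ₃`, of an element with
`h_{θ₁} a_θ h_{θ₂} a_θ⁻¹ = w h_{θ₃} w⁻¹`, where `θ = relAngle θ₁ θ₂ θ₃`. -/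
def IsSection (θ₁ θ₂ : ℝ) (w : ℝ → SU2) : Prop :=
  ∀ θ₃, Admissible θ₁ θ₂ θ₃ →
    h θ₁ * a (relAngle θ₁ θ₂ θ₃) * h θ₂ * (a (relAngle θ₁ θ₂ θ₃))⁻¹ = w θ₃ * h θ₃ * (w θ₃)⁻¹

open Classical in
/-- The Clebsch-Gordan map `(θ₁, 0) ⊗ (θ₂, 0) → (θ₃, s₃)`, `s₃ = n₃/2`:
`Φ ↦ ∫ dx₁ dx₂ C_{x₁ x₂ x₃} Φ(x₁, x₂)` for the kernel
`C_{x₁ x₂ x₃} = (4 sin(θ₁/2) sin(θ₂/2) sin(θ₃/2))^{-1/2}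
  ∫ dξ₁ dξ₂ dξ₃ e^{-i s₃ ξ₃} δ_{x₃ h_{ξ₃}}(x₁ h_{ξ₁} w) δ_{x₂ h_{ξ₂}}(x₁ h_{ξ₁} a_θ)`,
where `dξ` is normalised on `U(1) = {h_ξ : ξ ∈ [-2π, 2π]}`; the delta functions have been
integrated, which puts `x₁ = x₃ h_{ξ₃} w⁻¹ h_{ξ₁}⁻¹` and `x₂ = x₃ h_{ξ₃} w⁻¹ a_θ h_{ξ₂}⁻¹`. -/
def fluxCG (θ₁ θ₂ θ₃ : ℝ) (n₃ : ℤ) (w : SU2) (Φ : State ![.flux 0, .flux 0]) :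
    State ![.flux n₃] := fun x =>
  let x₃ : SU2 := x 0
  if Admissible θ₁ θ₂ θ₃ then
    ((1 / Real.sqrt (4 * Real.sin (θ₁ / 2) * Real.sin (θ₂ / 2) * Real.sin (θ₃ / 2)) : ℝ) : ℂ) *
      ((1 / (4 * Real.pi) ^ 3 : ℝ) : ℂ) *
      ∫ ξ₁ in (-(2 * Real.pi))..(2 * Real.pi), ∫ ξ₂ in (-(2 * Real.pi))..(2 * Real.pi),
      ∫ ξ₃ in (-(2 * Real.pi))..(2 * Real.pi),
        Complex.exp (-(Complex.I * n₃ * ξ₃ / 2)) *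
          Φ (consConfig (A := .flux 0) (x₃ * h ξ₃ * w⁻¹ * (h ξ₁)⁻¹ : SU2)
            (consConfig (A := .flux 0) (x₃ * h ξ₃ * w⁻¹ * a (relAngle θ₁ θ₂ θ₃) * (h ξ₂)⁻¹ : SU2)
              fun b => b.elim0))
  else 0

/-- The term `(θ₃, s₃)` of the fusion of two flux strands inside a circle of colour `(0, j)`, as a
sesquilinear form: `⟨C Ψ, E (C Φ)⟩`, where `C` is the Clebsch-Gordan map to `(θ₃, s₃)` and `E` is
the evaluation of the circle around a strand `(θ₃, s₃)`. -/
def fluxFusionTerm (n : ℕ) (δ : Bool) (θ₁ θ₂ : ℝ) (w : ℝ → SU2)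
    (Ψ Φ : State ![.flux 0, .flux 0]) (θ₃ : ℝ) (n₃ : ℤ) : ℂ :=
  braket ![.flux n₃] (fluxCG θ₁ θ₂ θ₃ n₃ (w θ₃) Ψ)
    (evalSpin n ![.flux n₃] ![θ₃] (circleWord δ) (fluxCG θ₁ θ₂ θ₃ n₃ (w θ₃) Φ))

end DoubleSU2

end

/-! A strand meets another through `R` only by its holonomy, and the holonomy of a strand (0,j) is
1. In every tangle below each crossing involves at least one spin strand, so a full twist of a flux
strand with a spin strand is simply D^j((x h_θ x⁻¹)^{±1}) applied to the spin strand, where x is the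
argument of the flux strand (`crossing_crossing_of_left`, `crossing_crossing_of_right`). Every
tangle thus has an explicit formula.

Closing a spin circle multiplies by the character of the product of the encircled holonomies. A
braid whose first strand is a flux circle acts on that strand as multiplication by a function of x.
Since the sum over m of |D^I_{m0}(x)|² is 1 at every x, such an operator is diagonal, and its
reduced trace is the Haar average over x (`blockTrace_eq`). By Schur's lemma the average of D^j over
a conjugacy class is χ_j/d_j times the identity (`integral_wigner_conj`).

Killing and sliding. For Ω* only the orthogonality of χ_j to the trivial character is needed:
everything vanishes unless j = 0, and for j = 0 a linking holonomy acts trivially. For Ω, the series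
of the d_j χ_j is the delta distribution at the identity (`hasSum_omegaCoeff`), by an integration by
parts and the cosine series of a smooth function at 0. A strand (0,j) linking (θ,s) acts by D^j(x
h_{rθ} x⁻¹) with r in {−1, 0, 1}. Its spectral projections do not depend on θ, and its eigenvalues
are smooth in θ with value 1 at θ = 0, so they are absorbed in the test function without changing
the limit.

Fusion of spins. The Racah formula has as generating function a product of powers of three bilinear
forms, invariant because det g = 1; this gives the intertwining property. Schur's lemma, the norm of
one highest weight row (a Vandermonde sum) and a dimension count make the maps √d_{j₃} C complete,
so D^{j₁} ⊗ D^{j₂} is the sum of the d_{j₃} C* D^{j₃} C (`wigner_kronecker`). Averaging over the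
class of h_θ gives the claim.

Fusion of fluxes. In the coordinates (x, b), b = x⁻¹y, the circle multiplies by χ_j(h_{θ₁} b h_{θ₂}
b⁻¹), a function of b invariant under the torus on both sides. The Haar integral of a bi-invariant
function is the uniform integral in |b₀₀|² (`map_cosSq_haar`, by moments). Passing from |b₀₀|² to
the class angle θ₃ of the product produces a Jacobian equal to Δ²(θ₃) times the squared
normalisation of the kernel (`deltaSq_mul_fluxNorm`). At fixed θ₃ the map to (θ₃,s₃) extracts one
Fourier component along the torus of a translated slice of Φ; the sum over s₃ is Parseval's identity
(`hasSum_integral_torusCoeff`), and w drops out by right invariance of Haar measure. -/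

noncomputable section

namespace DoubleSU2

/-! ### Wigner matrices -/

/-- The coordinates of `(X x + Y y)^n` in the orthonormal basis. -/
def mono (n : ℕ) (X Y : ℂ) : Fin (n + 1) → ℂ := fun k =>
  (Real.sqrt (n.choose k) : ℂ) * X ^ (n - (k : ℕ)) * Y ^ (k : ℕ)

lemma sqrt_choose_ne_zero {n : ℕ} (k : Fin (n + 1)) : (Real.sqrt (n.choose k) : ℂ) ≠ 0 := by
  have : 0 < n.choose k := Nat.choose_pos (Nat.lt_succ_iff.mp k.2)
  have : (0 : ℝ) < n.choose k := by exact_mod_cast this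
  exact_mod_cast (Real.sqrt_pos.mpr this).ne'

lemma sqrt_choose_mul_self {n : ℕ} (k : ℕ) :
    (Real.sqrt (n.choose k) : ℂ) * Real.sqrt (n.choose k) = n.choose k := by
  have : Real.sqrt (n.choose k) * Real.sqrt (n.choose k) = n.choose k :=
    Real.mul_self_sqrt (Nat.cast_nonneg _)
  exact_mod_cast this

/-- At X = 1 the pairing is a polynomial in Y whose coefficients are the c k times nonzero numbers.
So the vectors `mono n X Y` span, and identities between Wigner or Clebsch-Gordan matrices may be
tested on them. -/
lemma eq_zero_of_mono {n : ℕ} {c : Fin (n + 1) → ℂ} (hc : ∀ X Y, c ⬝ᵥ mono n X Y = 0) : c = 0 := by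
  let P : Polynomial ℂ := ∑ k : Fin (n + 1),
    Polynomial.monomial (k : ℕ) (c k * (Real.sqrt (n.choose k) : ℂ))
  have hP : P = 0 := by
    refine Polynomial.funext fun y => ?_
    rw [Polynomial.eval_zero, ← hc 1 y]
    simp [P, Polynomial.eval_finsetSum, dotProduct, mono, mul_assoc]
  funext k
  have hk : P.coeff k = c k * (Real.sqrt (n.choose k) : ℂ) := by
    simp only [P, Polynomial.finsetSum_coeff, Polynomial.coeff_monomial]
    rw [Finset.sum_eq_single k (fun b _ hb => if_neg fun h => hb (Fin.ext h)) (by simp)]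
    simp
  rw [hP, Polynomial.coeff_zero] at hk
  exact (mul_eq_zero.mp hk.symm).resolve_right (sqrt_choose_ne_zero k)

lemma eq_of_mono {n : ℕ} {c d : Fin (n + 1) → ℂ}
    (hc : ∀ X Y, c ⬝ᵥ mono n X Y = d ⬝ᵥ mono n X Y) : c = d :=
  sub_eq_zero.mp (eq_zero_of_mono fun X Y => by rw [sub_dotProduct, hc, sub_self])

lemma mono_dotProduct (n : ℕ) (X Y Z W : ℂ) :
    mono n X Y ⬝ᵥ mono n Z W = (X * Z + Y * W) ^ n := by
  rw [add_comm (X * Z), add_pow, ← Fin.sum_univ_eq_sum_range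
    (fun k => (Y * W) ^ k * (X * Z) ^ (n - k) * (n.choose k : ℂ))]
  refine Finset.sum_congr rfl fun k _ => ?_
  simp only [mono]
  rw [← sqrt_choose_mul_self, mul_pow, mul_pow]
  ring

lemma matrix_eq_of_mono {m n : ℕ} {A B : Matrix (Fin (m + 1)) (Fin (n + 1)) ℂ}
    (hAB : ∀ X Y Z W, mono m X Y ⬝ᵥ A.mulVec (mono n Z W) = mono m X Y ⬝ᵥ B.mulVec (mono n Z W)) :
    A = B := by
  funext k
  refine eq_of_mono fun Z W => ?_
  have : A.mulVec (mono n Z W) = B.mulVec (mono n Z W) :=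
    eq_of_mono fun X Y => by rw [dotProduct_comm, hAB, dotProduct_comm]
  exact congrFun this k

/-- Up to normalisation, pairing with `mono n X Y` evaluates a polynomial at Y/X; a column of
`wigner` is a product of powers of two linear forms, so the pairing is again of the form `mono`. -/
lemma mono_vecMul_wigner (n : ℕ) (g : SU2) (X Y : ℂ) :
    Matrix.vecMul (mono n X Y) (wigner n g) =
      mono n (X * g.1 0 0 + Y * g.1 1 0) (X * g.1 0 1 + Y * g.1 1 1) := by
  funext l
  have hl : (l : ℕ) ≤ n := Nat.lt_succ_iff.mp l.2
  -- Dehomogenising divides by X; X = 0 is recovered at the end by density and continuity.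
  have key : ∀ X ∈ ({0}ᶜ : Set ℂ), Matrix.vecMul (mono n X Y) (wigner n g) l =
      mono n (X * g.1 0 0 + Y * g.1 1 0) (X * g.1 0 1 + Y * g.1 1 1) l := by
    intro X hX
    have hX : X ≠ 0 := hX
    set P : Polynomial ℂ :=
      (Polynomial.C (g.1 0 0) + Polynomial.C (g.1 1 0) * Polynomial.X) ^ (n - (l : ℕ)) *
      (Polynomial.C (g.1 0 1) + Polynomial.C (g.1 1 1) * Polynomial.X) ^ (l : ℕ) with hP
    have hlin : ∀ a b : ℂ, (Polynomial.C a + Polynomial.C b * Polynomial.X).natDegree ≤ 1 := by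
      intro a b
      rw [add_comm]
      exact Polynomial.natDegree_linear_le
    have hdeg : P.natDegree < n + 1 := by
      have h1 := Polynomial.natDegree_pow_le_of_le (n - (l : ℕ)) (hlin (g.1 0 0) (g.1 1 0))
      have h2 := Polynomial.natDegree_pow_le_of_le (l : ℕ) (hlin (g.1 0 1) (g.1 1 1))
      have h3 := Polynomial.natDegree_mul_le_of_le h1 h2
      rw [← hP] at h3
      omega
    have hev := Polynomial.eval_eq_sum_range' hdeg (Y / X)
    have hev2 : P.eval (Y / X) = (g.1 0 0 + g.1 1 0 * (Y / X)) ^ (n - (l : ℕ)) *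
        (g.1 0 1 + g.1 1 1 * (Y / X)) ^ (l : ℕ) := by
      simp [hP]
    have hterm : ∀ k : Fin (n + 1), mono n X Y k * wigner n g k l =
        (Real.sqrt (n.choose l) : ℂ) * X ^ n * (P.coeff k * (Y / X) ^ (k : ℕ)) := by
      intro k
      have hk : (k : ℕ) ≤ n := Nat.lt_succ_iff.mp k.2
      have hs := sqrt_choose_ne_zero k
      have hXn : X ^ n = X ^ (n - (k : ℕ)) * X ^ (k : ℕ) := by
        rw [← pow_add, Nat.sub_add_cancel hk]
      simp only [mono, wigner]
      rw [← hP, Real.sqrt_div (Nat.cast_nonneg _), hXn, div_pow, Complex.ofReal_div]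
      field_simp
    have hsum : Matrix.vecMul (mono n X Y) (wigner n g) l =
        (Real.sqrt (n.choose l) : ℂ) * X ^ n * P.eval (Y / X) := by
      rw [hev, ← Fin.sum_univ_eq_sum_range (fun k => P.coeff k * (Y / X) ^ k), Finset.mul_sum]
      simp only [Matrix.vecMul, dotProduct, hterm]
    have hXn : X ^ n = X ^ (n - (l : ℕ)) * X ^ (l : ℕ) := by
      rw [← pow_add, Nat.sub_add_cancel hl]
    have e1 : X * g.1 0 0 + Y * g.1 1 0 = X * (g.1 0 0 + g.1 1 0 * (Y / X)) := by
      field_simp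
    have e2 : X * g.1 0 1 + Y * g.1 1 1 = X * (g.1 0 1 + g.1 1 1 * (Y / X)) := by
      field_simp
    rw [hsum, hev2, hXn, mono, e1, e2, mul_pow, mul_pow]
    ring
  have hd : Dense ({0}ᶜ : Set ℂ) := dense_compl_singleton 0
  have hc1 : Continuous fun X : ℂ => Matrix.vecMul (mono n X Y) (wigner n g) l := by
    simp only [Matrix.vecMul, dotProduct, mono]
    fun_prop
  have hc2 : Continuous fun X : ℂ =>
      mono n (X * g.1 0 0 + Y * g.1 1 0) (X * g.1 0 1 + Y * g.1 1 1) l := by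
    simp only [mono]
    fun_prop
  exact congrFun (Continuous.ext_on hd hc1 hc2 key) X

lemma wigner_mulVec_mono (n : ℕ) (g : SU2) (X Y : ℂ) :
    (wigner n g).mulVec (mono n X Y) =
      mono n (g.1 0 0 * X + g.1 0 1 * Y) (g.1 1 0 * X + g.1 1 1 * Y) := by
  refine eq_of_mono fun Z W => ?_
  rw [dotProduct_comm, Matrix.dotProduct_mulVec, mono_vecMul_wigner, mono_dotProduct,
    mono_dotProduct]
  ring

lemma mono_wigner_mono (n : ℕ) (g : SU2) (X Y Z W : ℂ) :
    mono n X Y ⬝ᵥ (wigner n g).mulVec (mono n Z W) =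
      (X * (g.1 0 0 * Z + g.1 0 1 * W) + Y * (g.1 1 0 * Z + g.1 1 1 * W)) ^ n := by
  rw [wigner_mulVec_mono, mono_dotProduct]

lemma wigner_mul (n : ℕ) (g g' : SU2) : wigner n (g * g') = wigner n g * wigner n g' := by
  refine matrix_eq_of_mono fun X Y Z W => ?_
  rw [← Matrix.mulVec_mulVec, wigner_mulVec_mono n g', mono_wigner_mono, mono_wigner_mono]
  simp only [Submonoid.coe_mul, Matrix.mul_apply, Fin.sum_univ_two]
  ring

lemma wigner_one (n : ℕ) : wigner n 1 = 1 := by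
  refine matrix_eq_of_mono fun X Y Z W => ?_
  rw [mono_wigner_mono, Matrix.one_mulVec, mono_dotProduct]
  simp

lemma star_mono (n : ℕ) (X Y : ℂ) : star (mono n X Y) = mono n (star X) (star Y) := by
  funext k
  simp [mono]

lemma inv_apply (g : SU2) (i j : Fin 2) : (g⁻¹).1 i j = star (g.1 j i) := rfl

lemma wigner_inv (n : ℕ) (g : SU2) : wigner n g⁻¹ = (wigner n g).conjTranspose := by
  refine matrix_eq_of_mono fun X Y Z W => ?_
  have h1 : mono n X Y = star (mono n (star X) (star Y)) := by simp [star_mono]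
  have h2 : mono n Z W = star (mono n (star Z) (star W)) := by simp [star_mono]
  rw [mono_wigner_mono, h1, h2, ← Matrix.star_vecMul, mono_vecMul_wigner,
    Matrix.star_dotProduct_star, mono_dotProduct]
  simp only [inv_apply, star_pow, star_add, star_mul', star_star]
  ring

lemma wigner_mul_conjTranspose (n : ℕ) (g : SU2) :
    wigner n g * (wigner n g).conjTranspose = 1 := by
  rw [← wigner_inv, ← wigner_mul, mul_inv_cancel, wigner_one]

lemma conjTranspose_mul_wigner (n : ℕ) (g : SU2) :
    (wigner n g).conjTranspose * wigner n g = 1 := by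
  rw [← wigner_inv, ← wigner_mul, inv_mul_cancel, wigner_one]

/-- The eigenvalue of `D^{n/2}(h_φ)` of weight `n/2 - k`. -/
def weight (n k : ℕ) (φ : ℝ) : ℂ := Complex.exp (Complex.I * (((n : ℂ) - 2 * k) * φ / 2))

lemma wigner_h (n : ℕ) (φ : ℝ) :
    wigner n (h φ) = Matrix.diagonal fun k : Fin (n + 1) => weight n k φ := by
  refine matrix_eq_of_mono fun X Y Z W => ?_
  rw [mono_wigner_mono]
  have hr : mono n X Y ⬝ᵥ (Matrix.diagonal fun k : Fin (n + 1) => weight n k φ).mulVec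
      (mono n Z W) = mono n X Y ⬝ᵥ
        mono n (Complex.exp (Complex.I * φ / 2) * Z) (Complex.exp (-(Complex.I * φ / 2)) * W) := by
    congr 1
    funext k
    have hk : (k : ℕ) ≤ n := Nat.lt_succ_iff.mp k.2
    have hw : weight n k φ = Complex.exp (Complex.I * φ / 2) ^ (n - (k : ℕ)) *
        Complex.exp (-(Complex.I * φ / 2)) ^ (k : ℕ) := by
      rw [← Complex.exp_nat_mul, ← Complex.exp_nat_mul, ← Complex.exp_add, weight]
      congr 1
      push_cast [hk]
      ring
    rw [Matrix.mulVec_diagonal, hw]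
    simp only [mono]
    ring
  rw [hr, mono_dotProduct]
  simp [h]

lemma wigner_column_zero (n : ℕ) (g : SU2) (k : Fin (n + 1)) :
    wigner n g k 0 = mono n (g.1 0 0) (g.1 1 0) k := by
  have hv : mono n 1 0 = Pi.single 0 1 := by
    funext l
    rcases eq_or_ne l 0 with rfl | hl
    · simp [mono]
    · have : (l : ℕ) ≠ 0 := fun h => hl (Fin.ext h)
      simp [mono, hl, this]
  have := congrFun (wigner_mulVec_mono n g 1 0) k
  rw [hv, Matrix.mulVec_single_one] at this
  simpa using this

/-- A quarter turn has no zero in its first column, so it moves the highest weight vector to one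
with a component in every weight. This cyclicity is the input for Schur's lemma. -/
lemma wigner_column_zero_ne_zero (n : ℕ) (k : Fin (n + 1)) :
    wigner n (a (Real.pi / 2)) k 0 ≠ 0 := by
  rw [wigner_column_zero, mono]
  have h1 : (Real.cos (Real.pi / 2 / 2) : ℂ) ≠ 0 := by
    rw [show Real.pi / 2 / 2 = Real.pi / 4 by ring, Real.cos_pi_div_four]
    simp
  have h2 : (Real.sin (Real.pi / 2 / 2) : ℂ) ≠ 0 := by
    rw [show Real.pi / 2 / 2 = Real.pi / 4 by ring, Real.sin_pi_div_four]
    simp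
  exact mul_ne_zero (mul_ne_zero (sqrt_choose_ne_zero k) (pow_ne_zero _ h1)) (pow_ne_zero _ h2)

/-! ### Continuity and boundedness of matrix coefficients -/

lemma continuous_entry (i j : Fin 2) : Continuous fun g : SU2 => g.1 i j :=
  (continuous_apply j).comp ((continuous_apply i).comp continuous_subtype_val)

lemma continuous_polynomial_coeff {X : Type*} [TopologicalSpace X] {a b c d : X → ℂ}
    (ha : Continuous a) (hb : Continuous b) (hc : Continuous c) (hd : Continuous d) (m n k : ℕ) :
    Continuous fun x => ((Polynomial.C (a x) + Polynomial.C (b x) * Polynomial.X) ^ m *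
      (Polynomial.C (c x) + Polynomial.C (d x) * Polynomial.X) ^ n).coeff k := by
  have step : ∀ (P : X → Polynomial ℂ) (u v : X → ℂ), Continuous u → Continuous v →
      (∀ k, Continuous fun x => (P x).coeff k) → ∀ k, Continuous fun x =>
        (P x * (Polynomial.C (u x) + Polynomial.C (v x) * Polynomial.X)).coeff k := by
    intro P u v hu hv hP k
    have : ∀ x, (P x * (Polynomial.C (u x) + Polynomial.C (v x) * Polynomial.X)).coeff k =
        (P x).coeff k * u x + (P x * Polynomial.X).coeff k * v x := by
      intro x
      rw [mul_add, Polynomial.coeff_add, Polynomial.coeff_mul_C, mul_left_comm,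
        Polynomial.coeff_C_mul, mul_comm (v x)]
    simp only [this]
    refine ((hP k).mul hu).add (Continuous.mul ?_ hv)
    cases k with
    | zero => simpa using continuous_const
    | succ k => simpa only [Polynomial.coeff_mul_X] using hP k
  have h1 : ∀ m k, Continuous fun x =>
      ((Polynomial.C (a x) + Polynomial.C (b x) * Polynomial.X) ^ m).coeff k := by
    intro m
    induction m with
    | zero => intro k; simpa using continuous_const
    | succ m ih => simpa only [pow_succ] using step _ a b ha hb ih
  induction n generalizing k with
  | zero => simpa using h1 m k
  | succ n ih => simpa only [pow_succ, ← mul_assoc] using step _ c d hc hd (fun k => ih k) k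

lemma continuous_wigner (n : ℕ) (k l : Fin (n + 1)) : Continuous fun g => wigner n g k l :=
  continuous_const.mul (continuous_polynomial_coeff (continuous_entry 0 0) (continuous_entry 1 0)
    (continuous_entry 0 1) (continuous_entry 1 1) _ _ _)

lemma norm_wigner_le_one (n : ℕ) (g : SU2) (k l : Fin (n + 1)) : ‖wigner n g k l‖ ≤ 1 :=
  entry_norm_bound_of_unitary (U := wigner n g)
    (Matrix.mem_unitaryGroup_iff.mpr (wigner_mul_conjTranspose n g)) k l

/-! ### Schur's lemma -/

/-- An intertwiner commutes with the torus, so it preserves weights. -/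
lemma intertwiner_weight {m n : ℕ} {M : Matrix (Fin (m + 1)) (Fin (n + 1)) ℂ}
    (hM : ∀ g, M * wigner n g = wigner m g * M) (k : Fin (m + 1)) (l : Fin (n + 1))
    (hkl : (m : ℤ) - 2 * k ≠ n - 2 * l) : M k l = 0 := by
  set d : ℤ := ((m : ℤ) - 2 * k) - (n - 2 * l) with hd
  have hd0 : (d : ℂ) ≠ 0 := Int.cast_ne_zero.mpr (sub_ne_zero.mpr hkl)
  -- At this angle the eigenvalues for two weights differing by d/2 are opposite.
  have := congrFun (congrFun (hM (h (2 * Real.pi / d))) k) l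
  rw [wigner_h, wigner_h, Matrix.mul_diagonal, Matrix.diagonal_mul] at this
  have hw : weight m k (2 * Real.pi / d) = -weight n l (2 * Real.pi / d) := by
    rw [weight, weight, ← mul_neg_one, ← Complex.exp_pi_mul_I, ← Complex.exp_add]
    congr 1
    have hm : ((m : ℂ) - 2 * (k : ℕ)) = d + ((n : ℂ) - 2 * (l : ℕ)) := by
      rw [hd]; push_cast; ring
    rw [hm]
    push_cast
    field_simp
    ring
  rw [hw] at this
  have h2 : (2 * weight n l (2 * Real.pi / d)) * M k l = 0 := by linear_combination this
  exact (mul_eq_zero.mp h2).resolve_left (mul_ne_zero two_ne_zero (Complex.exp_ne_zero _))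

/-- The highest weight vector is cyclic: applying M to its rotate by a(π/2) gives 0, while weight
preservation leaves a single term of that sum, with a nonzero coefficient. -/
lemma intertwiner_eq_zero {m n : ℕ} {M : Matrix (Fin (m + 1)) (Fin (n + 1)) ℂ}
    (hM : ∀ g, M * wigner n g = wigner m g * M) (h0 : ∀ k, M k 0 = 0) : M = 0 := by
  funext k l
  by_cases hkl : (m : ℤ) - 2 * k = n - 2 * l
  · have := congrFun (congrFun (hM (a (Real.pi / 2))) k) 0
    simp only [Matrix.mul_apply, h0, mul_zero, Finset.sum_const_zero] at this
    rw [Finset.sum_eq_single l] at this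
    · exact (mul_eq_zero.mp this).resolve_right (wigner_column_zero_ne_zero n l)
    · intro l' _ hl'
      rw [intertwiner_weight hM k l', zero_mul]
      intro h
      exact hl' (Fin.ext (by omega))
    · simp
  · exact intertwiner_weight hM k l hkl

/-- The highest weight of the larger representation does not occur in the smaller one, so the first
column of M vanishes. -/
lemma intertwiner_eq_zero_of_lt {m n : ℕ} (hmn : m < n)
    {M : Matrix (Fin (m + 1)) (Fin (n + 1)) ℂ}
    (hM : ∀ g, M * wigner n g = wigner m g * M) : M = 0 := by
  refine intertwiner_eq_zero hM fun k => intertwiner_weight hM k 0 ?_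
  simp only [Fin.val_zero]
  omega

lemma intertwiner_eq_smul_one {n : ℕ} {M : Matrix (Fin (n + 1)) (Fin (n + 1)) ℂ}
    (hM : ∀ g, M * wigner n g = wigner n g * M) : M = M 0 0 • 1 := by
  rw [← sub_eq_zero]
  refine intertwiner_eq_zero (fun g => ?_) fun k => ?_
  · rw [Matrix.sub_mul, Matrix.mul_sub, hM, Matrix.smul_mul, Matrix.mul_smul, Matrix.one_mul,
      Matrix.mul_one]
  · rcases eq_or_ne k 0 with rfl | hk
    · simp
    · rw [Matrix.sub_apply, intertwiner_weight hM k 0]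
      · simp [Matrix.one_apply_ne hk]
      · have : (k : ℕ) ≠ 0 := fun h => hk (Fin.ext h)
        simp only [Fin.val_zero]
        omega

lemma smul_one_eq_trace_div {n : ℕ} {M : Matrix (Fin (n + 1)) (Fin (n + 1)) ℂ}
    (hM : ∀ g, M * wigner n g = wigner n g * M) : M = (M.trace / (n + 1)) • 1 := by
  have h1 := intertwiner_eq_smul_one hM
  have h2 : M.trace = M 0 0 * (n + 1) := by
    conv_lhs => rw [h1]
    simp [Matrix.trace_smul]
  have h3 : (n : ℂ) + 1 ≠ 0 := Nat.cast_add_one_ne_zero n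
  rw [h2, mul_div_assoc, div_self h3, mul_one, ← h1]

end DoubleSU2

end

noncomputable section

namespace DoubleSU2

/-! ### Haar measure -/

instance : SecondCountableTopology SU2 :=
  have : SecondCountableTopology (Matrix (Fin 2) (Fin 2) ℂ) :=
    inferInstanceAs (SecondCountableTopology (Fin 2 → Fin 2 → ℂ))
  TopologicalSpace.Subtype.secondCountableTopology _

instance : IsProbabilityMeasure haar := ⟨Measure.haarMeasure_self⟩

instance : haar.IsHaarMeasure := inferInstanceAs (Measure.haarMeasure ⊤).IsHaarMeasure

/-- A right translate of the measure is again a Haar probability measure, and there is only one. -/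
instance : haar.IsMulRightInvariant where
  map_mul_right_eq_self g := by
    have : IsProbabilityMeasure (haar.map (· * g)) :=
      Measure.isProbabilityMeasure_map (by fun_prop)
    exact Measure.isHaarMeasure_eq_of_isProbabilityMeasure _ _

lemma integrable_of_continuous {f : SU2 → ℂ} (hf : Continuous f) : Integrable f haar :=
  hf.integrable_of_hasCompactSupport (HasCompactSupport.of_compactSpace f)

/-- The average of `D(x) A D(x)*` over the group. -/
def conjAverage (n : ℕ) (A : Matrix (Fin (n + 1)) (Fin (n + 1)) ℂ) :
    Matrix (Fin (n + 1)) (Fin (n + 1)) ℂ := fun k l =>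
  ∫ x, (wigner n x * A * (wigner n x).conjTranspose) k l ∂haar

lemma continuous_conj_wigner (n : ℕ) (A : Matrix (Fin (n + 1)) (Fin (n + 1)) ℂ)
    (k l : Fin (n + 1)) :
    Continuous fun x => (wigner n x * A * (wigner n x).conjTranspose) k l := by
  have := continuous_wigner n
  simp only [Matrix.mul_apply, Matrix.conjTranspose_apply]
  fun_prop

lemma conjAverage_comm (n : ℕ) (A : Matrix (Fin (n + 1)) (Fin (n + 1)) ℂ) (g : SU2) :
    conjAverage n A * wigner n g = wigner n g * conjAverage n A := by
  -- Conjugating the average by D(g) is the substitution x ↦ g x under the Haar integral.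
  have key : wigner n g * conjAverage n A * (wigner n g).conjTranspose = conjAverage n A := by
    funext k l
    have hl := integral_mul_left_eq_self (μ := haar)
      (fun x => (wigner n x * A * (wigner n x).conjTranspose) k l) g
    rw [conjAverage, ← hl]
    simp only [Matrix.mul_apply (M := wigner n g * conjAverage n A),
      Matrix.mul_apply (M := wigner n g), conjAverage]
    simp only [Finset.sum_mul, ← integral_const_mul, ← integral_mul_const]
    have hint : ∀ i j, Integrable (fun x => wigner n g k j *
        (wigner n x * A * (wigner n x).conjTranspose) j i * (wigner n g).conjTranspose i l) haar :=
      fun i j => ((integrable_of_continuous (continuous_conj_wigner n A j i)).const_mul _).mul_const _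
    rw [show (∑ i, ∑ j, ∫ x, wigner n g k j *
        (wigner n x * A * (wigner n x).conjTranspose) j i * (wigner n g).conjTranspose i l ∂haar) =
        ∫ x, ∑ i, ∑ j, wigner n g k j * (wigner n x * A * (wigner n x).conjTranspose) j i *
          (wigner n g).conjTranspose i l ∂haar from ?_]
    · congr 1
      funext x
      rw [wigner_mul, Matrix.conjTranspose_mul,
        show wigner n g * wigner n x * A * ((wigner n x).conjTranspose *
          (wigner n g).conjTranspose) = wigner n g * (wigner n x * A * (wigner n x).conjTranspose) *
          (wigner n g).conjTranspose by simp only [Matrix.mul_assoc]]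
      rw [Matrix.mul_apply]
      refine Finset.sum_congr rfl fun i _ => ?_
      rw [Matrix.mul_apply, Finset.sum_mul]
    · rw [integral_finsetSum _ fun i _ => integrable_finsetSum _ fun j _ => hint i j]
      refine Finset.sum_congr rfl fun i _ => ?_
      rw [integral_finsetSum _ fun j _ => hint i j]
  conv_lhs => rw [← key]
  rw [Matrix.mul_assoc, conjTranspose_mul_wigner, Matrix.mul_one]

/-- By Schur's lemma the average is a scalar, and conjugation preserves the trace, which fixes the
scalar. -/
lemma conjAverage_eq (n : ℕ) (A : Matrix (Fin (n + 1)) (Fin (n + 1)) ℂ) :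
    conjAverage n A = (A.trace / (n + 1)) • 1 := by
  have htr : (conjAverage n A).trace = A.trace := by
    simp only [Matrix.trace, Matrix.diag, conjAverage]
    rw [← integral_finsetSum _ fun i _ =>
      integrable_of_continuous (continuous_conj_wigner n A i i)]
    have : ∀ x, ∑ i, (wigner n x * A * (wigner n x).conjTranspose) i i = A.trace := by
      intro x
      change (wigner n x * A * (wigner n x).conjTranspose).trace = _
      rw [Matrix.trace_mul_comm, ← Matrix.mul_assoc, conjTranspose_mul_wigner, Matrix.one_mul]
    simp [this, Matrix.trace]
  rw [← htr]
  exact smul_one_eq_trace_div (conjAverage_comm n A)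

/-! ### The Cartan decomposition -/

lemma continuous_h : Continuous h := by
  refine Continuous.subtype_mk ?_ _
  refine continuous_matrix fun i j => ?_
  fin_cases i <;> fin_cases j <;> simp <;> fun_prop

lemma continuous_a : Continuous a := by
  refine Continuous.subtype_mk ?_ _
  refine continuous_matrix fun i j => ?_
  fin_cases i <;> fin_cases j <;>
    simp only [Fin.zero_eta, Fin.mk_one, Fin.isValue, Matrix.of_apply, Matrix.cons_val',
      Matrix.cons_val_zero, Matrix.cons_val_one, Matrix.cons_val_fin_one] <;> fun_prop

lemma star_eq_adjugate (g : SU2) : star g.1 = g.1.adjugate := by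
  have hg := Matrix.mem_specialUnitaryGroup_iff.mp g.2
  have h1 : star g.1 * g.1 = 1 := Matrix.mem_unitaryGroup_iff'.mp hg.1
  calc star g.1 = star g.1 * (g.1 * g.1.adjugate) := by
        rw [Matrix.mul_adjugate, hg.2, one_smul, mul_one]
    _ = g.1.adjugate := by rw [← mul_assoc, h1, one_mul]

lemma apply_one_one (g : SU2) : g.1 1 1 = star (g.1 0 0) := by
  have := congrFun (congrFun (star_eq_adjugate g) 0) 0
  rw [Matrix.adjugate_fin_two] at this
  simpa [Matrix.star_apply] using this.symm

lemma apply_zero_one (g : SU2) : g.1 0 1 = -star (g.1 1 0) := by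
  have := congrFun (congrFun (star_eq_adjugate g) 0) 1
  rw [Matrix.adjugate_fin_two] at this
  have h2 : star (g.1 1 0) = -g.1 0 1 := by simpa [Matrix.star_apply] using this
  rw [h2, neg_neg]

lemma ext_of_first_column {g g' : SU2} (h0 : g.1 0 0 = g'.1 0 0) (h1 : g.1 1 0 = g'.1 1 0) :
    g = g' := by
  refine Subtype.ext ?_
  funext i j
  fin_cases i <;> fin_cases j
  · exact h0
  · exact (apply_zero_one g).trans ((congrArg (fun z => -star z) h1).trans (apply_zero_one g').symm)
  · exact h1
  · exact (apply_one_one g).trans ((congrArg star h0).trans (apply_one_one g').symm)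

lemma normSq_add_normSq (g : SU2) : ‖g.1 0 0‖ ^ 2 + ‖g.1 1 0‖ ^ 2 = 1 := by
  have hdet := (Matrix.mem_specialUnitaryGroup_iff.mp g.2).2
  rw [Matrix.det_fin_two, apply_one_one, apply_zero_one, neg_mul, sub_neg_eq_add] at hdet
  have e1 : g.1 0 0 * star (g.1 0 0) = ((‖g.1 0 0‖ ^ 2 : ℝ) : ℂ) := by
    simpa using Complex.mul_conj' (g.1 0 0)
  have e2 : star (g.1 1 0) * g.1 1 0 = ((‖g.1 1 0‖ ^ 2 : ℝ) : ℂ) := by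
    simpa using Complex.conj_mul' (g.1 1 0)
  rw [e1, e2] at hdet
  exact_mod_cast hdet

/-- The square of the modulus of the upper left entry. -/
def cosSq (g : SU2) : ℝ := ‖g.1 0 0‖ ^ 2

lemma continuous_cosSq : Continuous cosSq := (continuous_entry 0 0).norm.pow 2

lemma cosSq_nonneg (g : SU2) : 0 ≤ cosSq g := sq_nonneg _

lemma cosSq_le_one (g : SU2) : cosSq g ≤ 1 := by
  have := normSq_add_normSq g
  have h2 := sq_nonneg ‖g.1 1 0‖
  rw [cosSq]
  linarith

/-- The rotation `a_θ` with `cos²(θ/2) = t`. -/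
def aSq (t : ℝ) : SU2 := a (Real.arccos (2 * t - 1))

lemma continuous_aSq : Continuous aSq := continuous_a.comp (by fun_prop)

/-- Euler angles: the moduli of the first column of g determine the rotation, their arguments the
two torus factors. -/
lemma exists_cartan (g : SU2) : ∃ ξ η : ℝ, g = h ξ * aSq (cosSq g) * h η := by
  set θ := Real.arccos (2 * cosSq g - 1) with hθ
  have h0 := cosSq_nonneg g
  have h1 := cosSq_le_one g
  have hcos : Real.cos θ = 2 * cosSq g - 1 := Real.cos_arccos (by linarith) (by linarith)
  have hc : Real.cos (θ / 2) = ‖g.1 0 0‖ := by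
    rw [Real.cos_half (by linarith [Real.arccos_nonneg (2 * cosSq g - 1), Real.pi_pos])
      (Real.arccos_le_pi _), hcos, show (1 + (2 * cosSq g - 1)) / 2 = cosSq g by ring, cosSq,
      Real.sqrt_sq (norm_nonneg _)]
  have hs : Real.sin (θ / 2) = ‖g.1 1 0‖ := by
    rw [Real.sin_half_eq_sqrt (Real.arccos_nonneg _)
      (by linarith [Real.arccos_le_pi (2 * cosSq g - 1), Real.pi_pos]), hcos,
      show (1 - (2 * cosSq g - 1)) / 2 = ‖g.1 1 0‖ ^ 2 by
        rw [cosSq]; linarith [normSq_add_normSq g],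
      Real.sqrt_sq (norm_nonneg _)]
  -- The first column of h_ξ a h_η carries the phases (ξ + η)/2 and (η − ξ)/2.
  refine ⟨Complex.arg (g.1 0 0) - Complex.arg (g.1 1 0),
    Complex.arg (g.1 0 0) + Complex.arg (g.1 1 0), ext_of_first_column ?_ ?_⟩
  · have := Complex.norm_mul_exp_arg_mul_I (g.1 0 0)
    rw [← hc] at this
    simp only [aSq, ← hθ, h, a, Submonoid.coe_mul, Matrix.mul_apply, Fin.sum_univ_two]
    conv_lhs => rw [← this]
    simp only [Matrix.of_apply, Matrix.cons_val', Matrix.cons_val_zero, Matrix.cons_val_one,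
      Matrix.cons_val_fin_one, mul_zero, zero_mul, add_zero]
    rw [mul_right_comm, ← Complex.exp_add, mul_comm]
    congr 2
    push_cast
    ring
  · have := Complex.norm_mul_exp_arg_mul_I (g.1 1 0)
    rw [← hs] at this
    simp only [aSq, ← hθ, h, a, Submonoid.coe_mul, Matrix.mul_apply, Fin.sum_univ_two]
    conv_lhs => rw [← this]
    simp only [Matrix.of_apply, Matrix.cons_val', Matrix.cons_val_zero, Matrix.cons_val_one,
      Matrix.cons_val_fin_one, mul_zero, zero_mul, add_zero, zero_add]
    rw [mul_right_comm, ← Complex.exp_add, mul_comm]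
    congr 2
    push_cast
    ring

/-! ### The law of `cosSq` -/

/-- Since D_{00}(g) = g₀₀^n, this is the Schur average of the projector on the highest weight
vector. The values are the moments of the uniform law on [0,1]. -/
lemma integral_cosSq_pow (n : ℕ) : ∫ g, cosSq g ^ n ∂haar = 1 / (n + 1) := by
  have key := congrFun (congrFun (conjAverage_eq n
    (Matrix.single 0 0 1 : Matrix (Fin (n + 1)) (Fin (n + 1)) ℂ)) 0) 0
  have hx : ∀ x, (wigner n x * (Matrix.single 0 0 1 : Matrix (Fin (n + 1)) (Fin (n + 1)) ℂ) *
      (wigner n x).conjTranspose) 0 0 =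
      ((cosSq x ^ n : ℝ) : ℂ) := by
    intro x
    have h0 : wigner n x 0 0 = x.1 0 0 ^ n := by
      rw [wigner_column_zero]
      simp [mono]
    rw [Matrix.mul_assoc, Matrix.mul_apply, Finset.sum_eq_single 0]
    · rw [Matrix.single_mul_apply_same, one_mul, Matrix.conjTranspose_apply, h0, star_pow,
        ← mul_pow]
      have := Complex.mul_conj' (x.1 0 0)
      rw [show star (x.1 0 0) = (starRingEnd ℂ) (x.1 0 0) from rfl, this, cosSq]
      push_cast
      rfl
    · intro b _ hb
      rw [Matrix.single_mul_apply_of_ne _ _ _ _ _ hb, mul_zero]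
    · simp
  simp only [conjAverage, hx] at key
  rw [integral_complex_ofReal] at key
  simp only [Matrix.trace_single_eq_same, Matrix.smul_apply, Matrix.one_apply_eq, smul_eq_mul,
    mul_one] at key
  refine Complex.ofReal_injective ?_
  rw [key]
  push_cast
  rfl

/-- The moment problem on a compact interval is determinate: Weierstrass approximation passes from
monomials to continuous functions. -/
lemma measure_eq_of_moments {μ ν : Measure ℝ} [IsProbabilityMeasure μ] [IsProbabilityMeasure ν]
    (hμ : ∀ᵐ x ∂μ, x ∈ Set.Icc (0 : ℝ) 1) (hν : ∀ᵐ x ∂ν, x ∈ Set.Icc (0 : ℝ) 1)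
    (hm : ∀ n : ℕ, ∫ x, x ^ n ∂μ = ∫ x, x ^ n ∂ν) : μ = ν := by
  have hint : ∀ (ρ : Measure ℝ) [IsProbabilityMeasure ρ], (∀ᵐ x ∂ρ, x ∈ Set.Icc (0 : ℝ) 1) →
      ∀ n : ℕ, Integrable (fun x => x ^ n) ρ := by
    intro ρ _ hρ n
    refine Integrable.of_bound (by fun_prop) 1 ?_
    filter_upwards [hρ] with x hx
    rw [norm_pow, Real.norm_of_nonneg hx.1]
    exact pow_le_one₀ hx.1 hx.2
  have hpi : ∀ (ρ : Measure ℝ) [IsProbabilityMeasure ρ], (∀ᵐ x ∂ρ, x ∈ Set.Icc (0 : ℝ) 1) →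
      ∀ p : Polynomial ℝ, Integrable (fun x => p.eval x) ρ := by
    intro ρ _ hρ p
    simp only [Polynomial.eval_eq_sum_range]
    exact integrable_finsetSum _ fun i _ => (hint ρ hρ i).const_mul _
  have hpoly : ∀ p : Polynomial ℝ, ∫ x, p.eval x ∂μ = ∫ x, p.eval x ∂ν := by
    intro p
    simp only [Polynomial.eval_eq_sum_range]
    rw [integral_finsetSum _ fun i _ => (hint μ hμ i).const_mul _,
      integral_finsetSum _ fun i _ => (hint ν hν i).const_mul _]
    simp only [integral_const_mul, hm]
  refine ext_of_forall_integral_eq_of_IsFiniteMeasure fun f => ?_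
  have hbound : ∀ ε : ℝ, 0 < ε → |∫ x, f x ∂μ - ∫ x, f x ∂ν| ≤ ε + ε := by
    intro ε hε
    obtain ⟨p, hp⟩ := exists_polynomial_near_of_continuousOn 0 1 f f.continuous.continuousOn ε hε
    have hb : ∀ (ρ : Measure ℝ) [IsProbabilityMeasure ρ], (∀ᵐ x ∂ρ, x ∈ Set.Icc (0 : ℝ) 1) →
        |∫ x, f x ∂ρ - ∫ x, p.eval x ∂ρ| ≤ ε := by
      intro ρ _ hρ
      rw [← integral_sub (f.integrable ρ) (hpi ρ hρ p), ← Real.norm_eq_abs]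
      have := norm_integral_le_of_norm_le_const (μ := ρ) (f := fun x => f x - p.eval x) (C := ε) (by
        filter_upwards [hρ] with x hx
        rw [Real.norm_eq_abs, abs_sub_comm]
        exact (hp x hx).le)
      simpa using this
    have h1 := hb μ hμ
    have h2 := hb ν hν
    rw [hpoly p] at h1
    rw [abs_le] at *
    constructor <;> linarith [h1.1, h1.2, h2.1, h2.2]
  refine sub_eq_zero.mp (abs_eq_zero.mp (le_antisymm ?_ (abs_nonneg _)))
  refine le_of_forall_pos_le_add fun ε hε => ?_
  have := hbound (ε / 2) (by linarith)
  linarith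

/-- Equality of moments yields the integration formula for torus-bi-invariant functions without any
coordinate expression of Haar measure. -/
lemma map_cosSq_haar : haar.map cosSq = volume.restrict (Set.Icc 0 1) := by
  have hc := continuous_cosSq.measurable
  have : IsProbabilityMeasure (haar.map cosSq) := Measure.isProbabilityMeasure_map hc.aemeasurable
  have : IsProbabilityMeasure (volume.restrict (Set.Icc (0 : ℝ) 1)) := ⟨by simp⟩
  refine measure_eq_of_moments ?_ (ae_restrict_mem measurableSet_Icc) fun n => ?_
  · refine (ae_map_iff hc.aemeasurable measurableSet_Icc).mpr ?_
    exact Eventually.of_forall fun g => ⟨cosSq_nonneg g, cosSq_le_one g⟩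
  · rw [integral_map hc.aemeasurable (by fun_prop), integral_cosSq_pow,
      integral_Icc_eq_integral_Ioc, ← intervalIntegral.integral_of_le zero_le_one, integral_pow]
    simp

lemma eq_aSq_of_invariant {E : Type*} {H : SU2 → E} (hl : ∀ ξ g, H (h ξ * g) = H g)
    (hr : ∀ ξ g, H (g * h ξ) = H g) (g : SU2) : H g = H (aSq (cosSq g)) := by
  obtain ⟨ξ, η, hg⟩ := exists_cartan g
  conv_lhs => rw [hg, hr, hl]

lemma lintegral_of_invariant {H : SU2 → ℝ≥0∞} (hm : Measurable H)
    (hl : ∀ ξ g, H (h ξ * g) = H g) (hr : ∀ ξ g, H (g * h ξ) = H g) :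
    ∫⁻ g, H g ∂haar = ∫⁻ t in Set.Icc 0 1, H (aSq t) := by
  rw [← map_cosSq_haar, lintegral_map (f := fun t => H (aSq t)) (hm.comp continuous_aSq.measurable)
    continuous_cosSq.measurable]
  exact lintegral_congr fun g => eq_aSq_of_invariant hl hr g

lemma integral_of_invariant {H : SU2 → ℂ} (hm : StronglyMeasurable H)
    (hl : ∀ ξ g, H (h ξ * g) = H g) (hr : ∀ ξ g, H (g * h ξ) = H g) :
    ∫ g, H g ∂haar = ∫ t in Set.Icc 0 1, H (aSq t) := by
  rw [← map_cosSq_haar, integral_map (f := fun t => H (aSq t)) continuous_cosSq.measurable.aemeasurable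
    (hm.comp_measurable continuous_aSq.measurable).aestronglyMeasurable]
  exact integral_congr_ae (Eventually.of_forall fun g => eq_aSq_of_invariant hl hr g)

lemma integrableOn_of_invariant {H : SU2 → ℂ} (hm : StronglyMeasurable H)
    (hl : ∀ ξ g, H (h ξ * g) = H g) (hr : ∀ ξ g, H (g * h ξ) = H g) (hi : Integrable H haar) :
    IntegrableOn (fun t => H (aSq t)) (Set.Icc 0 1) := by
  rw [IntegrableOn, ← map_cosSq_haar, integrable_map_measure (g := fun t => H (aSq t))
    (hm.comp_measurable continuous_aSq.measurable).aestronglyMeasurable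
    continuous_cosSq.measurable.aemeasurable]
  exact hi.congr (Eventually.of_forall fun g => eq_aSq_of_invariant hl hr g)

/-! ### The change of variables to the class angle of a product -/

/-- The cosine decreases on [0, π], where θ₃/2 and |θ₁ − θ₂|/2 lie. If (θ₁ + θ₂)/2 exceeds π it is
reflected to 2π − (θ₁ + θ₂)/2, which is where the bound θ₁ + θ₂ + θ₃ ≤ 4π enters. -/
lemma admissible_iff {θ₁ θ₂ θ₃ : ℝ} (h₁ : 0 < θ₁) (h₁' : θ₁ < 2 * Real.pi) (h₂ : 0 < θ₂)
    (h₂' : θ₂ < 2 * Real.pi) : Admissible θ₁ θ₂ θ₃ ↔ 0 ≤ θ₃ ∧ θ₃ ≤ 2 * Real.pi ∧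
      Real.cos ((θ₁ + θ₂) / 2) ≤ Real.cos (θ₃ / 2) ∧
      Real.cos (θ₃ / 2) ≤ Real.cos ((θ₁ - θ₂) / 2) := by
  have hd : Real.cos ((θ₁ - θ₂) / 2) = Real.cos (|θ₁ - θ₂| / 2) := by
    rw [← Real.cos_abs, abs_div, abs_two]
  have hs : Real.cos ((θ₁ + θ₂) / 2) = Real.cos (2 * Real.pi - (θ₁ + θ₂) / 2) := by
    rw [Real.cos_two_pi_sub]
  have hd2 : |θ₁ - θ₂| < 2 * Real.pi := by rw [abs_lt]; constructor <;> linarith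
  have hd0 := abs_nonneg (θ₁ - θ₂)
  constructor
  · rintro ⟨a1, a2, a3⟩
    have h0 : 0 ≤ θ₃ := hd0.trans a1
    have hpi : θ₃ ≤ 2 * Real.pi := by linarith
    refine ⟨h0, hpi, ?_, ?_⟩
    · rcases le_total ((θ₁ + θ₂) / 2) Real.pi with hle | hle
      · exact Real.cos_le_cos_of_nonneg_of_le_pi (by linarith) hle (by linarith)
      · rw [hs]
        exact Real.cos_le_cos_of_nonneg_of_le_pi (by linarith) (by linarith) (by linarith)
    · rw [hd]
      exact Real.cos_le_cos_of_nonneg_of_le_pi (by linarith) (by linarith) (by linarith)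
  · rintro ⟨h0, hpi, c1, c2⟩
    refine ⟨?_, ?_, ?_⟩
    · by_contra hlt
      rw [not_le] at hlt
      rw [hd] at c2
      exact absurd c2 (not_le.mpr
        (Real.cos_lt_cos_of_nonneg_of_le_pi (by linarith) (by linarith) (by linarith)))
    · by_contra hlt
      rw [not_le] at hlt
      exact absurd c1 (not_le.mpr
        (Real.cos_lt_cos_of_nonneg_of_le_pi (by linarith) (by linarith) (by linarith)))
    · by_contra hlt
      rw [not_le] at hlt
      rw [hs] at c1
      exact absurd c1 (not_le.mpr
        (Real.cos_lt_cos_of_nonneg_of_le_pi (by linarith) (by linarith) (by linarith)))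

/-- The parameter `cos²(θ/2)` of `θ = relAngle θ₁ θ₂ θ₃`. -/
def relCosSq (θ₁ θ₂ θ₃ : ℝ) : ℝ :=
  (1 + (Real.cos (θ₁ / 2) * Real.cos (θ₂ / 2) - Real.cos (θ₃ / 2)) /
    (Real.sin (θ₁ / 2) * Real.sin (θ₂ / 2))) / 2

lemma a_relAngle (θ₁ θ₂ θ₃ : ℝ) : a (relAngle θ₁ θ₂ θ₃) = aSq (relCosSq θ₁ θ₂ θ₃) := by
  rw [aSq, relAngle, relCosSq]
  congr 2
  ring

/-- The Jacobian `dt/dθ₃` of `t = cos²(θ/2)`. -/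
def relJacobian (θ₁ θ₂ θ₃ : ℝ) : ℝ :=
  Real.sin (θ₃ / 2) / (4 * (Real.sin (θ₁ / 2) * Real.sin (θ₂ / 2)))

lemma hasDerivAt_relCosSq (θ₁ θ₂ θ₃ : ℝ) :
    HasDerivAt (relCosSq θ₁ θ₂) (relJacobian θ₁ θ₂ θ₃) θ₃ := by
  have h1 : HasDerivAt (fun x : ℝ => Real.cos (x / 2)) (-Real.sin (θ₃ / 2) * (1 / 2)) θ₃ :=
    HasDerivAt.comp (h₂ := Real.cos) θ₃ (Real.hasDerivAt_cos (θ₃ / 2))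
      ((hasDerivAt_id θ₃).div_const 2)
  have h2 := (((h1.const_sub (Real.cos (θ₁ / 2) * Real.cos (θ₂ / 2))).div_const
    (Real.sin (θ₁ / 2) * Real.sin (θ₂ / 2))).const_add 1).div_const 2
  refine h2.congr_deriv ?_
  rw [relJacobian]
  ring

section

variable {θ₁ θ₂ : ℝ} (h₁ : 0 < θ₁) (h₁' : θ₁ < 2 * Real.pi) (h₂ : 0 < θ₂)
  (h₂' : θ₂ < 2 * Real.pi)

lemma measurableSet_admissible (θ₁ θ₂ : ℝ) : MeasurableSet {θ₃ | Admissible θ₁ θ₂ θ₃} := by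
  have : {θ₃ | Admissible θ₁ θ₂ θ₃} = Set.Icc |θ₁ - θ₂| (min (θ₁ + θ₂) (4 * Real.pi - θ₁ - θ₂)) := by
    ext θ₃
    simp only [Admissible, Set.mem_ofPred_eq, Set.mem_Icc, le_min_iff]
    constructor
    · rintro ⟨a, b, c⟩
      exact ⟨a, b, by linarith⟩
    · rintro ⟨a, b, c⟩
      exact ⟨a, b, by linarith⟩
  rw [this]
  exact measurableSet_Icc

include h₁ h₁' in
lemma sin_half_pos : 0 < Real.sin (θ₁ / 2) :=
  Real.sin_pos_of_pos_of_lt_pi (by linarith) (by linarith)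

include h₁ h₁' h₂ h₂'

/-- `relCosSq` is affine in cos(θ₃/2), and admissibility says that this cosine runs between A − B
and A + B, with A the product of the cosines and B that of the sines. -/
lemma image_relCosSq : relCosSq θ₁ θ₂ '' {θ₃ | Admissible θ₁ θ₂ θ₃} = Set.Icc 0 1 := by
  have hB : 0 < Real.sin (θ₁ / 2) * Real.sin (θ₂ / 2) :=
    mul_pos (sin_half_pos h₁ h₁') (sin_half_pos h₂ h₂')
  have hadd : Real.cos ((θ₁ + θ₂) / 2) = Real.cos (θ₁ / 2) * Real.cos (θ₂ / 2) -
      Real.sin (θ₁ / 2) * Real.sin (θ₂ / 2) := by rw [add_div, Real.cos_add]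
  have hsub : Real.cos ((θ₁ - θ₂) / 2) = Real.cos (θ₁ / 2) * Real.cos (θ₂ / 2) +
      Real.sin (θ₁ / 2) * Real.sin (θ₂ / 2) := by rw [sub_div, Real.cos_sub]
  ext t
  simp only [Set.mem_image, Set.mem_ofPred_eq, admissible_iff h₁ h₁' h₂ h₂', hadd, hsub, Set.mem_Icc]
  constructor
  · rintro ⟨θ₃, ⟨-, -, c1, c2⟩, rfl⟩
    have e1 : -1 ≤ (Real.cos (θ₁ / 2) * Real.cos (θ₂ / 2) - Real.cos (θ₃ / 2)) /
        (Real.sin (θ₁ / 2) * Real.sin (θ₂ / 2)) := by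
      rw [le_div_iff₀ hB]; linarith
    have e2 : (Real.cos (θ₁ / 2) * Real.cos (θ₂ / 2) - Real.cos (θ₃ / 2)) /
        (Real.sin (θ₁ / 2) * Real.sin (θ₂ / 2)) ≤ 1 := by
      rw [div_le_iff₀ hB]; linarith
    rw [relCosSq]
    constructor <;> linarith
  · rintro ⟨t0, t1⟩
    set B := Real.sin (θ₁ / 2) * Real.sin (θ₂ / 2)
    set A := Real.cos (θ₁ / 2) * Real.cos (θ₂ / 2)
    have hc1 : A - B ≤ A - B * (2 * t - 1) := by nlinarith
    have hc2 : A - B * (2 * t - 1) ≤ A + B := by nlinarith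
    have hcos : Real.cos (2 * Real.arccos (A - B * (2 * t - 1)) / 2) = A - B * (2 * t - 1) := by
      rw [mul_div_cancel_left₀ _ two_ne_zero]
      exact Real.cos_arccos (by linarith [Real.neg_one_le_cos ((θ₁ + θ₂) / 2)])
        (by linarith [Real.cos_le_one ((θ₁ - θ₂) / 2)])
    -- Obtained by solving `relCosSq` = t for θ₃; the argument of arccos lies in [−1, 1] because A −
    -- B and A + B are cosines.
    refine ⟨2 * Real.arccos (A - B * (2 * t - 1)), ⟨?_, ?_, ?_, ?_⟩, ?_⟩
    · linarith [Real.arccos_nonneg (A - B * (2 * t - 1))]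
    · linarith [Real.arccos_le_pi (A - B * (2 * t - 1))]
    · rw [hcos]; exact hc1
    · rw [hcos]; exact hc2
    · rw [relCosSq, hcos]
      change (1 + (A - (A - B * (2 * t - 1))) / B) / 2 = t
      field_simp
      ring

lemma injOn_relCosSq : Set.InjOn (relCosSq θ₁ θ₂) {θ₃ | Admissible θ₁ θ₂ θ₃} := by
  have hB : 0 < Real.sin (θ₁ / 2) * Real.sin (θ₂ / 2) :=
    mul_pos (sin_half_pos h₁ h₁') (sin_half_pos h₂ h₂')
  intro x hx y hy hxy
  simp only [Set.mem_ofPred_eq, admissible_iff h₁ h₁' h₂ h₂'] at hx hy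
  have h1 : (Real.cos (θ₁ / 2) * Real.cos (θ₂ / 2) - Real.cos (x / 2)) /
      (Real.sin (θ₁ / 2) * Real.sin (θ₂ / 2)) = (Real.cos (θ₁ / 2) * Real.cos (θ₂ / 2) -
      Real.cos (y / 2)) / (Real.sin (θ₁ / 2) * Real.sin (θ₂ / 2)) := by
    simp only [relCosSq] at hxy
    linarith
  rw [div_left_inj' hB.ne'] at h1
  have := Real.injOn_cos ⟨by linarith, by linarith⟩ ⟨by linarith, by linarith⟩
    (show Real.cos (x / 2) = Real.cos (y / 2) by linarith)
  linarith

lemma relJacobian_nonneg {θ₃ : ℝ} (ha : Admissible θ₁ θ₂ θ₃) : 0 ≤ relJacobian θ₁ θ₂ θ₃ := by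
  have hB : 0 < Real.sin (θ₁ / 2) * Real.sin (θ₂ / 2) :=
    mul_pos (sin_half_pos h₁ h₁') (sin_half_pos h₂ h₂')
  rw [admissible_iff h₁ h₁' h₂ h₂'] at ha
  exact div_nonneg (Real.sin_nonneg_of_nonneg_of_le_pi (by linarith) (by linarith)) (by linarith)

lemma lintegral_aSq_eq (H : SU2 → ℝ≥0∞) : ∫⁻ t in Set.Icc 0 1, H (aSq t) =
    ∫⁻ θ₃ in {θ₃ | Admissible θ₁ θ₂ θ₃},
      ENNReal.ofReal (relJacobian θ₁ θ₂ θ₃) * H (a (relAngle θ₁ θ₂ θ₃)) := by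
  rw [← image_relCosSq h₁ h₁' h₂ h₂', lintegral_image_eq_lintegral_abs_deriv_mul
    (measurableSet_admissible θ₁ θ₂) (fun x _ => (hasDerivAt_relCosSq θ₁ θ₂ x).hasDerivWithinAt)
    (injOn_relCosSq h₁ h₁' h₂ h₂')]
  refine setLIntegral_congr_fun (measurableSet_admissible θ₁ θ₂) fun θ₃ ha => ?_
  simp only [abs_of_nonneg (relJacobian_nonneg h₁ h₁' h₂ h₂' ha), a_relAngle]

lemma integral_aSq_eq (H : SU2 → ℂ) : ∫ t in Set.Icc 0 1, H (aSq t) =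
    ∫ θ₃ in {θ₃ | Admissible θ₁ θ₂ θ₃},
      (relJacobian θ₁ θ₂ θ₃ : ℂ) * H (a (relAngle θ₁ θ₂ θ₃)) := by
  rw [← image_relCosSq h₁ h₁' h₂ h₂', integral_image_eq_integral_abs_deriv_smul
    (measurableSet_admissible θ₁ θ₂) (fun x _ => (hasDerivAt_relCosSq θ₁ θ₂ x).hasDerivWithinAt)
    (injOn_relCosSq h₁ h₁' h₂ h₂')]
  refine setIntegral_congr_fun (measurableSet_admissible θ₁ θ₂) fun θ₃ ha => ?_
  simp only [abs_of_nonneg (relJacobian_nonneg h₁ h₁' h₂ h₂' ha), a_relAngle, Complex.real_smul]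

lemma integrableOn_aSq_iff (H : SU2 → ℂ) : IntegrableOn (fun t => H (aSq t)) (Set.Icc 0 1) ↔
    IntegrableOn (fun θ₃ => (relJacobian θ₁ θ₂ θ₃ : ℂ) * H (a (relAngle θ₁ θ₂ θ₃)))
      {θ₃ | Admissible θ₁ θ₂ θ₃} := by
  rw [← image_relCosSq h₁ h₁' h₂ h₂', integrableOn_image_iff_integrableOn_abs_deriv_smul
    (measurableSet_admissible θ₁ θ₂) (fun x _ => (hasDerivAt_relCosSq θ₁ θ₂ x).hasDerivWithinAt)
    (injOn_relCosSq h₁ h₁' h₂ h₂')]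
  refine integrableOn_congr_fun (fun θ₃ ha => ?_) (measurableSet_admissible θ₁ θ₂)
  simp only [abs_of_nonneg (relJacobian_nonneg h₁ h₁' h₂ h₂' ha), a_relAngle, Complex.real_smul]

end

end DoubleSU2

end

noncomputable section

namespace DoubleSU2

/-! ### Crossings -/

lemma Kind.act_one : ∀ (k : Kind) (φ : k.Point → ℂ), k.act 1 φ = φ
  | .flux _, φ => by
      funext x
      exact congrArg φ (show (1 : SU2)⁻¹ * (show SU2 from x) = x by rw [inv_one, one_mul])
  | .spin n, φ => by
      have key : ∀ v : Fin (n + 1) → ℂ, (wigner n 1).mulVec v = v := fun v => by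
        rw [wigner_one, Matrix.one_mulVec]
      exact key φ

lemma Kind.act_mul : ∀ (k : Kind) (g g' : SU2) (φ : k.Point → ℂ),
    k.act (g * g') φ = k.act g (k.act g' φ)
  | .flux _, g, g', φ => by
      funext x
      exact congrArg φ (show (g * g')⁻¹ * (show SU2 from x) = g'⁻¹ * (g⁻¹ * (show SU2 from x)) by
        rw [mul_inv_rev, mul_assoc])
  | .spin n, g, g', φ => by
      have key : ∀ v : Fin (n + 1) → ℂ,
          (wigner n (g * g')).mulVec v = (wigner n g).mulVec ((wigner n g').mulVec v) := fun v => by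
        rw [wigner_mul, Matrix.mulVec_mulVec]
      exact key φ

lemma Kind.act_const_mul : ∀ (k : Kind) (g : SU2) (r : ℂ) (φ : k.Point → ℂ) (x : k.Point),
    k.act g (fun p => r * φ p) x = r * k.act g φ x
  | .flux _, _, _, _, _ => rfl
  | .spin n, g, r, φ, x => congrFun (Matrix.mulVec_smul (wigner n g) r φ) x

lemma Kind.act_mul_const (k : Kind) (g : SU2) (r : ℂ) (φ : k.Point → ℂ) (x : k.Point) :
    k.act g (fun p => φ p * r) x = k.act g φ x * r := by
  simp only [mul_comm _ r, Kind.act_const_mul]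

variable {N : ℕ} {c : Fin N → Kind} {θ : Fin N → ℝ}

lemma slotAct_one (b : Fin N) (Φ : State c) : slotAct c b 1 Φ = Φ := by
  funext x
  simp only [slotAct, Kind.act_one, Function.update_eq_self]

/-- The inner group element may be the holonomy of other strands; the two actions compose as soon as
it does not see the coordinate b. -/
lemma slotAct_slotAct (b : Fin N) (g : SU2) (g' : Config c → SU2) (Φ : State c) (x : Config c)
    (hg' : ∀ p, g' (Function.update x b p) = g' x) :
    slotAct c b g (fun x' => slotAct c b (g' x') Φ x') x = slotAct c b (g * g' x) Φ x := by
  simp only [slotAct, hg', Function.update_idem, Function.update_self, Kind.act_mul]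

/-- `g` or `g⁻¹`, according to a sign. -/
def signed (δ : Bool) (g : SU2) : SU2 := if δ then g else g⁻¹

lemma signed_conj (δ : Bool) (x g : SU2) : signed δ (x * g * x⁻¹) = x * signed δ g * x⁻¹ := by
  cases δ <;> simp [signed, mul_assoc]

/-- A strand of trivial holonomy does nothing through the first leg of R or R⁻¹, so only the sign
for which the other strand carries the first leg has an effect. -/
lemma crossing_eq_of_left {sign : Bool} {l r : Fin N} (hl : ∀ p, (c l).hol (θ l) p = 1)
    (Φ : State c) (x : Config c) : crossing c θ sign l r Φ x =
      slotAct c l (if sign then 1 else ((c r).hol (θ r) (x r))⁻¹) Φ x := by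
  cases sign
  · rfl
  · change slotAct c r ((c l).hol (θ l) (x l)) Φ x = _
    simp only [hl, slotAct_one, if_true]

lemma crossing_eq_of_right {sign : Bool} {l r : Fin N} (hr : ∀ p, (c r).hol (θ r) p = 1)
    (Φ : State c) (x : Config c) : crossing c θ sign l r Φ x =
      slotAct c r (if sign then (c l).hol (θ l) (x l) else 1) Φ x := by
  cases sign
  · change slotAct c l ((c r).hol (θ r) (x r))⁻¹ Φ x = _
    simp [hr, slotAct_one]
  · rfl

/-- Of two successive crossings of equal sign exactly one is nontrivial: the second for δ true, the
first for δ false. So a full twist is a single action of the holonomy or its inverse. -/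
lemma crossing_crossing_of_left {δ : Bool} {l r : Fin N} (hl : ∀ p, (c l).hol (θ l) p = 1)
    (Φ : State c) : crossing c θ δ r l (crossing c θ δ l r Φ) =
      fun x => slotAct c l (signed δ ((c r).hol (θ r) (x r))) Φ x := by
  funext x
  rw [crossing_eq_of_right hl, show crossing c θ δ l r Φ = _ from
    funext fun x => crossing_eq_of_left hl Φ x]
  cases δ <;> simp [signed, slotAct_one]

lemma crossing_crossing_of_right {δ : Bool} {l r : Fin N} (hr : ∀ p, (c r).hol (θ r) p = 1)
    (Φ : State c) : crossing c θ δ r l (crossing c θ δ l r Φ) =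
      fun x => slotAct c r (signed δ ((c l).hol (θ l) (x l))) Φ x := by
  funext x
  rw [crossing_eq_of_left hr, show crossing c θ δ l r Φ = _ from
    funext fun x => crossing_eq_of_right hr Φ x]
  cases δ <;> simp [signed, slotAct_one]

lemma braidEval_circleWord (c : Fin 2 → Kind) (θ : Fin 2 → ℝ) (δ : Bool) (Φ : State c) :
    braidEval c θ (circleWord δ) 1 Φ = crossing c θ δ 1 0 (crossing c θ δ 0 1 Φ) := rfl

lemma braidEval_aroundTwoWord (c : Fin 3 → Kind) (θ : Fin 3 → ℝ) (δ : Bool) (Φ : State c) :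
    braidEval c θ (aroundTwoWord δ) 1 Φ =
      crossing c θ δ 1 0 (crossing c θ δ 2 0 (crossing c θ δ 0 2 (crossing c θ δ 0 1 Φ))) := rfl

lemma braidEval_slideWord (c : Fin 3 → Kind) (θ : Fin 3 → ℝ) (δ ε ε' : Bool) (Φ : State c) :
    braidEval c θ (slideWord δ ε ε') 1 Φ =
      crossing c θ ε' 2 1 (crossing c θ δ 2 0 (crossing c θ δ 0 2 (crossing c θ ε 1 2 Φ))) := rfl

/-! ### Partial traces -/

/-- An action on one of the later strands passes through any factor that does not depend on its
coordinate. This strips the closed strand off and leaves an operator on Φ alone. -/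
lemma slotAct_succ {A : Kind} (b : Fin N) (g : SU2) (F : Config (Matrix.vecCons A c) → ℂ)
    (Φ : State c) (x : Config (Matrix.vecCons A c))
    (hF : ∀ p, F (Function.update x b.succ p) = F x) :
    slotAct (Matrix.vecCons A c) b.succ g (fun x => F x * Φ fun b => x b.succ) x =
      F x * slotAct c b g Φ fun b => x b.succ := by
  have : ∀ p : (c b).Point, (fun b' : Fin N => Function.update x b.succ p b'.succ) =
      Function.update (fun b' : Fin N => x b'.succ) b p := by
    intro p
    funext b'
    rcases eq_or_ne b' b with rfl | hb
    · exact (Function.update_self (f := x) b'.succ p).trans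
        (Function.update_self (f := fun b' : Fin N => x b'.succ) b' p).symm
    · exact (Function.update_of_ne (f := x) (fun h => hb (Fin.succ_injective _ h)) p).trans
        (Function.update_of_ne (f := fun b' : Fin N => x b'.succ) hb p).symm
  change (c b).act g (fun p : (c b).Point => F (Function.update x b.succ p) *
    Φ fun b' => Function.update x b.succ p b'.succ) (x b.succ) = _
  have hfun : (fun p : (c b).Point => F (Function.update x b.succ p) *
      Φ fun b' => Function.update x b.succ p b'.succ) = fun p : (c b).Point => F x *
      Φ (Function.update (fun b' : Fin N => x b'.succ) b p) :=
    funext fun p => congrArg₂ (· * ·) (hF p) (congrArg Φ (this p))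
  exact (congrArg (fun φ => (c b).act g φ (x b.succ)) hfun).trans (Kind.act_const_mul _ _ _ _ _)

lemma slotAct_zero {A : Kind} (g : SU2) (e : A.Point → ℂ)
    (Φ : State c) (x : Config (Matrix.vecCons A c)) :
    slotAct (Matrix.vecCons A c) 0 g (tensorState e Φ) x =
      A.act g e (x 0) * Φ fun b => x b.succ := by
  have : ∀ p : A.Point, (fun b' : Fin N => Function.update x 0 p b'.succ) =
      fun b' : Fin N => x b'.succ :=
    fun p => funext fun b' => Function.update_of_ne (Fin.succ_ne_zero b') _ _
  have h0 : ∀ p : A.Point, Function.update x 0 p 0 = p := fun p => Function.update_self _ _ _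
  change A.act g (fun p : A.Point => e (Function.update x 0 p 0) *
    Φ fun b' => Function.update x 0 p b'.succ) (x 0) = _
  simp only [this, h0]
  exact Kind.act_mul_const _ _ _ _ _

/-- The character `χ_{n/2}`. -/
def character (n : ℕ) (g : SU2) : ℂ := (wigner n g).trace

/-- The element g may depend on y: it will be a product of encircled holonomies, frozen while the
trace is taken. -/
lemma spinTrace_eq {n : ℕ} {T : Op (Matrix.vecCons (.spin n) c)} {Φ : State c} {y : Config c}
    {g : SU2} {r : ℂ} (hT : ∀ (e : Fin (n + 1) → ℂ) (k : Fin (n + 1)),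
      T (tensorState (A := .spin n) e Φ) (consConfig (A := .spin n) k y) =
        (wigner n g).mulVec e k * r) :
    spinTrace n T Φ y = character n g * r := by
  rw [spinTrace, character, Matrix.trace, Finset.sum_mul]
  refine Finset.sum_congr rfl fun k _ => ?_
  rw [hT, show (fun l : Fin (n + 1) => if l = k then (1 : ℂ) else 0) = Pi.single k 1 by
    funext l; simp [Pi.single_apply], Matrix.mulVec_single_one]
  rfl

/-- A column of a unitary matrix has norm one. That this holds at every x is what makes a
multiplication operator on the flux strand diagonal. -/
lemma sum_normSq_blockBasis (I : ℕ) (x : SU2) :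
    ∑ k, (starRingEnd ℂ) (blockBasis I k x) * blockBasis I k x = 2 * I + 1 := by
  have hu := congrFun (congrFun (conjTranspose_mul_wigner (2 * I) x) ⟨I, by omega⟩) ⟨I, by omega⟩
  rw [Matrix.mul_apply, Matrix.one_apply_eq] at hu
  have hs : (Real.sqrt (2 * I + 1) : ℂ) * Real.sqrt (2 * I + 1) = 2 * I + 1 := by
    have : Real.sqrt (2 * I + 1) * Real.sqrt (2 * I + 1) = 2 * I + 1 :=
      Real.mul_self_sqrt (by positivity)
    exact_mod_cast this
  have hsum : (2 * (I : ℂ) + 1) = (Real.sqrt (2 * I + 1) : ℂ) * Real.sqrt (2 * I + 1) *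
      ∑ j, (wigner (2 * I) x).conjTranspose ⟨I, by omega⟩ j *
        wigner (2 * I) x j ⟨I, by omega⟩ := by
    rw [hu, hs, mul_one]
  rw [hsum, Finset.mul_sum]
  refine Finset.sum_congr rfl fun k _ => ?_
  simp only [blockBasis, map_mul, Complex.conj_ofReal, Matrix.conjTranspose_apply]
  change _ = _ * ((starRingEnd ℂ) _ * _)
  ring

lemma continuous_blockBasis (I : ℕ) (k : Fin (2 * I + 1)) : Continuous (blockBasis I k) :=
  continuous_const.mul (continuous_wigner _ _ _)

lemma blockTrace_eq {T : Op (Matrix.vecCons (.flux 0) c)} {Φ : State c} {y : Config c}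
    {S : SU2 → ℂ} (hS : Continuous S) (hT : ∀ (e : SU2 → ℂ) (x : SU2),
      T (tensorState (A := .flux 0) e Φ) (consConfig (A := .flux 0) x y) = e x * S x) (I : ℕ) :
    blockTrace I T Φ y = (2 * I + 1) * ∫ x, S x ∂haar := by
  simp only [blockTrace, hT]
  rw [← integral_finsetSum, ← integral_const_mul]
  · congr 1
    funext x
    simp only [← mul_assoc]
    rw [← Finset.sum_mul, sum_normSq_blockBasis]
  · intro k _
    have := continuous_blockBasis I k
    exact integrable_of_continuous (by fun_prop)

lemma reducedTrace_eq {T : Op (Matrix.vecCons (.flux 0) c)} {Φ : State c} {y : Config c}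
    {S : SU2 → ℂ} (hS : Continuous S) (hT : ∀ (e : SU2 → ℂ) (x : SU2),
      T (tensorState (A := .flux 0) e Φ) (consConfig (A := .flux 0) x y) = e x * S x) :
    reducedTrace T Φ y = ∫ x, S x ∂haar := by
  rw [reducedTrace, blockTrace_eq hS hT]
  simp

lemma isDiagonal_of_forall {T : Op (Matrix.vecCons (.flux 0) c)} {S : State c → Config c → SU2 → ℂ}
    (hS : ∀ Φ y, Continuous (S Φ y)) (hT : ∀ Φ y (e : SU2 → ℂ) (x : SU2),
      T (tensorState (A := .flux 0) e Φ) (consConfig (A := .flux 0) x y) = e x * S Φ y x) :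
    IsDiagonal T := by
  intro I Φ _ y
  rw [blockTrace_eq (hS Φ y) (hT Φ y), reducedTrace_eq (hS Φ y) (hT Φ y)]

/-! ### Characters -/

/-- The value of `χ_{n/2}` on the class `θ`. -/
def chi (n : ℕ) (t : ℝ) : ℝ := ∑ k : Fin (n + 1), Real.cos (((n : ℝ) - 2 * k) * (t / 2))

lemma character_h (n : ℕ) (t : ℝ) : character n (h t) = chi n t := by
  -- The weights are symmetric under k ↦ n − k, so the imaginary parts cancel.
  have hsin : ∑ k : Fin (n + 1), Real.sin (((n : ℝ) - 2 * k) * (t / 2)) = 0 := by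
    have hrev := Equiv.sum_comp Fin.revPerm
      fun k : Fin (n + 1) => Real.sin (((n : ℝ) - 2 * k) * (t / 2))
    have hneg : ∀ k : Fin (n + 1),
        Real.sin (((n : ℝ) - 2 * (Fin.revPerm k : Fin (n + 1))) * (t / 2)) =
          -Real.sin (((n : ℝ) - 2 * k) * (t / 2)) := by
      intro k
      rw [← Real.sin_neg]
      congr 1
      rw [Fin.revPerm_apply, Fin.val_rev, Nat.add_sub_add_right,
        Nat.cast_sub (Nat.lt_succ_iff.mp k.2)]
      ring
    simp only [hneg, Finset.sum_neg_distrib] at hrev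
    linarith
  rw [character, wigner_h, Matrix.trace_diagonal, chi]
  have : ∀ k : Fin (n + 1), weight n k t = (Real.cos (((n : ℝ) - 2 * k) * (t / 2)) : ℂ) +
      (Real.sin (((n : ℝ) - 2 * k) * (t / 2)) : ℂ) * Complex.I := by
    intro k
    rw [weight, Complex.ofReal_cos, Complex.ofReal_sin, ← Complex.exp_mul_I]
    congr 1
    push_cast
    ring
  simp only [this, Finset.sum_add_distrib]
  rw [← Finset.sum_mul, ← Complex.ofReal_sum, ← Complex.ofReal_sum, hsin]
  simp

lemma h_inv (t : ℝ) : (h t)⁻¹ = h (-t) := by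
  refine ext_of_first_column ?_ ?_
  · rw [inv_apply]
    simp [h, ← Complex.exp_conj, Complex.conj_ofNat]
  · rw [inv_apply]
    simp [h]

lemma character_conj (n : ℕ) (x g : SU2) : character n (x * g * x⁻¹) = character n g := by
  rw [character, wigner_mul, Matrix.trace_mul_comm, ← wigner_mul, ← mul_assoc, inv_mul_cancel,
    one_mul, character]

lemma chi_neg (n : ℕ) (t : ℝ) : chi n (-t) = chi n t := by
  simp only [chi, neg_div, mul_neg, Real.cos_neg]

/-- The inverse of h_t is h_{−t} and χ is even; hence the orientation of a circle has no effect on a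
character. -/
lemma character_signed_h (n : ℕ) (δ : Bool) (t : ℝ) : character n (signed δ (h t)) = chi n t := by
  cases δ
  · simp [signed, h_inv, character_h, chi_neg]
  · simp [signed, character_h]

lemma character_signed_conj (n : ℕ) (δ : Bool) (x : SU2) (t : ℝ) :
    character n (signed δ (x * h t * x⁻¹)) = chi n t := by
  rw [signed_conj, character_conj, character_signed_h]

lemma continuous_chi (n : ℕ) : Continuous (chi n) := by
  unfold chi
  fun_prop

/-- Telescoping: each product sin · cos is half a difference of sines of consecutive frequencies. -/
lemma sin_mul_chi (n : ℕ) (t : ℝ) :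
    Real.sin (t / 2) * chi n t = Real.sin (((n : ℝ) + 1) * (t / 2)) := by
  rw [chi, Fin.sum_univ_eq_sum_range (fun k => Real.cos (((n : ℝ) - 2 * k) * (t / 2))),
    Finset.mul_sum]
  have : ∀ k : ℕ, Real.sin (t / 2) * Real.cos (((n : ℝ) - 2 * k) * (t / 2)) =
      (fun k : ℕ => Real.sin (((n : ℝ) + 1 - 2 * k) * (t / 2)) / 2) k -
      (fun k : ℕ => Real.sin (((n : ℝ) + 1 - 2 * k) * (t / 2)) / 2) (k + 1) := by
    intro k
    have e1 : ((n : ℝ) + 1 - 2 * k) * (t / 2) = ((n : ℝ) - 2 * k) * (t / 2) + t / 2 := by ring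
    have e2 : ((n : ℝ) + 1 - 2 * ((k + 1 : ℕ) : ℝ)) * (t / 2) =
        ((n : ℝ) - 2 * k) * (t / 2) - t / 2 := by push_cast; ring
    simp only [e1, e2, Real.sin_add, Real.sin_sub]
    ring
  simp only [this]
  rw [Finset.sum_range_sub']
  have e3 : ((n : ℝ) + 1 - 2 * ((n + 1 : ℕ) : ℝ)) * (t / 2) = -(((n : ℝ) + 1) * (t / 2)) := by
    push_cast; ring
  simp only [e3, Real.sin_neg, Nat.cast_zero, mul_zero, sub_zero]
  ring

lemma integral_deltaSq_mul_chi (n : ℕ) :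
    ∫ t in (0 : ℝ)..(2 * Real.pi), deltaSq t / Real.pi * chi n t = if n = 0 then 1 else 0 := by
  -- One factor sin(t/2) turns χ into a sine, the other splits the product into cosines of
  -- frequencies n/2 and n/2 + 1. Only for n = 0 is a frequency zero.
  have hpt : ∀ t, deltaSq t / Real.pi * chi n t =
      (1 / (2 * Real.pi)) * (Real.cos ((n : ℝ) / 2 * t) - Real.cos (((n : ℝ) / 2 + 1) * t)) := by
    intro t
    have e : deltaSq t / Real.pi * chi n t =
        (1 / Real.pi) * (Real.sin (t / 2) * (Real.sin (t / 2) * chi n t)) := by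
      rw [deltaSq]; ring
    have e1 : (n : ℝ) / 2 * t = ((n : ℝ) + 1) * (t / 2) - t / 2 := by ring
    have e2 : ((n : ℝ) / 2 + 1) * t = ((n : ℝ) + 1) * (t / 2) + t / 2 := by ring
    rw [e, sin_mul_chi, e1, e2, Real.cos_add, Real.cos_sub]
    field_simp
    ring
  simp only [hpt]
  have hcos : ∀ c : ℝ, c ≠ 0 → Real.sin (c * (2 * Real.pi)) = 0 →
      ∫ t in (0 : ℝ)..(2 * Real.pi), Real.cos (c * t) = 0 := by
    intro c hc hs
    rw [intervalIntegral.integral_comp_mul_left (fun t => Real.cos t) hc]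
    simp [hs]
  have h2 : Real.sin (((n : ℝ) / 2 + 1) * (2 * Real.pi)) = 0 := by
    rw [show ((n : ℝ) / 2 + 1) * (2 * Real.pi) = ((n + 2 : ℕ) : ℝ) * Real.pi by push_cast; ring]
    exact Real.sin_nat_mul_pi _
  rw [intervalIntegral.integral_const_mul, intervalIntegral.integral_sub
    (Continuous.intervalIntegrable (by fun_prop) _ _)
    (Continuous.intervalIntegrable (by fun_prop) _ _), hcos _ (by positivity) h2, sub_zero]
  split_ifs with hn
  · subst hn
    have := Real.pi_pos
    simp
    field_simp
  · have hn0 : (n : ℝ) ≠ 0 := by exact_mod_cast hn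
    rw [hcos _ (div_ne_zero hn0 two_ne_zero), mul_zero]
    rw [show (n : ℝ) / 2 * (2 * Real.pi) = (n : ℝ) * Real.pi by ring]
    exact Real.sin_nat_mul_pi _

/-! ### Averages of Wigner matrices over a conjugacy class -/

lemma continuous_wigner_conj (n : ℕ) (u v g : SU2) (k l : Fin (n + 1)) :
    Continuous fun x => wigner n (u * (x * g * x⁻¹) * v) k l :=
  (continuous_wigner n k l).comp
    (f := fun x : SU2 => u * (x * g * x⁻¹) * v)
    ((continuous_const.mul ((continuous_id.mul continuous_const).mul continuous_inv)).mul
      continuous_const)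

/-- D(u) and D(v) come out of the integral, and what remains is the Schur average of D(g). -/
lemma integral_wigner_conj (n : ℕ) (u v g : SU2) (k l : Fin (n + 1)) :
    ∫ x, wigner n (u * (x * g * x⁻¹) * v) k l ∂haar =
      character n g / (n + 1) * wigner n (u * v) k l := by
  have key : ∀ i j, ∫ x, wigner n (x * g * x⁻¹) i j ∂haar =
      (character n g / (n + 1)) * (1 : Matrix (Fin (n + 1)) (Fin (n + 1)) ℂ) i j := by
    intro i j
    have := congrFun (congrFun (conjAverage_eq n (wigner n g)) i) j
    rw [Matrix.smul_apply, smul_eq_mul] at this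
    rw [character, ← this, conjAverage]
    simp only [wigner_mul, wigner_inv]
  have hconj : Continuous fun x : SU2 => x * g * x⁻¹ :=
    (continuous_id.mul continuous_const).mul continuous_inv
  have hc : ∀ i j, Integrable (fun x => wigner n (x * g * x⁻¹) i j) haar := by
    intro i j
    have hcont : Continuous fun x => wigner n (x * g * x⁻¹) i j :=
      (continuous_wigner n i j).comp hconj
    exact integrable_of_continuous hcont
  have hx : ∀ x, wigner n (u * (x * g * x⁻¹) * v) k l =
      ∑ j, ∑ i, wigner n u k i * wigner n (x * g * x⁻¹) i j * wigner n v j l := by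
    intro x
    rw [wigner_mul, wigner_mul n u, Matrix.mul_apply]
    refine Finset.sum_congr rfl fun j _ => ?_
    rw [Matrix.mul_apply, Finset.sum_mul]
  simp only [hx]
  rw [integral_finsetSum _ fun j _ => integrable_finsetSum _ fun i _ =>
    ((hc i j).const_mul _).mul_const _, wigner_mul, Matrix.mul_apply, Finset.mul_sum]
  refine Finset.sum_congr rfl fun j _ => ?_
  rw [integral_finsetSum _ fun i _ => ((hc i j).const_mul _).mul_const _]
  simp only [integral_mul_const, integral_const_mul, key, Matrix.one_apply]
  simp only [mul_ite, mul_one, mul_zero, ite_mul, zero_mul, Finset.sum_ite_eq', Finset.mem_univ,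
    if_true]
  ring

end DoubleSU2

end

noncomputable section

namespace DoubleSU2

/-! ### Evaluation of the tangles -/

section

variable {C : Fin 3 → Kind} {T : Fin 3 → ℝ}

/-- The four crossings collapse to one action. Both orientations give the product of the holonomies
in the same order as the coproduct, or its inverse. -/
lemma braidEval_aroundTwoWord_of_zero (h0 : ∀ p, (C 0).hol (T 0) p = 1) (δ : Bool)
    (Ψ : State C) (x : Config C) : braidEval C T (aroundTwoWord δ) 1 Ψ x =
      slotAct C 0 (signed δ ((C 1).hol (T 1) (x 1) * (C 2).hol (T 2) (x 2))) Ψ x := by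
  rw [braidEval_aroundTwoWord, show crossing C T δ 0 1 Ψ = _ from
      funext fun x => crossing_eq_of_left h0 _ x,
    crossing_crossing_of_left h0, crossing_eq_of_right h0, slotAct_slotAct _ _ _ _ _ fun _ => rfl,
    slotAct_slotAct _ _ _ _ _ fun _ => rfl]
  cases δ <;> simp [signed]

lemma braidEval_aroundTwoWord_of_one_two (h1 : ∀ p, (C 1).hol (T 1) p = 1)
    (h2 : ∀ p, (C 2).hol (T 2) p = 1) (δ : Bool)
    (Ψ : State C) (x : Config C) : braidEval C T (aroundTwoWord δ) 1 Ψ x =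
      slotAct C 1 (if δ then 1 else ((C 0).hol (T 0) (x 0))⁻¹) (fun x => slotAct C 2
        (signed δ ((C 0).hol (T 0) (x 0))) (fun x => slotAct C 1
          (if δ then (C 0).hol (T 0) (x 0) else 1) Ψ x) x) x := by
  rw [braidEval_aroundTwoWord, show crossing C T δ 0 1 Ψ = _ from
      funext fun x => crossing_eq_of_right h1 _ x,
    crossing_crossing_of_right h2, crossing_eq_of_left h1]

lemma braidEval_slideWord_of_zero_one (h0 : ∀ p, (C 0).hol (T 0) p = 1)
    (h1 : ∀ p, (C 1).hol (T 1) p = 1) (δ ε ε' : Bool) (Ψ : State C) (x : Config C) :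
    braidEval C T (slideWord δ ε ε') 1 Ψ x =
      slotAct C 1 (if ε' then (C 2).hol (T 2) (x 2) else 1) (fun x => slotAct C 0
        (signed δ ((C 2).hol (T 2) (x 2))) (fun x => slotAct C 1
          (if ε then 1 else ((C 2).hol (T 2) (x 2))⁻¹) Ψ x) x) x := by
  rw [braidEval_slideWord, show crossing C T ε 1 2 Ψ = _ from
      funext fun x => crossing_eq_of_left h1 _ x,
    crossing_crossing_of_left h0, crossing_eq_of_right h1]

lemma braidEval_slideWord_of_two (h2 : ∀ p, (C 2).hol (T 2) p = 1) (δ ε ε' : Bool)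
    (Ψ : State C) (x : Config C) :
    braidEval C T (slideWord δ ε ε') 1 Ψ x = slotAct C 2
      ((if ε' then 1 else ((C 1).hol (T 1) (x 1))⁻¹) * signed δ ((C 0).hol (T 0) (x 0)) *
        (if ε then (C 1).hol (T 1) (x 1) else 1)) Ψ x := by
  rw [braidEval_slideWord, show crossing C T ε 1 2 Ψ = _ from
      funext fun x => crossing_eq_of_right h2 _ x,
    crossing_crossing_of_right h2, crossing_eq_of_left h2, slotAct_slotAct _ _ _ _ _ fun _ => rfl,
    slotAct_slotAct _ _ _ _ _ fun _ => rfl, mul_assoc]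

lemma braidEval_circleWord_of_zero {C : Fin 2 → Kind} {T : Fin 2 → ℝ}
    (h0 : ∀ p, (C 0).hol (T 0) p = 1) (δ : Bool) (Ψ : State C) (x : Config C) :
    braidEval C T (circleWord δ) 1 Ψ x =
      slotAct C 0 (signed δ ((C 1).hol (T 1) (x 1))) Ψ x := by
  rw [braidEval_circleWord, crossing_crossing_of_left h0]

lemma braidEval_circleWord_of_one {C : Fin 2 → Kind} {T : Fin 2 → ℝ}
    (h1 : ∀ p, (C 1).hol (T 1) p = 1) (δ : Bool) (Ψ : State C) (x : Config C) :
    braidEval C T (circleWord δ) 1 Ψ x =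
      slotAct C 1 (signed δ ((C 0).hol (T 0) (x 0))) Ψ x := by
  rw [braidEval_circleWord, crossing_crossing_of_right h1]

end

lemma evalSpin_circleWord (k : ℕ) (c : Fin 1 → Kind) (θ : Fin 1 → ℝ) (δ : Bool) (Φ : State c)
    (y : Config c) : evalSpin k c θ (circleWord δ) Φ y =
      character k (signed δ ((c 0).hol (θ 0) (y 0))) * Φ y :=
  spinTrace_eq fun e _ => (braidEval_circleWord_of_zero (fun _ => rfl) _ _ _).trans
    (slotAct_zero (A := .spin k) _ e Φ _)

lemma evalSpin_aroundTwoWord (k : ℕ) (c : Fin 2 → Kind) (θ : Fin 2 → ℝ) (δ : Bool) (Φ : State c)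
    (y : Config c) : evalSpin k c θ (aroundTwoWord δ) Φ y =
      character k (signed δ ((c 0).hol (θ 0) (y 0) * (c 1).hol (θ 1) (y 1))) * Φ y :=
  spinTrace_eq fun e _ => (braidEval_aroundTwoWord_of_zero (fun _ => rfl) _ _ _).trans
    (slotAct_zero (A := .spin k) _ e Φ _)

/-- Circle and passing strand are acted on in different slots by group elements read off the same
flux strand. The trace yields the character, and the passing strand keeps a power 1, −1 or 0 of the
holonomy, according to how it links. -/
lemma evalSpin_slideWord (k : ℕ) (c : Fin 2 → Kind) (θ : Fin 2 → ℝ)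
    (hc : ∀ p, (c 0).hol (θ 0) p = 1) (δ ε ε' : Bool) (Φ : State c) (y : Config c) :
    evalSpin k c θ (slideWord δ ε ε') Φ y =
      character k (signed δ ((c 1).hol (θ 1) (y 1))) * slotAct c 0
        ((if ε' then (c 1).hol (θ 1) (y 1) else 1) *
          (if ε then 1 else ((c 1).hol (θ 1) (y 1))⁻¹)) Φ y := by
  refine spinTrace_eq fun e i =>
    (braidEval_slideWord_of_zero_one (C := Matrix.vecCons (.spin k) c)
      (T := Matrix.vecCons 0 θ) (fun _ => rfl) hc δ ε ε' _ _).trans ?_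
  let Φ₁ : State c := fun y => slotAct c 0 (if ε then 1 else ((c 1).hol (θ 1) (y 1))⁻¹) Φ y
  let F : Config (Matrix.vecCons (.spin k) c) → ℂ := fun x =>
    (Kind.spin k).act (signed δ ((c 1).hol (θ 1) (x 2))) e (x 0)
  have h1 : (fun x => slotAct (Matrix.vecCons (.spin k) c) 1
      (if ε then 1 else ((c 1).hol (θ 1) (x 2))⁻¹) (tensorState (A := .spin k) e Φ) x) =
      tensorState (A := .spin k) e Φ₁ := by
    funext x
    exact slotAct_succ (A := .spin k) (c := c) 0 _ (fun x => e (x 0)) Φ x fun _ => rfl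
  have h2 : (fun x => slotAct (Matrix.vecCons (.spin k) c) 0
      (signed δ ((c 1).hol (θ 1) (x 2))) (tensorState (A := .spin k) e Φ₁) x) =
      fun x => F x * Φ₁ fun b => x b.succ :=
    funext fun x => slotAct_zero _ _ _ _
  refine (congrArg (fun Ψ => slotAct (Matrix.vecCons (.spin k) c) 1 _ (fun x =>
    slotAct (Matrix.vecCons (.spin k) c) 0 (signed δ ((c 1).hol (θ 1) (x 2))) Ψ x) _) h1).trans ?_
  refine (congrArg (fun Ψ => slotAct (Matrix.vecCons (.spin k) c) 1 _ Ψ _) h2).trans ?_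
  refine (slotAct_succ (A := .spin k) (c := c) 0 _ F Φ₁ _ fun _ => rfl).trans ?_
  refine congrArg₂ (· * ·) rfl ?_
  exact slotAct_slotAct (c := c) 0 _ (fun y => if ε then 1 else ((c 1).hol (θ 1) (y 1))⁻¹) Φ y
    fun _ => rfl

lemma fluxBraid_circleWord (t : ℝ) (c : Fin 1 → Kind) (θ : Fin 1 → ℝ)
    (hc : ∀ p, (c 0).hol (θ 0) p = 1) (δ : Bool) (Φ : State c) (y : Config c) (e : SU2 → ℂ)
    (x : SU2) : fluxBraid t c θ (circleWord δ) (tensorState (A := .flux 0) e Φ)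
      (consConfig (A := .flux 0) x y) = e x * slotAct c 0 (signed δ (x * h t * x⁻¹)) Φ y :=
  (braidEval_circleWord_of_one (C := Matrix.vecCons (.flux 0) c) (T := Matrix.vecCons t θ)
    hc _ _ _).trans (slotAct_succ (A := .flux 0) (c := c) 0 _ (fun x => e (x 0)) Φ _ fun _ => rfl)

lemma fluxBraid_slideWord (t : ℝ) (c : Fin 2 → Kind) (θ : Fin 2 → ℝ)
    (hc : ∀ p, (c 1).hol (θ 1) p = 1) (δ ε ε' : Bool) (Φ : State c) (y : Config c) (e : SU2 → ℂ)
    (x : SU2) : fluxBraid t c θ (slideWord δ ε ε') (tensorState (A := .flux 0) e Φ)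
      (consConfig (A := .flux 0) x y) =
    e x * slotAct c 1 ((if ε' then 1 else ((c 0).hol (θ 0) (y 0))⁻¹) *
      signed δ (x * h t * x⁻¹) * (if ε then (c 0).hol (θ 0) (y 0) else 1)) Φ y :=
  (braidEval_slideWord_of_two (C := Matrix.vecCons (.flux 0) c) (T := Matrix.vecCons t θ)
    hc _ _ _ _ _).trans
    (slotAct_succ (A := .flux 0) (c := c) 1 _ (fun x => e (x 0)) Φ _ fun _ => rfl)

lemma fluxBraid_aroundTwoWord (t : ℝ) (c : Fin 2 → Kind) (θ : Fin 2 → ℝ)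
    (hc : ∀ b p, (c b).hol (θ b) p = 1) (δ : Bool) (Φ : State c) (y : Config c) (e : SU2 → ℂ)
    (x : SU2) : fluxBraid t c θ (aroundTwoWord δ) (tensorState (A := .flux 0) e Φ)
      (consConfig (A := .flux 0) x y) =
    e x * slotAct c 0 (if δ then 1 else (x * h t * x⁻¹)⁻¹)
      (slotAct c 1 (signed δ (x * h t * x⁻¹))
        (slotAct c 0 (if δ then x * h t * x⁻¹ else 1) Φ)) y := by
  refine (braidEval_aroundTwoWord_of_one_two (C := Matrix.vecCons (.flux 0) c)
    (T := Matrix.vecCons t θ) (hc 0) (hc 1) _ _ _).trans ?_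
  -- the three operators act on the last strands, with a parameter read off on the first
  let hol : SU2 → SU2 := fun x => x * h t * x⁻¹
  have step : ∀ (b : Fin 2) (f : SU2 → SU2) (Θ : SU2 → State c)
      (z : Config (Matrix.vecCons (.flux 0) c)),
      slotAct (Matrix.vecCons (.flux 0) c) b.succ (f (z 0))
        (fun x => e (x 0) * Θ (x 0) fun b => x b.succ) z =
      e (z 0) * slotAct c b (f (z 0)) (Θ (z 0)) fun b => z b.succ := by
    intro b f Θ z
    have hz : ∀ p, Function.update z b.succ p 0 = z 0 := fun p =>
      Function.update_of_ne (Fin.succ_ne_zero b).symm _ _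
    refine Eq.trans ?_ (slotAct_succ (A := .flux 0) (c := c) b (f (z 0)) (fun x => e (x 0)) (Θ (z 0))
      z fun p => congrArg e (hz p))
    change (Matrix.vecCons (.flux 0) c b.succ).act _ _ _ = (Matrix.vecCons (.flux 0) c b.succ).act _ _ _
    refine congrArg (fun φ => (Matrix.vecCons (.flux 0) c b.succ).act (f (z 0)) φ (z b.succ)) ?_
    funext p
    exact congrArg (fun q => e (Function.update z b.succ p 0) * Θ q _) (hz p)
  have s1 := funext (step 0 (fun x => if δ then hol x else 1) fun _ => Φ)
  have s2 := funext (step 1 (fun x => signed δ (hol x))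
    fun x => slotAct c 0 (if δ then hol x else 1) Φ)
  have s3 := step 0 (fun x => if δ then 1 else (hol x)⁻¹)
    (fun x => slotAct c 1 (signed δ (hol x)) (slotAct c 0 (if δ then hol x else 1) Φ))
    (consConfig (A := .flux 0) x y)
  refine Eq.trans ?_ s3
  refine congrArg (fun Ψ => slotAct (Matrix.vecCons (.flux 0) c) 1 _ Ψ _) ?_
  refine Eq.trans ?_ s2
  funext z
  exact congrArg (fun Ψ => slotAct (Matrix.vecCons (.flux 0) c) 2 _ Ψ z) s1

end DoubleSU2

end

noncomputable section

namespace DoubleSU2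

/-! ### Closed flux strands around spins -/

lemma continuous_mulVec_conj (n : ℕ) (u w g : SU2) (v : Fin (n + 1) → ℂ) (k : Fin (n + 1)) :
    Continuous fun x => (wigner n (u * (x * g * x⁻¹) * w)).mulVec v k := by
  have := continuous_wigner_conj n u w g k
  simp only [Matrix.mulVec, dotProduct]
  fun_prop

lemma integral_mulVec_conj (n : ℕ) (u w g : SU2) (v : Fin (n + 1) → ℂ) (k : Fin (n + 1)) :
    ∫ x, (wigner n (u * (x * g * x⁻¹) * w)).mulVec v k ∂haar =
      character n g / (n + 1) * (wigner n (u * w)).mulVec v k := by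
  simp only [Matrix.mulVec, dotProduct]
  rw [integral_finsetSum _ fun l _ =>
    (integrable_of_continuous (continuous_wigner_conj n u w g k l)).mul_const _]
  simp only [integral_mul_const, integral_wigner_conj]
  simp only [Finset.mul_sum, mul_assoc]

lemma continuous_act_conj {K : Kind} {n : ℕ} (hK : K = .spin n) (u w g : SU2) (φ : K.Point → ℂ)
    (p : K.Point) : Continuous fun x => K.act (u * (x * g * x⁻¹) * w) φ p := by
  subst hK
  exact continuous_mulVec_conj n u w g φ p

lemma integral_act_conj {K : Kind} {n : ℕ} (hK : K = .spin n) (u w g : SU2) (φ : K.Point → ℂ)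
    (p : K.Point) : ∫ x, K.act (u * (x * g * x⁻¹) * w) φ p ∂haar =
      character n g / (n + 1) * K.act (u * w) φ p := by
  subst hK
  exact integral_mulVec_conj n u w g φ p

lemma signed_conj_eq (δ : Bool) (x g : SU2) :
    signed δ (x * g * x⁻¹) = 1 * (x * signed δ g * x⁻¹) * 1 := by
  rw [one_mul, mul_one, signed_conj]

lemma isDiagonal_circleWord_spin (t : ℝ) (n : ℕ) (δ : Bool) :
    IsDiagonal (fluxBraid t ![.spin n] ![0] (circleWord δ)) := by
  refine isDiagonal_of_forall (fun Φ y => ?_)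
    fun Φ y e x => fluxBraid_circleWord t ![.spin n] ![0] (fun _ => rfl) δ Φ y e x
  simp only [signed_conj_eq]
  exact continuous_act_conj (K := .spin n) rfl _ _ _ _ _

lemma evalFlux_circleWord_spin (t : ℝ) (n : ℕ) (δ : Bool) (Φ : State ![.spin n])
    (y : Config ![.spin n]) :
    evalFlux t ![.spin n] ![0] (circleWord δ) Φ y = (chi n t / (n + 1) : ℂ) * Φ y := by
  have hc : Continuous fun x => slotAct ![.spin n] 0 (signed δ (x * h t * x⁻¹)) Φ y := by
    simp only [signed_conj_eq]
    exact continuous_act_conj (K := .spin n) rfl _ _ _ _ _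
  rw [evalFlux, reducedTrace_eq hc
    fun e x => fluxBraid_circleWord t ![.spin n] ![0] (fun _ => rfl) δ Φ y e x]
  simp only [signed_conj_eq]
  refine (integral_act_conj (K := .spin n) rfl _ _ _ _ _).trans ?_
  rw [character_signed_h, one_mul]
  exact congrArg _ (congrFun (slotAct_one 0 Φ) y)

lemma isDiagonal_slideWord (t : ℝ) (n : ℕ) (s : ℤ) (θ : ℝ) (δ ε ε' : Bool) :
    IsDiagonal (fluxBraid t ![.flux s, .spin n] ![θ, 0] (slideWord δ ε ε')) := by
  refine isDiagonal_of_forall (fun Φ y => ?_)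
    fun Φ y e x => fluxBraid_slideWord t ![.flux s, .spin n] ![θ, 0] (fun _ => rfl) δ ε ε' Φ y e x
  simp only [signed_conj]
  exact continuous_act_conj (K := .spin n) rfl _ _ _ _ _

/-- The Haar average removes the circle from between the two crossings as a scalar; the remaining
factor records only the linking of the flux strand with the spin strand. -/
lemma evalFlux_slideWord (t : ℝ) (n : ℕ) (s : ℤ) (θ : ℝ) (δ ε ε' : Bool)
    (Φ : State ![.flux s, .spin n]) (y : Config ![.flux s, .spin n]) :
    evalFlux t ![.flux s, .spin n] ![θ, 0] (slideWord δ ε ε') Φ y = (chi n t / (n + 1) : ℂ) *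
      slotAct ![.flux s, .spin n] 1 ((if ε' then 1 else ((Kind.flux s).hol θ (y 0))⁻¹) *
        (if ε then (Kind.flux s).hol θ (y 0) else 1)) Φ y := by
  have hc : Continuous fun x => slotAct ![.flux s, .spin n] 1
      ((if ε' then 1 else ((Kind.flux s).hol θ (y 0))⁻¹) * signed δ (x * h t * x⁻¹) *
        (if ε then (Kind.flux s).hol θ (y 0) else 1)) Φ y := by
    simp only [signed_conj]
    exact continuous_act_conj (K := .spin n) rfl _ _ _ _ _
  rw [evalFlux, reducedTrace_eq hc
    fun e x => fluxBraid_slideWord t ![.flux s, .spin n] ![θ, 0] (fun _ => rfl) δ ε ε' Φ y e x]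
  simp only [signed_conj]
  refine (integral_act_conj (K := .spin n) rfl _ _ _ _ _).trans ?_
  rw [character_signed_h]
  rfl

/-- Every tangle with a flux circle around a single spin has this form: χ_n(t)/(n+1) times a
quantity r free of t. Orthogonality to the trivial character does the rest. -/
lemma omegaStar_chi {X : Type} (n : ℕ) (E : ℝ → X → ℂ) (y : X) (r : ℂ)
    (hE : ∀ t, E t y = (chi n t / (n + 1) : ℂ) * r) :
    IntervalIntegrable (fun t => E t y) volume 0 (2 * Real.pi) ∧
      omegaStar E y = (if n = 0 then 1 else 0) * r := by
  have hc2 : Continuous fun t => (chi n t : ℂ) := Complex.continuous_ofReal.comp (continuous_chi n)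
  refine ⟨?_, ?_⟩
  · simp only [hE]
    exact Continuous.intervalIntegrable (by fun_prop) _ _
  · have hpt : ∀ t, ((deltaSq t / Real.pi : ℝ) : ℂ) * E t y =
        ((deltaSq t / Real.pi * chi n t : ℝ) : ℂ) * (r / (n + 1)) := by
      intro t
      rw [hE]
      push_cast
      ring
    simp only [omegaStar, hpt]
    rw [intervalIntegral.integral_mul_const, intervalIntegral.integral_ofReal,
      integral_deltaSq_mul_chi]
    split_ifs with hn
    · subst hn
      simp
    · simp

lemma wigner_zero (g : SU2) : wigner 0 g = 1 := by
  funext k l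
  have hk : k = 0 := Fin.ext (by omega)
  have hl : l = 0 := Fin.ext (by omega)
  rw [hk, hl, wigner_column_zero]
  simp [mono]

lemma act_spin_zero {K : Kind} (hK : K = .spin 0) (g : SU2) (φ : K.Point → ℂ) : K.act g φ = φ := by
  subst hK
  have key : ∀ v : Fin 1 → ℂ, (wigner 0 g).mulVec v = v := fun v => by
    rw [wigner_zero, Matrix.one_mulVec]
  exact key φ

lemma slotAct_spin_zero {N : ℕ} {c : Fin N → Kind} {b : Fin N} (hb : c b = .spin 0) (g : SU2)
    (Φ : State c) : slotAct c b g Φ = Φ := by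
  funext x
  rw [slotAct, act_spin_zero hb, Function.update_eq_self]

/-- Sliding of a strand `(θ, s)` over a circle `Ω*` around a strand `(0, j)`. -/
theorem slide_flux (n : ℕ) (s : ℤ) (θ : ℝ) (δ : Bool) (Φ : State ![.flux s, .spin n])
    (y : Config ![.flux s, .spin n]) :
    (∀ ε ε' : Bool, IntervalIntegrable (fun t => evalFlux t ![.flux s, .spin n]
      ![θ, 0] (slideWord δ ε ε') Φ y) volume 0 (2 * Real.pi)) ∧
    ∀ ε₁ ε₁' ε₂ ε₂' : Bool,
      omegaStar (fun t => evalFlux t ![.flux s, .spin n] ![θ, 0] (slideWord δ ε₁ ε₁') Φ) y =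
      omegaStar (fun t => evalFlux t ![.flux s, .spin n] ![θ, 0] (slideWord δ ε₂ ε₂') Φ) y := by
  have key := fun ε ε' => omegaStar_chi n
    (fun t => evalFlux t ![.flux s, .spin n] ![θ, 0] (slideWord δ ε ε') Φ) y _
    fun t => evalFlux_slideWord t n s θ δ ε ε' Φ y
  refine ⟨fun ε ε' => (key ε ε').1, fun ε₁ ε₁' ε₂ ε₂' => ?_⟩
  refine ((key ε₁ ε₁').2).trans (Eq.trans ?_ (key ε₂ ε₂').2.symm)
  -- For j = 0 linking is invisible because D⁰ = 1; for j ≠ 0 both sides vanish.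
  rcases eq_or_ne n 0 with hn | hn
  · subst hn
    refine congrArg _ ?_
    rw [slotAct_spin_zero rfl, slotAct_spin_zero rfl]
  · simp only [if_neg hn, zero_mul]

/-- A circle `Ω*` around a strand `(0, j)`. -/
theorem kill_spin (n : ℕ) (δ : Bool) (Φ : State ![.spin n]) (y : Config ![.spin n]) :
    IntervalIntegrable (fun t => evalFlux t ![.spin n] ![0] (circleWord δ) Φ y)
      volume 0 (2 * Real.pi) ∧
    omegaStar (fun t => evalFlux t ![.spin n] ![0] (circleWord δ) Φ) y =
      (if n = 0 then 1 else 0) * Φ y :=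
  omegaStar_chi n (fun t => evalFlux t ![.spin n] ![0] (circleWord δ) Φ) y _
    fun t => evalFlux_circleWord_spin t n δ Φ y

/-! ### The `Ω` expansion of the delta function -/

/-- The pairing of `d_j χ_j`, `j = k/2`, with a test function. -/
def omegaCoeff (f : ℝ → ℂ) (k : ℕ) : ℂ :=
  ∫ t in (0 : ℝ)..(2 * Real.pi),
    ((deltaSq t / Real.pi : ℝ) : ℂ) * (f t * (((k : ℂ) + 1) * chi k t))

/-- `(2/π) ∫ g(t) cos(m t/2) dt`. -/
def cosCoeff (g : ℝ → ℂ) (m : ℕ) : ℂ :=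
  (1 / Real.pi : ℂ) * ∫ t in (0 : ℝ)..(2 * Real.pi), g t * (Real.cos (m * (t / 2)) : ℂ)

/-- Integration by parts against −2 cos(m t/2). The boundary terms stay here, whereas in
`integral_mul_cos_half` they vanish because sin(mπ) = 0. -/
lemma integral_mul_sin_half {u u' : ℝ → ℂ} (hu : ∀ t, HasDerivAt u (u' t) t) (hu' : Continuous u')
    (m : ℕ) :
    (m : ℂ) * ∫ t in (0 : ℝ)..(2 * Real.pi), u t * (Real.sin (m * (t / 2)) : ℂ) =
      2 * u 0 - 2 * (Real.cos (m * Real.pi) : ℂ) * u (2 * Real.pi) +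
      2 * ∫ t in (0 : ℝ)..(2 * Real.pi), u' t * (Real.cos (m * (t / 2)) : ℂ) := by
  have hv : ∀ t : ℝ, HasDerivAt (fun t : ℝ => ((-2 * Real.cos (m * (t / 2)) : ℝ) : ℂ))
      ((m * Real.sin (m * (t / 2)) : ℝ) : ℂ) t := by
    intro t
    have h2 : HasDerivAt (fun t : ℝ => (m : ℝ) * (t / 2)) ((m : ℝ) * (1 / 2)) t :=
      ((hasDerivAt_id t).div_const 2).const_mul _
    refine HasDerivAt.ofReal_comp (((h2.cos).const_mul (-2)).congr_deriv ?_)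
    ring
  have key := intervalIntegral.integral_mul_deriv_eq_deriv_mul (a := 0) (b := 2 * Real.pi)
    (fun t _ => hu t) (fun t _ => hv t) (hu'.intervalIntegrable _ _)
    (Continuous.intervalIntegrable (by fun_prop) _ _)
  have e1 : (m : ℝ) * (2 * Real.pi / 2) = m * Real.pi := by ring
  rw [e1] at key
  simp only [zero_div, mul_zero, Real.cos_zero] at key
  have e2 : ∫ t in (0 : ℝ)..(2 * Real.pi), u' t * ((-2 * Real.cos (m * (t / 2)) : ℝ) : ℂ) =
      -2 * ∫ t in (0 : ℝ)..(2 * Real.pi), u' t * (Real.cos (m * (t / 2)) : ℂ) := by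
    rw [← intervalIntegral.integral_const_mul]
    congr 1; funext t; push_cast; ring
  calc _ = ∫ t in (0 : ℝ)..(2 * Real.pi), u t * ((m * Real.sin (m * (t / 2)) : ℝ) : ℂ) := by
        rw [← intervalIntegral.integral_const_mul]
        congr 1; funext t; push_cast; ring
    _ = _ := key
    _ = _ := by
        rw [e2]
        push_cast
        ring

lemma integral_mul_cos_half {u u' : ℝ → ℂ} (hu : ∀ t, HasDerivAt u (u' t) t) (hu' : Continuous u')
    (m : ℕ) :
    (m : ℂ) * ∫ t in (0 : ℝ)..(2 * Real.pi), u t * (Real.cos (m * (t / 2)) : ℂ) =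
      -(2 * ∫ t in (0 : ℝ)..(2 * Real.pi), u' t * (Real.sin (m * (t / 2)) : ℂ)) := by
  have hv : ∀ t : ℝ, HasDerivAt (fun t : ℝ => ((2 * Real.sin (m * (t / 2)) : ℝ) : ℂ))
      ((m * Real.cos (m * (t / 2)) : ℝ) : ℂ) t := by
    intro t
    have h2 : HasDerivAt (fun t : ℝ => (m : ℝ) * (t / 2)) ((m : ℝ) * (1 / 2)) t :=
      ((hasDerivAt_id t).div_const 2).const_mul _
    refine HasDerivAt.ofReal_comp (((h2.sin).const_mul 2).congr_deriv ?_)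
    ring
  have key := intervalIntegral.integral_mul_deriv_eq_deriv_mul (a := 0) (b := 2 * Real.pi)
    (fun t _ => hu t) (fun t _ => hv t) (hu'.intervalIntegrable _ _)
    (Continuous.intervalIntegrable (by fun_prop) _ _)
  have e1 : Real.sin (m * (2 * Real.pi / 2)) = 0 := by
    rw [mul_div_cancel_left₀ _ two_ne_zero]
    exact Real.sin_nat_mul_pi m
  rw [e1] at key
  simp only [zero_div, mul_zero, Real.sin_zero, Complex.ofReal_zero, sub_zero, zero_sub] at key
  calc _ = ∫ t in (0 : ℝ)..(2 * Real.pi), u t * ((m * Real.cos (m * (t / 2)) : ℝ) : ℂ) := by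
        rw [← intervalIntegral.integral_const_mul]
        congr 1; funext t; push_cast; ring
    _ = _ := key
    _ = _ := by
        rw [← intervalIntegral.integral_const_mul]
        congr 2; funext t; push_cast; ring

lemma exists_bound_integral {g : ℝ → ℂ} (hg : Continuous g) : ∃ M : ℝ, ∀ m : ℕ,
    ‖∫ t in (0 : ℝ)..(2 * Real.pi), g t * (Real.cos (m * (t / 2)) : ℂ)‖ ≤ M := by
  obtain ⟨M, hM⟩ := isCompact_uIcc.exists_bound_of_continuousOn
    (hg.continuousOn (s := Set.uIcc 0 (2 * Real.pi)))
  refine ⟨M * |2 * Real.pi - 0|, fun m => intervalIntegral.norm_integral_le_of_norm_le_const ?_⟩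
  intro t ht
  rw [norm_mul, Complex.norm_real, Real.norm_eq_abs]
  have h1 := hM t (Set.uIoc_subset_uIcc ht)
  exact (mul_le_of_le_one_right (norm_nonneg _) (Real.abs_cos_le_one _)).trans h1

section

variable {g g' g'' : ℝ → ℂ} (hg : ∀ t, HasDerivAt g (g' t) t)
  (hg' : ∀ t, HasDerivAt g' (g'' t) t) (hg'' : Continuous g'')

include hg hg' hg''

/-- Two integrations by parts give decay m⁻². Absolute summability provides both the pointwise value
of the Fourier series and the unconditional convergence over spins. -/
lemma summable_cosCoeff : Summable (cosCoeff g) := by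
  obtain ⟨M, hM⟩ := exists_bound_integral hg''
  have hcg' : Continuous g' := continuous_iff_continuousAt.mpr fun t => (hg' t).continuousAt
  set B : ℝ := (1 / Real.pi) * (2 * (2 * ‖g' 0‖ + 2 * ‖g' (2 * Real.pi)‖ + 2 * M)) with hB
  rw [← summable_nat_add_iff 1]
  have hs : Summable fun m : ℕ => B * (1 / ((m + 1 : ℕ) : ℝ) ^ 2) :=
    (((summable_nat_add_iff 1).mpr (Real.summable_one_div_nat_pow.mpr one_lt_two))).mul_left B
  refine Summable.of_norm_bounded hs fun k => ?_
  set m := k + 1 with hm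
  have hm0 : (0 : ℝ) < ((m : ℕ) : ℝ) := by positivity
  have e1 := integral_mul_cos_half hg hcg' m
  have e2 := integral_mul_sin_half hg' hg'' m
  have e3 : ((m : ℂ) ^ 2) * cosCoeff g m = (1 / Real.pi : ℂ) * -(2 * (2 * g' 0 -
      2 * (Real.cos (m * Real.pi) : ℂ) * g' (2 * Real.pi) +
      2 * ∫ t in (0 : ℝ)..(2 * Real.pi), g'' t * (Real.cos (m * (t / 2)) : ℂ))) := by
    rw [← e2, cosCoeff]
    linear_combination (1 / Real.pi : ℂ) * (m : ℂ) * e1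
  have hcos : ‖(Real.cos (m * Real.pi) : ℂ)‖ ≤ 1 := by
    rw [Complex.norm_real, Real.norm_eq_abs]
    exact Real.abs_cos_le_one _
  have e4 : ((m : ℝ) ^ 2) * ‖cosCoeff g m‖ ≤ B := by
    have := congrArg norm e3
    rw [norm_mul, norm_pow, Complex.norm_natCast] at this
    rw [this, hB, norm_mul, norm_neg, norm_mul, norm_div, norm_one, Complex.norm_real,
      Real.norm_of_nonneg Real.pi_pos.le, Complex.norm_ofNat]
    gcongr
    refine (norm_add_le _ _).trans (add_le_add ((norm_sub_le _ _).trans (add_le_add ?_ ?_)) ?_)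
    · rw [norm_mul, Complex.norm_ofNat]
    · rw [norm_mul, norm_mul, Complex.norm_ofNat]
      exact mul_le_mul_of_nonneg_right (by linarith) (norm_nonneg _)
    · rw [norm_mul, Complex.norm_ofNat]
      exact mul_le_mul_of_nonneg_left (hM m) zero_le_two
  rw [mul_one_div, le_div_iff₀ (by positivity), mul_comm]
  exact e4

/-- The cosine series on `[0, 2π]` at the origin. -/
lemma hasSum_cosCoeff : HasSum (fun k => cosCoeff g (k + 1))
    (g 0 - (1 / (2 * Real.pi) : ℂ) * ∫ t in (0 : ℝ)..(2 * Real.pi), g t) := by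
  have hsum := summable_cosCoeff hg hg' hg''
  have hcg : Continuous g := continuous_iff_continuousAt.mpr fun t => (hg t).continuousAt
  have hpi := Real.pi_pos
  have hT : Fact (0 < 4 * Real.pi) := ⟨by positivity⟩
  -- The even extension matches at ±2π whatever the boundary values of g, so it is continuous on the
  -- circle of length 4π.
  let G : ℝ → ℂ := fun x => g |x|
  have hG : Continuous G := hcg.comp continuous_abs
  let a₀ : ℝ := -(2 * Real.pi)
  have hab : a₀ + 4 * Real.pi = 2 * Real.pi := by ring
  have hGab : G a₀ = G (a₀ + 4 * Real.pi) := by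
    change g |_| = g |_|
    rw [hab, abs_neg]
  let F : C(AddCircle (4 * Real.pi), ℂ) :=
    ⟨AddCircle.liftIco (4 * Real.pi) a₀ G, AddCircle.liftIco_continuous hGab hG.continuousOn⟩
  have hcoef : ∀ m : ℤ, fourierCoeff F m = cosCoeff g m.natAbs / 2 := by
    intro m
    have h1 : fourierCoeff F m = _ := fourierCoeff_liftIco_eq (a := a₀) G m
    rw [h1, fourierCoeffOn_eq_integral, hab]
    have hexp : ∀ x : ℝ, (fourier (-m)) (x : AddCircle (2 * Real.pi - a₀)) • G x =
        Complex.exp (-(Complex.I * m * x / 2)) * G x := by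
      intro x
      rw [fourier_coe_apply, smul_eq_mul]
      congr 2
      have : ((2 * Real.pi - a₀ : ℝ) : ℂ) = 4 * Real.pi := by
        simp only [a₀]; push_cast; ring
      have hpi' : (Real.pi : ℂ) ≠ 0 := by exact_mod_cast hpi.ne'
      rw [this]
      push_cast
      field_simp
      ring
    simp only [hexp]
    have hc : Continuous fun x : ℝ => Complex.exp (-(Complex.I * m * x / 2)) * G x := by fun_prop
    rw [← intervalIntegral.integral_add_adjacent_intervals (b := 0)
      (hc.intervalIntegrable _ _) (hc.intervalIntegrable _ _)]
    have hneg := intervalIntegral.integral_comp_neg (a := 0) (b := 2 * Real.pi)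
      fun x : ℝ => Complex.exp (-(Complex.I * m * x / 2)) * G x
    rw [neg_zero] at hneg
    have hc' : Continuous fun x : ℝ =>
        Complex.exp (-(Complex.I * m * (-x : ℝ) / 2)) * G (-x) := by fun_prop
    rw [← hneg, ← intervalIntegral.integral_add (hc'.intervalIntegrable _ _)
      (hc.intervalIntegrable _ _)]
    have hpt : ∀ x ∈ Set.uIcc 0 (2 * Real.pi),
        Complex.exp (-(Complex.I * m * (-x : ℝ) / 2)) * G (-x) +
          Complex.exp (-(Complex.I * m * x / 2)) * G x =
        2 * (g x * (Real.cos (m.natAbs * (x / 2)) : ℂ)) := by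
      intro x hx
      rw [Set.uIcc_of_le (by positivity)] at hx
      have hcosabs : Real.cos (m.natAbs * (x / 2)) = Real.cos (m * (x / 2)) := by
        rw [← Real.cos_abs (m * (x / 2)), abs_mul, abs_of_nonneg (div_nonneg hx.1 zero_le_two),
          Nat.cast_natAbs, Int.cast_abs]
      simp only [G, abs_neg, abs_of_nonneg hx.1]
      rw [hcosabs, Complex.ofReal_cos, Complex.cos]
      push_cast
      have i1 : -(Complex.I * m * -x / 2) = m * (x / 2) * Complex.I := by ring
      have i2 : -(Complex.I * m * x / 2) = -(m * (x / 2)) * Complex.I := by ring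
      rw [i1, i2]
      ring
    rw [intervalIntegral.integral_congr hpt, intervalIntegral.integral_const_mul, cosCoeff,
      Complex.real_smul]
    have : (2 * Real.pi - a₀ : ℝ) = 4 * Real.pi := by simp only [a₀]; ring
    rw [this]
    push_cast
    have hpi' : (Real.pi : ℂ) ≠ 0 := by exact_mod_cast hpi.ne'
    field_simp
    ring
  have hsumF : Summable (fourierCoeff F) := by
    refine Summable.of_nat_of_neg ?_ ?_
    · simpa [hcoef] using hsum.div_const 2
    · simpa [hcoef] using hsum.div_const 2
  have h1 := has_pointwise_sum_fourier_series_of_summable hsumF 0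
  have hF0 : F 0 = g 0 := by
    have : AddCircle.liftIco (4 * Real.pi) a₀ G ((0 : ℝ) : AddCircle (4 * Real.pi)) = G 0 :=
      AddCircle.liftIco_coe_apply ⟨by simp only [a₀]; linarith, by rw [hab]; linarith⟩
    exact this.trans (congrArg g abs_zero)
  -- Pairing m with −m counts m = 0 twice; dropping that term below turns g 0 + c₀/2 into g 0 −
  -- c₀/2, where c₀ is the zeroth cosine coefficient.
  have h2 := HasSum.nat_add_neg h1
  simp only [fourier_eval_zero, smul_eq_mul, mul_one, hcoef, Int.natAbs_neg, Int.natAbs_natCast,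
    add_halves, hF0, Int.natAbs_zero] at h2
  have h3 := (hasSum_nat_add_iff' 1).mpr h2
  rw [show g 0 - (1 / (2 * Real.pi) : ℂ) * ∫ t in (0 : ℝ)..(2 * Real.pi), g t =
    g 0 + cosCoeff g 0 / 2 - ∑ i ∈ Finset.range 1, cosCoeff g i from ?_]
  · exact h3
  rw [Finset.sum_range_one, cosCoeff]
  simp only [Nat.cast_zero, zero_mul, Real.cos_zero, Complex.ofReal_one, mul_one]
  ring

end

/-- With u = f sin(t/2), `sin_mul_chi` turns the k-th term into (k+1)/π times the integral of u
sin((k+1)t/2). As u vanishes at 0 and 2π, an integration by parts makes it twice a cosine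
coefficient of u'. Since u' has mean zero, its cosine series at 0 sums to u'(0) = f(0)/2. -/
lemma hasSum_omegaCoeff {f : ℝ → ℂ} (hf : ContDiff ℝ ∞ f) : HasSum (omegaCoeff f) (f 0) := by
  have hs : ContDiff ℝ ∞ fun t : ℝ => (Real.sin (t / 2) : ℂ) :=
    Complex.ofRealCLM.contDiff.comp (Real.contDiff_sin.comp (contDiff_id.div_const 2))
  let u : ℝ → ℂ := fun t => f t * (Real.sin (t / 2) : ℂ)
  have hu : ContDiff ℝ ∞ u := hf.mul hs
  have hd : ∀ v : ℝ → ℂ, ContDiff ℝ ∞ v → ∀ t, HasDerivAt v (deriv v t) t := fun v hv t =>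
    (hv.differentiable (by simp)).differentiableAt.hasDerivAt
  have hd1 : ∀ v : ℝ → ℂ, ContDiff ℝ ∞ v → ContDiff ℝ ∞ (deriv v) := fun v hv =>
    (contDiff_infty_iff_deriv.mp hv).2
  have h0 : u 0 = 0 := by simp [u]
  have h1 : u (2 * Real.pi) = 0 := by simp [u]
  have hcoef : ∀ k, omegaCoeff f k = 2 * cosCoeff (deriv u) (k + 1) := by
    intro k
    have e := integral_mul_sin_half (hd u hu) (hd1 u hu).continuous (k + 1)
    rw [h0, h1] at e
    have hpt : ∀ t, ((deltaSq t / Real.pi : ℝ) : ℂ) * (f t * (((k : ℂ) + 1) * chi k t)) =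
        (1 / Real.pi : ℂ) * (((k + 1 : ℕ) : ℂ) *
          (u t * (Real.sin (((k + 1 : ℕ) : ℝ) * (t / 2)) : ℂ))) := by
      intro t
      have := sin_mul_chi k t
      rw [Nat.cast_succ (R := ℝ), ← this, deltaSq]
      simp only [u]
      push_cast
      ring
    rw [omegaCoeff]
    simp only [hpt]
    rw [intervalIntegral.integral_const_mul, intervalIntegral.integral_const_mul, e, cosCoeff]
    ring
  have key := (hasSum_cosCoeff (hd _ (hd1 u hu)) (hd _ (hd1 _ (hd1 u hu)))
    (hd1 _ (hd1 _ (hd1 u hu))).continuous).mul_left 2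
  have hint : ∫ t in (0 : ℝ)..(2 * Real.pi), deriv u t = 0 := by
    rw [intervalIntegral.integral_deriv_eq_sub' u rfl
      (fun t _ => (hd u hu t).differentiableAt) (hd1 u hu).continuous.continuousOn, h0, h1, sub_zero]
  have hd0 : deriv u 0 = f 0 / 2 := by
    have hsin : HasDerivAt (fun t : ℝ => (Real.sin (t / 2) : ℂ)) (1 / 2) 0 := by
      have h2 : HasDerivAt (fun t : ℝ => t / 2) (1 / 2) (0 : ℝ) := (hasDerivAt_id _).div_const 2
      have := (h2.sin).ofReal_comp
      simpa using this
    refine ((hd f hf 0).mul hsin).deriv.trans ?_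
    simp [div_eq_mul_inv]
  have hfun : omegaCoeff f = fun k => 2 * cosCoeff (deriv u) (k + 1) := funext hcoef
  rw [hfun]
  rw [hint, hd0, mul_zero, sub_zero, mul_div_cancel₀ _ two_ne_zero] at key
  exact key

end DoubleSU2

end

noncomputable section

namespace DoubleSU2

/-! ### Product measures -/

instance Kind.isFiniteMeasure_measure : (k : Kind) → IsFiniteMeasure k.measure
  | .flux _ => inferInstanceAs (IsFiniteMeasure haar)
  | .spin n => inferInstanceAs (IsFiniteMeasure (Measure.count : Measure (Fin (n + 1))))

lemma measurePreserving_two (c : Fin 2 → Kind) :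
    MeasurePreserving (MeasurableEquiv.piFinTwo fun b => (c b).Point) (configMeasure c)
      ((c 0).measure.prod (c 1).measure) :=
  measurePreserving_piFinTwo fun b => (c b).measure

lemma measurePreserving_one (c : Fin 1 → Kind) :
    MeasurePreserving (MeasurableEquiv.piUnique fun b => (c b).Point) (configMeasure c)
      (c 0).measure :=
  measurePreserving_piUnique fun b => (c b).measure

/-! ### Finite combinations in `L²` -/

/-- All terms lie in the span of finitely many fixed L² functions, so convergence in norm follows
from that of finitely many scalar series. The Ψ i will be components of a state that do not involve
θ. -/
lemma hasSumL2_of_finite {X ι : Type} [MeasurableSpace X] [Fintype ι] {μ : Measure X}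
    {F : ℕ → X → ℂ} {L : X → ℂ} {r : ι → ℕ → ℂ} {z : ℂ} {Ψ : ι → X → ℂ}
    (hr : ∀ i, HasSum (r i) z) (hΨ : ∀ i, MemLp (Ψ i) 2 μ)
    (hF : ∀ k y, F k y = ∑ i, r i k * Ψ i y) (hL : ∀ y, L y = z * ∑ i, Ψ i y) :
    HasSumL2 μ F L := by
  have hfun : ∀ s : Finset ℕ, (fun y => ∑ k ∈ s, F k y - L y) =
      ∑ i, (∑ k ∈ s, r i k - z) • Ψ i := by
    intro s
    funext y
    simp only [hF, hL, Finset.sum_apply, Pi.smul_apply, smul_eq_mul, sub_mul,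
      Finset.sum_sub_distrib, Finset.mul_sum, Finset.sum_mul]
    rw [Finset.sum_comm]
  have hbound : ∀ s : Finset ℕ, eLpNorm (fun y => ∑ k ∈ s, F k y - L y) 2 μ ≤
      ∑ i, ‖∑ k ∈ s, r i k - z‖ₑ * eLpNorm (Ψ i) 2 μ := by
    intro s
    rw [hfun]
    refine (eLpNorm_sum_le (fun i _ => ((hΨ i).const_smul _).aestronglyMeasurable)
      one_le_two).trans (Finset.sum_le_sum fun i _ => ?_)
    exact (eLpNorm_const_smul _ _ _ _).le
  have hlim : Tendsto (fun s : Finset ℕ => ∑ i, ‖∑ k ∈ s, r i k - z‖ₑ * eLpNorm (Ψ i) 2 μ) atTop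
      (𝓝 (∑ _i : ι, 0)) := by
    refine tendsto_finsetSum _ fun i _ => ?_
    have h1 : Tendsto (fun s : Finset ℕ => ‖∑ k ∈ s, r i k - z‖ₑ) atTop (𝓝 0) := by
      have : Tendsto (fun s : Finset ℕ => ∑ k ∈ s, r i k - z) atTop (𝓝 (z - z)) :=
        (hr i).sub_const z
      rw [sub_self] at this
      simpa using this.enorm
    have := ENNReal.Tendsto.mul_const (b := eLpNorm (Ψ i) 2 μ) h1 (Or.inr (hΨ i).2.ne)
    rwa [zero_mul] at this
  rw [Finset.sum_const_zero] at hlim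
  exact tendsto_of_tendsto_of_tendsto_of_le_of_le tendsto_const_nhds hlim (fun _ => zero_le)
    hbound

/-- A circle `Ω` around a strand `(θ, s)`. -/
theorem kill_flux (s : ℤ) (δ : Bool) :
    OmegaEvaluatesTo ![.flux s] (fun k t => evalSpin k ![.flux s] ![t] (circleWord δ))
      (deltaId ![.flux s]) := by
  intro f hf Φ hΦ
  have heval : ∀ (k : ℕ) (t : ℝ) (y : Config ![.flux s]),
      evalSpin k ![.flux s] ![t] (circleWord δ) Φ y = chi k t * Φ y := fun k t y =>
    (evalSpin_circleWord k ![.flux s] ![t] δ Φ y).trans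
      (congrArg (· * Φ y) (character_signed_conj k δ (y 0) t))
  have hc : ∀ k, Continuous fun t => (chi k t : ℂ) := fun k =>
    Complex.continuous_ofReal.comp (continuous_chi k)
  refine ⟨fun k y => ?_, ?_⟩
  · simp only [heval]
    exact ((hc k).mul continuous_const).intervalIntegrable _ _
  · refine hasSumL2_of_finite (ι := Unit) (r := fun _ => omegaCoeff f) (Ψ := fun _ => Φ)
      (fun _ => hasSum_omegaCoeff hf) (fun _ => hΦ.memLp) (fun k y => ?_) fun y => by
        simp [deltaId]
    simp only [heval, testAgainst, Finset.univ_unique, Finset.sum_singleton, omegaCoeff]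
    rw [← intervalIntegral.integral_mul_const]
    congr 1
    funext t
    ring

/-! ### Sliding over `Ω` -/

/-- The projection of a state on `(0, n/2) ⊗ (θ, s)` to the `l`-th eigenspace of the
holonomy of the second strand acting on the first one. -/
def eigenProj (n : ℕ) (s : ℤ) (Φ : State ![.spin n, .flux s]) (l : Fin (n + 1)) :
    State ![.spin n, .flux s] := fun y =>
  wigner n (show SU2 from y 1) (show Fin (n + 1) from y 0) l *
    ∑ b : Fin (n + 1), (starRingEnd ℂ) (wigner n (show SU2 from y 1) b l) *
      Φ (Function.update y 0 b)

/-- Diagonalise D(x h_τ x⁻¹) = D(x) D(h_τ) D(x)⁻¹: the projections depend on x only, and the angle τ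
enters through scalars. -/
lemma slotAct_conj_h (n : ℕ) (s : ℤ) (τ : ℝ) (Φ : State ![.spin n, .flux s])
    (y : Config ![.spin n, .flux s]) :
    slotAct ![.spin n, .flux s] 0 ((show SU2 from y 1) * h τ * (show SU2 from y 1)⁻¹) Φ y =
      ∑ l : Fin (n + 1), weight n l τ * eigenProj n s Φ l y := by
  have key : ∀ (x : SU2) (a : Fin (n + 1)) (v : Fin (n + 1) → ℂ),
      (wigner n (x * h τ * x⁻¹)).mulVec v a = ∑ l : Fin (n + 1), weight n l τ *
        (wigner n x a l * ∑ b, (starRingEnd ℂ) (wigner n x b l) * v b) := by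
    intro x a v
    rw [wigner_mul, wigner_mul, wigner_h, wigner_inv, ← Matrix.mulVec_mulVec,
      ← Matrix.mulVec_mulVec, Matrix.mulVec, dotProduct]
    refine Finset.sum_congr rfl fun l _ => ?_
    rw [Matrix.mulVec_diagonal, mul_left_comm]
    rfl
  exact key (y 1) (y 0) fun b => Φ (Function.update y 0 b)

lemma measurable_eigenProj (n : ℕ) (s : ℤ) {Φ : State ![.spin n, .flux s]} (hΦ : Measurable Φ)
    (l : Fin (n + 1)) : Measurable (eigenProj n s Φ l) := by
  let e := MeasurableEquiv.piFinTwo fun b => (![Kind.spin n, Kind.flux s] b).Point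
  let F : Fin (n + 1) × SU2 → ℂ := fun p => Φ (e.symm p)
  have hF : Measurable F := hΦ.comp e.symm.measurable
  let G : Fin (n + 1) × SU2 → ℂ := fun p => wigner n p.2 p.1 l *
    ∑ b : Fin (n + 1), (starRingEnd ℂ) (wigner n p.2 b l) * F (b, p.2)
  have hG : Measurable G := by
    refine Measurable.mul ?_ (Finset.measurable_sum _ fun b _ => Measurable.mul ?_ ?_)
    · exact measurable_from_prod_countable_right fun b => (continuous_wigner n b l).measurable
    · exact Complex.continuous_conj.measurable.comp
        ((continuous_wigner n b l).measurable.comp measurable_snd)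
    · exact hF.comp (measurable_const.prodMk measurable_snd)
  have hfun : eigenProj n s Φ l = fun y => G (e y) := by
    funext y
    have hu : ∀ b : Fin (n + 1), Function.update y 0 b = e.symm (b, y 1) := fun b => by
      refine e.injective ?_
      rw [e.apply_symm_apply]
      rfl
    exact congrArg (wigner n (show SU2 from y 1) (show Fin (n + 1) from y 0) l * ·)
      (Finset.sum_congr rfl fun b _ => congrArg (_ * Φ ·) (hu b))
  rw [hfun]
  exact hG.comp e.measurable

lemma memLp_update (n : ℕ) (s : ℤ) {Φ : State ![.spin n, .flux s]}
    (hL : MemLp Φ 2 (configMeasure ![.spin n, .flux s])) (b : Fin (n + 1)) :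
    MemLp (fun y : Config ![.spin n, .flux s] => Φ (Function.update y 0 b)) 2
      (configMeasure ![.spin n, .flux s]) := by
  let e := MeasurableEquiv.piFinTwo fun b => (![Kind.spin n, Kind.flux s] b).Point
  let ν : Measure (Fin (n + 1) × SU2) := (Measure.count : Measure (Fin (n + 1))).prod haar
  have he : MeasurePreserving e (configMeasure ![.spin n, .flux s]) ν := measurePreserving_two _
  let F : Fin (n + 1) × SU2 → ℂ := fun p => Φ (e.symm p)
  have h1 : MemLp F 2 ν := hL.comp_measurePreserving (he.symm e)
  -- Freezing the spin index restricts counting measure to one of its atoms.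
  have hle : (Measure.dirac b).prod haar ≤ ν :=
    Measure.prod_mono (Measure.le_sum (fun b : Fin (n + 1) => Measure.dirac b) b) le_rfl
  have h2 : MemLp F 2 ((Measure.dirac b).prod haar) := h1.mono_measure hle
  rw [Measure.dirac_prod] at h2
  have h3 : MemLp (fun x : SU2 => F (b, x)) 2 haar :=
    (memLp_map_measure_iff h2.aestronglyMeasurable (by fun_prop)).1 h2
  have h4 := (h3.comp_snd (Measure.count : Measure (Fin (n + 1)))).comp_measurePreserving he
  refine (memLp_congr_ae (Eventually.of_forall fun y => ?_)).1 h4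
  refine congrArg Φ (e.injective ?_)
  exact (e.apply_symm_apply _).trans rfl

lemma memLp_eigenProj (n : ℕ) (s : ℤ) {Φ : State ![.spin n, .flux s]} (hΦ : Measurable Φ)
    (hL : MemLp Φ 2 (configMeasure ![.spin n, .flux s])) (l : Fin (n + 1)) :
    MemLp (eigenProj n s Φ l) 2 (configMeasure ![.spin n, .flux s]) := by
  have h1 : MemLp (fun y : Config ![.spin n, .flux s] =>
      ∑ b : Fin (n + 1), ‖Φ (Function.update y 0 b)‖) 2 (configMeasure ![.spin n, .flux s]) :=
    memLp_finsetSum _ fun b _ => (memLp_update n s hL b).norm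
  refine h1.mono (measurable_eigenProj n s hΦ l).aestronglyMeasurable
    (Eventually.of_forall fun y => ?_)
  rw [Real.norm_of_nonneg (Finset.sum_nonneg fun b _ => norm_nonneg _), eigenProj, norm_mul]
  refine (mul_le_of_le_one_left (norm_nonneg _) (norm_wigner_le_one _ _ _ _)).trans
    ((norm_sum_le _ _).trans (Finset.sum_le_sum fun b _ => ?_))
  rw [norm_mul, RCLike.norm_conj]
  exact mul_le_of_le_one_left (norm_nonneg _) (norm_wigner_le_one _ _ _ _)

lemma h_zero : h 0 = 1 := by
  refine ext_of_first_column ?_ ?_ <;> simp [h]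

lemma weight_zero (n k : ℕ) : weight n k 0 = 1 := by simp [weight]

lemma sum_eigenProj (n : ℕ) (s : ℤ) (Φ : State ![.spin n, .flux s])
    (y : Config ![.spin n, .flux s]) : ∑ l : Fin (n + 1), eigenProj n s Φ l y = Φ y := by
  have h1 := slotAct_conj_h n s 0 Φ y
  simp only [weight_zero, one_mul] at h1
  have h2 : ∀ x : SU2, x * h 0 * x⁻¹ = 1 := fun x => by
    rw [h_zero, mul_one, mul_inv_cancel]
  exact h1.symm.trans ((congrArg (fun g => slotAct ![.spin n, .flux s] 0 g Φ y) (h2 (y 1))).trans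
    (congrFun (slotAct_one _ _) y))

lemma contDiff_weight (n k : ℕ) (r : ℝ) : ContDiff ℝ ∞ fun t : ℝ => weight n k (r * t) := by
  unfold weight
  have : ContDiff ℝ ∞ fun t : ℝ => ((r * t : ℝ) : ℂ) :=
    Complex.ofRealCLM.contDiff.comp (contDiff_const.mul contDiff_id)
  exact (contDiff_const.mul ((contDiff_const.mul this).div_const _)).cexp

/-- Sliding of a strand `(0, n/2)` over a circle `Ω` around a strand `(θ, s)`. -/
theorem slide_spin (n : ℕ) (s : ℤ) (δ ε ε' : Bool) :
    OmegaEvaluatesTo ![.spin n, .flux s]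
      (fun k t => evalSpin k ![.spin n, .flux s] ![0, t] (slideWord δ ε ε'))
      (deltaId ![.spin n, .flux s]) := by
  intro f hf Φ hΦ
  -- The linking of the passing strand: 1 or −1 when it links, 0 when it passes on either side.
  let r : ℝ := (if ε' then 1 else 0) - if ε then 0 else 1
  have hr : ∀ (x : SU2) (t : ℝ), (if ε' then x * h t * x⁻¹ else 1) *
      (if ε then 1 else (x * h t * x⁻¹)⁻¹) = x * h (r * t) * x⁻¹ := by
    intro x t
    cases ε <;> cases ε' <;> simp [r, h_zero, ← h_inv, mul_assoc]
  have heval : ∀ (k : ℕ) (t : ℝ) (y : Config ![.spin n, .flux s]),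
      evalSpin k ![.spin n, .flux s] ![0, t] (slideWord δ ε ε') Φ y =
        chi k t * ∑ l : Fin (n + 1), weight n l (r * t) * eigenProj n s Φ l y := fun k t y =>
    (evalSpin_slideWord k ![.spin n, .flux s] ![0, t] (fun _ => rfl) δ ε ε' Φ y).trans
      (congrArg₂ (· * ·) (character_signed_conj k δ (y 1) t)
        ((congrArg (fun g => slotAct ![.spin n, .flux s] 0 g Φ y) (hr (y 1) t)).trans
          (slotAct_conj_h n s (r * t) Φ y)))
  have hc : ∀ k, Continuous fun t => (chi k t : ℂ) := fun k =>
    Complex.continuous_ofReal.comp (continuous_chi k)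
  have hw : ∀ l, Continuous fun t => weight n l (r * t) := fun l =>
    (contDiff_weight n l r).continuous
  refine ⟨fun k y => ?_, ?_⟩
  · simp only [heval]
    refine Continuous.intervalIntegrable ?_ _ _
    exact (hc k).mul (continuous_finsetSum _ fun l _ => (hw l).mul continuous_const)
  -- The weights are smooth in t and equal 1 at t = 0, so f times a weight is a test function with
  -- the same value f 0 at the origin; the limit is the same for all components and all linkings.
  · refine hasSumL2_of_finite (z := f 0)
      (r := fun l : Fin (n + 1) => omegaCoeff fun t => f t * weight n l (r * t))
      (Ψ := eigenProj n s Φ) (fun l => ?_) (memLp_eigenProj n s hΦ.measurable hΦ.memLp)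
      (fun k y => ?_) fun y => ?_
    · have := hasSum_omegaCoeff (hf.mul (contDiff_weight n l r))
      rwa [mul_zero, weight_zero, mul_one] at this
    · simp only [heval, testAgainst, omegaCoeff]
      rw [← Finset.sum_congr rfl fun l _ => intervalIntegral.integral_mul_const _ _,
        ← intervalIntegral.integral_finsetSum]
      · congr 1
        funext t
        simp only [Finset.mul_sum]
        refine Finset.sum_congr rfl fun l _ => ?_
        ring
      · intro l _
        have hd : Continuous fun t => ((deltaSq t / Real.pi : ℝ) : ℂ) := by
          unfold deltaSq
          fun_prop
        exact ((hd.mul ((hf.continuous.mul (hw l)).mul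
          (continuous_const.mul (hc k)))).mul continuous_const).intervalIntegrable _ _
    · rw [sum_eigenProj]
      rfl

end DoubleSU2

end

noncomputable section

namespace DoubleSU2

/-! ### The generating function of the Clebsch-Gordan coefficients -/

lemma sum_shift_choose {q i N : ℕ} (hN : i + q ≤ N) (f : ℕ → ℂ) :
    ∑ k : Fin (N + 1), (if i ≤ (k : ℕ) then (q.choose ((k : ℕ) - i) : ℂ) * f k else 0) =
      ∑ a ∈ Finset.range (q + 1), (q.choose a : ℂ) * f (i + a) := by
  rw [Fin.sum_univ_eq_sum_range
    (fun k => if i ≤ k then (q.choose (k - i) : ℂ) * f k else 0) (N + 1)]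
  have h1 := Finset.sum_Ico_eq_sum_range (fun k => (q.choose (k - i) : ℂ) * f k) i (i + (q + 1))
  simp only [Nat.add_sub_cancel_left] at h1
  rw [← h1]
  symm
  refine Finset.sum_subset_zero_on_sdiff (fun k hk => ?_) (fun k hk => ?_) fun k hk => ?_
  · rw [Finset.mem_Ico] at hk
    rw [Finset.mem_range]
    omega
  · rw [Finset.mem_sdiff, Finset.mem_range, Finset.mem_Ico] at hk
    split_ifs with hik
    · rw [Nat.choose_eq_zero_of_lt (by omega), Nat.cast_zero, zero_mul]
    · rfl
  · rw [if_pos (Finset.mem_Ico.mp hk).1]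

/-- The sum in the Racah formula. -/
def racahSum (p q r k₁ k₂ : ℕ) : ℝ :=
  ∑ i ∈ Finset.range (p + 1), if i ≤ k₁ ∧ p ≤ k₂ + i then
    (-1 : ℝ) ^ i * (p.choose i : ℝ) * (q.choose (k₁ - i) : ℝ) * (r.choose (k₂ + i - p) : ℝ)
    else 0

/-- For fixed i substitute k₁ = i + a and k₂ = p − i + b; the constraint k₁ + k₂ = p + k₃ then
forces k₃ = a + b, and three independent binomial sums remain. -/
lemma sum_racahSum (p q r : ℕ) (A B Z : ℕ → ℂ) :
    ∑ k₁ : Fin (p + q + 1), ∑ k₂ : Fin (p + r + 1), ∑ k₃ : Fin (q + r + 1),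
      (if (k₁ : ℕ) + k₂ = p + k₃ then (racahSum p q r k₁ k₂ : ℂ) * (A k₁ * B k₂ * Z k₃) else 0) =
    ∑ i ∈ Finset.range (p + 1), ∑ a ∈ Finset.range (q + 1), ∑ b ∈ Finset.range (r + 1),
      ((-1) ^ i * (p.choose i : ℂ)) * (q.choose a : ℂ) * (r.choose b : ℂ) *
        (A (i + a) * B (p - i + b) * Z (a + b)) := by
  let G : ℕ → Fin (p + q + 1) → Fin (p + r + 1) → Fin (q + r + 1) → ℂ := fun i k₁ k₂ k₃ =>
    if i ≤ (k₁ : ℕ) then (q.choose ((k₁ : ℕ) - i) : ℂ) * (if p - i ≤ (k₂ : ℕ) then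
      (r.choose ((k₂ : ℕ) - (p - i)) : ℂ) * (if (k₁ : ℕ) + k₂ = p + k₃ then
        ((-1) ^ i * (p.choose i : ℂ)) * (A k₁ * B k₂ * Z k₃) else 0) else 0) else 0
  have hG : ∀ (k₁ : Fin (p + q + 1)) (k₂ : Fin (p + r + 1)) (k₃ : Fin (q + r + 1)),
      (if (k₁ : ℕ) + k₂ = p + k₃ then (racahSum p q r k₁ k₂ : ℂ) * (A k₁ * B k₂ * Z k₃) else 0) =
        ∑ i ∈ Finset.range (p + 1), G i k₁ k₂ k₃ := by
    intro k₁ k₂ k₃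
    by_cases hk : (k₁ : ℕ) + k₂ = p + k₃
    · rw [if_pos hk, racahSum, Complex.ofReal_sum, Finset.sum_mul]
      refine Finset.sum_congr rfl fun i hi => ?_
      have hi : i ≤ p := Nat.lt_succ_iff.mp (Finset.mem_range.mp hi)
      simp only [G, if_pos hk]
      by_cases h1 : i ≤ (k₁ : ℕ)
      · by_cases h2 : p - i ≤ (k₂ : ℕ)
        · rw [if_pos ⟨h1, by omega⟩, if_pos h1, if_pos h2,
            show (k₂ : ℕ) + i - p = k₂ - (p - i) by omega]
          push_cast
          ring
        · rw [if_neg (fun h => h2 (by omega)), if_pos h1, if_neg h2]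
          simp
      · rw [if_neg (fun h => h1 h.1), if_neg h1]
        simp
    · rw [if_neg hk]
      symm
      refine Finset.sum_eq_zero fun i _ => ?_
      simp [G, hk]
  have hcomm : ∑ k₁ : Fin (p + q + 1), ∑ k₂ : Fin (p + r + 1), ∑ k₃ : Fin (q + r + 1),
      ∑ i ∈ Finset.range (p + 1), G i k₁ k₂ k₃ =
      ∑ i ∈ Finset.range (p + 1), ∑ k₁ : Fin (p + q + 1), ∑ k₂ : Fin (p + r + 1),
        ∑ k₃ : Fin (q + r + 1), G i k₁ k₂ k₃ :=
    (Finset.sum_congr rfl fun k₁ _ =>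
      (Finset.sum_congr rfl fun k₂ _ => Finset.sum_comm).trans Finset.sum_comm).trans
      Finset.sum_comm
  simp only [hG]
  rw [hcomm]
  refine Finset.sum_congr rfl fun i hi => ?_
  have hi : i ≤ p := Nat.lt_succ_iff.mp (Finset.mem_range.mp hi)
  have h3 : ∀ k₁ k₂ : ℕ, ∑ k₃ : Fin (q + r + 1), (if k₁ + k₂ = p + k₃ then
        ((-1) ^ i * (p.choose i : ℂ)) * (A k₁ * B k₂ * Z k₃) else 0) =
      ((-1) ^ i * (p.choose i : ℂ)) * A k₁ * (B k₂ * ∑ k₃ : Fin (q + r + 1),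
        if k₁ + k₂ = p + k₃ then Z k₃ else 0) := by
    intro k₁ k₂
    simp only [Finset.mul_sum]
    refine Finset.sum_congr rfl fun k₃ _ => ?_
    split_ifs
    · ring
    · simp
  have h2 : ∀ k₁ : ℕ, ∑ k₂ : Fin (p + r + 1), ∑ k₃ : Fin (q + r + 1), (if p - i ≤ (k₂ : ℕ) then
      (r.choose ((k₂ : ℕ) - (p - i)) : ℂ) * (if k₁ + k₂ = p + k₃ then
        ((-1) ^ i * (p.choose i : ℂ)) * (A k₁ * B k₂ * Z k₃) else 0) else 0) =
      ∑ b ∈ Finset.range (r + 1), (r.choose b : ℂ) * (((-1) ^ i * (p.choose i : ℂ)) * A k₁ *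
        (B (p - i + b) * ∑ k₃ : Fin (q + r + 1),
          if k₁ + (p - i + b) = p + k₃ then Z k₃ else 0)) := by
    intro k₁
    rw [← sum_shift_choose (q := r) (i := p - i) (N := p + r) (by omega) fun k₂ =>
      ((-1) ^ i * (p.choose i : ℂ)) * A k₁ * (B k₂ * ∑ k₃ : Fin (q + r + 1),
        if k₁ + k₂ = p + k₃ then Z k₃ else 0)]
    refine Finset.sum_congr rfl fun k₂ _ => ?_
    split_ifs
    · rw [← Finset.mul_sum, h3]
    · simp
  have h1 : ∑ k₁ : Fin (p + q + 1), ∑ k₂ : Fin (p + r + 1), ∑ k₃ : Fin (q + r + 1),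
      G i k₁ k₂ k₃ = ∑ a ∈ Finset.range (q + 1), (q.choose a : ℂ) *
        ∑ b ∈ Finset.range (r + 1), (r.choose b : ℂ) * (((-1) ^ i * (p.choose i : ℂ)) * A (i + a) *
        (B (p - i + b) * ∑ k₃ : Fin (q + r + 1),
          if (i + a) + (p - i + b) = p + k₃ then Z k₃ else 0)) := by
    rw [← sum_shift_choose (q := q) (i := i) (N := p + q) (by omega) fun k₁ =>
      ∑ b ∈ Finset.range (r + 1), (r.choose b : ℂ) * (((-1) ^ i * (p.choose i : ℂ)) * A k₁ *
        (B (p - i + b) * ∑ k₃ : Fin (q + r + 1),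
          if k₁ + (p - i + b) = p + k₃ then Z k₃ else 0))]
    refine Finset.sum_congr rfl fun k₁ _ => ?_
    simp only [G]
    split_ifs
    · simp only [← Finset.mul_sum, ← h2]
    · simp
  rw [h1]
  refine Finset.sum_congr rfl fun a ha => ?_
  have ha : a ≤ q := Nat.lt_succ_iff.mp (Finset.mem_range.mp ha)
  rw [Finset.mul_sum]
  refine Finset.sum_congr rfl fun b hb => ?_
  have hb : b ≤ r := Nat.lt_succ_iff.mp (Finset.mem_range.mp hb)
  have hz : ∑ k₃ : Fin (q + r + 1), (if (i + a) + (p - i + b) = p + k₃ then Z k₃ else 0) =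
      Z (a + b) := by
    rw [Finset.sum_eq_single ⟨a + b, by omega⟩]
    · exact if_pos (by simp only; omega)
    · intro k _ hk
      exact if_neg fun h => hk (Fin.ext (by simp only; omega))
    · simp
  rw [hz]
  ring

/-- The normalisation in the Racah formula. -/
def cgNorm (p q r : ℕ) : ℝ :=
  Real.sqrt ((((p + q).factorial * (p + r).factorial * (q + r).factorial : ℕ) : ℝ) /
    ((p.factorial * q.factorial * r.factorial * (p + q + r + 1).factorial : ℕ) : ℝ))

lemma cg_add (p q r k₁ k₂ k₃ : ℕ) : cg (p + q) (p + r) (q + r) k₁ k₂ k₃ =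
    if k₁ + k₂ = p + k₃ then cgNorm p q r * racahSum p q r k₁ k₂ /
      Real.sqrt (((p + q).choose k₁ * (p + r).choose k₂ * (q + r).choose k₃ : ℕ) : ℝ) else 0 := by
  have hp : (p + q + (p + r) - (q + r)) / 2 = p := by omega
  have hq : (p + q + (q + r) - (p + r)) / 2 = q := by omega
  have hr : (p + r + (q + r) - (p + q)) / 2 = r := by omega
  have he : Even (p + q + (p + r) + (q + r)) := ⟨p + q + r, by ring⟩
  simp only [cg, hp, hq, hr]
  by_cases hk : k₁ + k₂ = p + k₃
  · rw [if_pos hk, if_pos ⟨he, by omega, by omega, by omega, hk⟩]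
    rfl
  · rw [if_neg hk, if_neg fun h => hk h.2.2.2.2]

/-- The Racah sum is the joint expansion of three binomial powers. The exponents p, q, r count the
contractions of the pairs (1,2), (1,3), (2,3), the third spin entering through its dual; the square
roots in `cg` and `mono` cancel. -/
lemma sum_cg_mono (p q r : ℕ) (X₁ Y₁ X₂ Y₂ X₃ Y₃ : ℂ) :
    ∑ k₁ : Fin (p + q + 1), ∑ k₂ : Fin (p + r + 1), ∑ k₃ : Fin (q + r + 1),
      (cg (p + q) (p + r) (q + r) k₁ k₂ k₃ : ℂ) *
        (mono (p + q) X₁ Y₁ k₁ * mono (p + r) X₂ Y₂ k₂ * mono (q + r) X₃ Y₃ k₃) =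
    cgNorm p q r * ((X₁ * Y₂ - Y₁ * X₂) ^ p * (X₃ * X₁ + Y₃ * Y₁) ^ q *
      (X₃ * X₂ + Y₃ * Y₂) ^ r) := by
  have hterm : ∀ (k₁ : Fin (p + q + 1)) (k₂ : Fin (p + r + 1)) (k₃ : Fin (q + r + 1)),
      (cg (p + q) (p + r) (q + r) k₁ k₂ k₃ : ℂ) *
        (mono (p + q) X₁ Y₁ k₁ * mono (p + r) X₂ Y₂ k₂ * mono (q + r) X₃ Y₃ k₃) =
      cgNorm p q r * if (k₁ : ℕ) + k₂ = p + k₃ then (racahSum p q r k₁ k₂ : ℂ) *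
        ((X₁ ^ (p + q - k₁) * Y₁ ^ (k₁ : ℕ)) * (X₂ ^ (p + r - k₂) * Y₂ ^ (k₂ : ℕ)) *
          (X₃ ^ (q + r - k₃) * Y₃ ^ (k₃ : ℕ))) else 0 := by
    intro k₁ k₂ k₃
    rw [cg_add]
    split_ifs
    · have h1 := sqrt_choose_ne_zero k₁
      have h2 := sqrt_choose_ne_zero k₂
      have h3 := sqrt_choose_ne_zero k₃
      simp only [mono]
      push_cast
      rw [Real.sqrt_mul (by positivity), Real.sqrt_mul (by positivity)]
      push_cast
      field_simp
    · simp
  simp only [hterm, ← Finset.mul_sum]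
  rw [sum_racahSum p q r (fun k => X₁ ^ (p + q - k) * Y₁ ^ k) (fun k => X₂ ^ (p + r - k) * Y₂ ^ k)
    fun k => X₃ ^ (q + r - k) * Y₃ ^ k, sub_eq_add_neg, add_comm (X₁ * Y₂), add_comm (X₃ * X₁),
    add_comm (X₃ * X₂), add_pow, add_pow, add_pow, Finset.sum_mul_sum, Finset.sum_mul]
  congr 1
  refine Finset.sum_congr rfl fun i hi => ?_
  rw [Finset.sum_mul]
  refine Finset.sum_congr rfl fun a ha => ?_
  rw [Finset.mul_sum]
  refine Finset.sum_congr rfl fun b hb => ?_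
  have hi : i ≤ p := Nat.lt_succ_iff.mp (Finset.mem_range.mp hi)
  have ha : a ≤ q := Nat.lt_succ_iff.mp (Finset.mem_range.mp ha)
  have hb : b ≤ r := Nat.lt_succ_iff.mp (Finset.mem_range.mp hb)
  rw [show p + q - (i + a) = (p - i) + (q - a) by omega,
    show p + r - (p - i + b) = i + (r - b) by omega,
    show q + r - (a + b) = (q - a) + (r - b) by omega, neg_pow]
  simp only [pow_add, mul_pow]
  ring

/-- The Clebsch-Gordan map as a matrix. -/
def cgMatrix (n₁ n₂ n₃ : ℕ) : Matrix (Fin (n₃ + 1)) (Fin (n₁ + 1) × Fin (n₂ + 1)) ℂ :=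
  fun k₃ k => (cg n₁ n₂ n₃ k.1 k.2 k₃ : ℂ)

-- On generating functions: the determinant factor is unchanged because det g = 1, and in the two
-- other factors g may be moved from the vectors (X₁,Y₁), (X₂,Y₂) to the covector (X₃,Y₃).
open scoped Kronecker in
lemma cgMatrix_mul_wigner_add (p q r : ℕ) (g : SU2) :
    cgMatrix (p + q) (p + r) (q + r) * (wigner (p + q) g ⊗ₖ wigner (p + r) g) =
      wigner (q + r) g * cgMatrix (p + q) (p + r) (q + r) := by
  let pair : Matrix (Fin (q + r + 1)) (Fin (p + q + 1) × Fin (p + r + 1)) ℂ →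
      ℂ → ℂ → ℂ → ℂ → ℂ → ℂ → ℂ := fun B X₁ Y₁ X₂ Y₂ X₃ Y₃ =>
    mono (q + r) X₃ Y₃ ⬝ᵥ B.mulVec fun k => mono (p + q) X₁ Y₁ k.1 * mono (p + r) X₂ Y₂ k.2
  -- Products of the vectors `mono` span the tensor product, so the generating function determines
  -- the matrix.
  have hext : ∀ B B', (∀ X₁ Y₁ X₂ Y₂ X₃ Y₃, pair B X₁ Y₁ X₂ Y₂ X₃ Y₃ = pair B' X₁ Y₁ X₂ Y₂ X₃ Y₃) →
      B = B' := by
    intro B B' hB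
    have h1 : ∀ X₁ Y₁ X₂ Y₂,
        (B.mulVec fun k => mono (p + q) X₁ Y₁ k.1 * mono (p + r) X₂ Y₂ k.2) =
        B'.mulVec fun k => mono (p + q) X₁ Y₁ k.1 * mono (p + r) X₂ Y₂ k.2 :=
      fun X₁ Y₁ X₂ Y₂ => eq_of_mono fun X₃ Y₃ => by
        rw [dotProduct_comm, dotProduct_comm _ (mono (q + r) X₃ Y₃)]
        exact hB X₁ Y₁ X₂ Y₂ X₃ Y₃
    have hsum : ∀ (B : Matrix (Fin (q + r + 1)) (Fin (p + q + 1) × Fin (p + r + 1)) ℂ)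
        X₁ Y₁ X₂ Y₂ k₃, (B.mulVec fun k => mono (p + q) X₁ Y₁ k.1 * mono (p + r) X₂ Y₂ k.2) k₃ =
        (fun k₁ => (fun k₂ => B k₃ (k₁, k₂)) ⬝ᵥ mono (p + r) X₂ Y₂) ⬝ᵥ mono (p + q) X₁ Y₁ := by
      intro B X₁ Y₁ X₂ Y₂ k₃
      simp only [Matrix.mulVec, dotProduct, Fintype.sum_prod_type, Finset.sum_mul]
      refine Finset.sum_congr rfl fun k₁ _ => Finset.sum_congr rfl fun k₂ _ => ?_
      ring
    funext k₃ k
    have h2 := fun X₂ Y₂ => eq_of_mono fun X₁ Y₁ =>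
      (hsum B X₁ Y₁ X₂ Y₂ k₃).symm.trans ((congrFun (h1 X₁ Y₁ X₂ Y₂) k₃).trans (hsum B' _ _ _ _ _))
    exact congrFun (eq_of_mono fun X₂ Y₂ => congrFun (h2 X₂ Y₂) k.1) k.2
  have hpair : ∀ X₁ Y₁ X₂ Y₂ X₃ Y₃,
      pair (cgMatrix (p + q) (p + r) (q + r)) X₁ Y₁ X₂ Y₂ X₃ Y₃ = cgNorm p q r *
        ((X₁ * Y₂ - Y₁ * X₂) ^ p * (X₃ * X₁ + Y₃ * Y₁) ^ q * (X₃ * X₂ + Y₃ * Y₂) ^ r) := by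
    intro X₁ Y₁ X₂ Y₂ X₃ Y₃
    rw [← sum_cg_mono]
    simp only [pair, Matrix.mulVec, dotProduct, Fintype.sum_prod_type, Finset.mul_sum]
    rw [Finset.sum_comm]
    refine Finset.sum_congr rfl fun k₁ _ => ?_
    rw [Finset.sum_comm]
    refine Finset.sum_congr rfl fun k₂ _ => Finset.sum_congr rfl fun k₃ _ => ?_
    rw [cgMatrix]
    ring
  refine hext _ _ fun X₁ Y₁ X₂ Y₂ X₃ Y₃ => ?_
  have hk : (wigner (p + q) g ⊗ₖ wigner (p + r) g).mulVec
      (fun k => mono (p + q) X₁ Y₁ k.1 * mono (p + r) X₂ Y₂ k.2) =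
      fun k => mono (p + q) (g.1 0 0 * X₁ + g.1 0 1 * Y₁) (g.1 1 0 * X₁ + g.1 1 1 * Y₁) k.1 *
        mono (p + r) (g.1 0 0 * X₂ + g.1 0 1 * Y₂) (g.1 1 0 * X₂ + g.1 1 1 * Y₂) k.2 := by
    funext k
    rw [← wigner_mulVec_mono, ← wigner_mulVec_mono]
    simp only [Matrix.mulVec, dotProduct, Fintype.sum_prod_type, Finset.sum_mul_sum,
      Matrix.kroneckerMap_apply]
    refine Finset.sum_congr rfl fun k₁ _ => Finset.sum_congr rfl fun k₂ _ => ?_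
    ring
  have hL : pair (cgMatrix (p + q) (p + r) (q + r) * (wigner (p + q) g ⊗ₖ wigner (p + r) g))
      X₁ Y₁ X₂ Y₂ X₃ Y₃ = pair (cgMatrix (p + q) (p + r) (q + r))
        (g.1 0 0 * X₁ + g.1 0 1 * Y₁) (g.1 1 0 * X₁ + g.1 1 1 * Y₁)
        (g.1 0 0 * X₂ + g.1 0 1 * Y₂) (g.1 1 0 * X₂ + g.1 1 1 * Y₂) X₃ Y₃ := by
    simp only [pair]
    rw [← Matrix.mulVec_mulVec, hk]
  have hR : pair (wigner (q + r) g * cgMatrix (p + q) (p + r) (q + r)) X₁ Y₁ X₂ Y₂ X₃ Y₃ =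
      pair (cgMatrix (p + q) (p + r) (q + r)) X₁ Y₁ X₂ Y₂
        (X₃ * g.1 0 0 + Y₃ * g.1 1 0) (X₃ * g.1 0 1 + Y₃ * g.1 1 1) := by
    simp only [pair]
    rw [← Matrix.mulVec_mulVec, Matrix.dotProduct_mulVec, mono_vecMul_wigner]
  have hdet : g.1 0 0 * g.1 1 1 - g.1 0 1 * g.1 1 0 = 1 := by
    rw [← Matrix.det_fin_two]
    exact (Matrix.mem_specialUnitaryGroup_iff.mp g.2).2
  rw [hL, hR, hpair, hpair]
  have e1 : (g.1 0 0 * X₁ + g.1 0 1 * Y₁) * (g.1 1 0 * X₂ + g.1 1 1 * Y₂) -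
      (g.1 1 0 * X₁ + g.1 1 1 * Y₁) * (g.1 0 0 * X₂ + g.1 0 1 * Y₂) = X₁ * Y₂ - Y₁ * X₂ := by
    linear_combination (X₁ * Y₂ - Y₁ * X₂) * hdet
  rw [e1]
  congr 2
  · congr 2
    ring
  · ring

end DoubleSU2

end

noncomputable section

namespace DoubleSU2

/-! ### Orthogonality and completeness of the Clebsch-Gordan coefficients -/

lemma cg_cases (n₁ n₂ n₃ : ℕ) : (∃ p q r, n₁ = p + q ∧ n₂ = p + r ∧ n₃ = q + r) ∨
    ∀ k₁ k₂ k₃, cg n₁ n₂ n₃ k₁ k₂ k₃ = 0 := by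
  by_cases hn : Even (n₁ + n₂ + n₃) ∧ n₃ ≤ n₁ + n₂ ∧ n₁ ≤ n₂ + n₃ ∧ n₂ ≤ n₁ + n₃
  · obtain ⟨⟨m, hm⟩, h1, h2, h3⟩ := hn
    exact Or.inl ⟨m - n₃, m - n₂, m - n₁, by omega, by omega, by omega⟩
  · refine Or.inr fun k₁ k₂ k₃ => ?_
    simp only [cg]
    exact if_neg fun h => hn ⟨h.1, h.2.1, h.2.2.1, h.2.2.2.1⟩

open scoped Kronecker in
lemma cgMatrix_mul_wigner (n₁ n₂ n₃ : ℕ) (g : SU2) :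
    cgMatrix n₁ n₂ n₃ * (wigner n₁ g ⊗ₖ wigner n₂ g) = wigner n₃ g * cgMatrix n₁ n₂ n₃ := by
  rcases cg_cases n₁ n₂ n₃ with ⟨p, q, r, rfl, rfl, rfl⟩ | h0
  · exact cgMatrix_mul_wigner_add p q r g
  · have : cgMatrix n₁ n₂ n₃ = 0 := by
      funext k₃ k
      simp [cgMatrix, h0]
    rw [this, Matrix.zero_mul, Matrix.mul_zero]

lemma conjTranspose_wigner (n : ℕ) (g : SU2) : (wigner n g).conjTranspose = wigner n g⁻¹ :=
  (wigner_inv n g).symm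

/-- Adjoints of intertwiners of unitary representations intertwine. So C C'* maps between
irreducible representations, and Schur's lemma applies to it. -/
lemma cgMatrix_mul_conjTranspose_intertwines (n₁ n₂ n₃ n₃' : ℕ) (g : SU2) :
    cgMatrix n₁ n₂ n₃ * (cgMatrix n₁ n₂ n₃').conjTranspose * wigner n₃' g =
      wigner n₃ g * (cgMatrix n₁ n₂ n₃ * (cgMatrix n₁ n₂ n₃').conjTranspose) := by
  have h1 := congrArg Matrix.conjTranspose (cgMatrix_mul_wigner n₁ n₂ n₃' g⁻¹)
  rw [Matrix.conjTranspose_mul, Matrix.conjTranspose_mul, Matrix.conjTranspose_kronecker,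
    conjTranspose_wigner, conjTranspose_wigner, conjTranspose_wigner, inv_inv] at h1
  rw [Matrix.mul_assoc, ← h1, ← Matrix.mul_assoc, cgMatrix_mul_wigner, Matrix.mul_assoc]

lemma cgMatrix_mul_conjTranspose_of_ne {n₁ n₂ n₃ n₃' : ℕ} (h : n₃ ≠ n₃') :
    cgMatrix n₁ n₂ n₃ * (cgMatrix n₁ n₂ n₃').conjTranspose = 0 := by
  rcases lt_or_gt_of_ne h with h | h
  · exact intertwiner_eq_zero_of_lt h (cgMatrix_mul_conjTranspose_intertwines n₁ n₂ n₃ n₃')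
  · have := intertwiner_eq_zero_of_lt h (cgMatrix_mul_conjTranspose_intertwines n₁ n₂ n₃' n₃)
    rw [← Matrix.conjTranspose_eq_zero, Matrix.conjTranspose_mul,
      Matrix.conjTranspose_conjTranspose]
    exact this

/-- Compare the coefficients of X^p in (1−X)^{-(q+1)} (1−X)^{-(r+1)} = (1−X)^{-(q+r+2)}. -/
lemma sum_choose_mul_choose (p q r : ℕ) :
    ∑ k ∈ Finset.range (p + 1), (q + (p - k)).choose q * (r + k).choose r =
      (p + q + r + 1).choose p := by
  have h1 := congrArg (fun u : (PowerSeries ℤ)ˣ => PowerSeries.coeff p u.val)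
    (PowerSeries.invOneSubPow_add ℤ (d := q + 1) (r + 1))
  have h2 : q + 1 + (r + 1) = q + r + 1 + 1 := by ring
  simp only [h2, Units.val_mul, PowerSeries.invOneSubPow_val_succ_eq_mk_add_choose,
    PowerSeries.coeff_mk, PowerSeries.coeff_mul] at h1
  rw [Finset.Nat.sum_antidiagonal_eq_sum_range_succ
    (fun i j => ((q + i).choose q : ℤ) * ((r + j).choose r : ℤ))] at h1
  have h3 : (p + q + r + 1).choose p = (q + r + 1 + p).choose (q + r + 1) := by
    rw [show p + q + r + 1 = q + r + 1 + p by ring]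
    exact (Nat.choose_symm_of_eq_add rfl).symm
  rw [h3]
  zify
  rw [h1, ← Finset.sum_range_reflect]
  refine Finset.sum_congr rfl fun k hk => ?_
  have hk : k ≤ p := Nat.lt_succ_iff.mp (Finset.mem_range.mp hk)
  rw [show p + 1 - 1 - k = p - k by omega, show p - (p - k) = k by omega]

lemma racahSum_of_add_eq {p q r k₁ k₂ : ℕ} (h : k₁ + k₂ = p) :
    racahSum p q r k₁ k₂ = (-1) ^ k₁ * (p.choose k₁ : ℝ) := by
  rw [racahSum, Finset.sum_eq_single k₁]
  · rw [if_pos ⟨le_rfl, by omega⟩, Nat.sub_self, show k₂ + k₁ - p = 0 by omega]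
    simp
  · intro i _ hi
    exact if_neg fun hh => hi (by omega)
  · intro hk
    exact absurd (Finset.mem_range.mpr (by omega)) hk

/-- C C* is a scalar, so one diagonal entry fixes the normalisation. At highest weight, k₃ = 0, the
Racah sum has a single term and the squares reduce to products of binomials, summed by
`sum_choose_mul_choose`. -/
lemma sum_cg_sq (p q r : ℕ) :
    ∑ k₁ : Fin (p + q + 1), ∑ k₂ : Fin (p + r + 1), cg (p + q) (p + r) (q + r) k₁ k₂ 0 ^ 2 =
      1 / ((q + r : ℕ) + 1 : ℝ) := by
  have hinner : ∀ k₁ : Fin (p + q + 1),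
      ∑ k₂ : Fin (p + r + 1), cg (p + q) (p + r) (q + r) k₁ k₂ 0 ^ 2 =
      if (k₁ : ℕ) ∈ Finset.range (p + 1) then
        cg (p + q) (p + r) (q + r) k₁ (p - k₁ : ℕ) 0 ^ 2 else 0 := by
    intro k₁
    split_ifs with hk
    · rw [Finset.mem_range] at hk
      rw [Finset.sum_eq_single ⟨p - k₁, by omega⟩]
      · intro k₂ _ hne
        rw [cg_add, if_neg fun hh => hne (Fin.ext (by simp only; omega))]
        simp
      · simp
    · rw [Finset.mem_range] at hk
      refine Finset.sum_eq_zero fun k₂ _ => ?_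
      rw [cg_add, if_neg (by omega)]
      simp
  simp only [hinner]
  rw [Fin.sum_univ_eq_sum_range (fun k => if k ∈ Finset.range (p + 1) then
    cg (p + q) (p + r) (q + r) k (p - k) 0 ^ 2 else 0) (p + q + 1), Finset.sum_ite_mem,
    Finset.inter_eq_right.mpr (Finset.range_subset_range.mpr (by omega))]
  have hterm : ∀ k ∈ Finset.range (p + 1), cg (p + q) (p + r) (q + r) k (p - k) 0 ^ 2 =
      (((q + (p - k)).choose q * (r + k).choose r : ℕ) : ℝ) *
        ((p.factorial * (q + r).factorial : ℕ) / ((p + q + r + 1).factorial : ℝ)) := by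
    intro k hk
    have hk : k ≤ p := Nat.lt_succ_iff.mp (Finset.mem_range.mp hk)
    rw [cg_add, if_pos (by omega), racahSum_of_add_eq (by omega), div_pow, mul_pow, mul_pow,
      cgNorm, Real.sq_sqrt (by positivity), Real.sq_sqrt (by positivity), ← pow_mul, mul_comm k 2,
      pow_mul, neg_one_sq, one_pow, one_mul]
    have c1 := Nat.choose_mul_factorial_mul_factorial hk
    have c2 := Nat.choose_mul_factorial_mul_factorial (show k ≤ p + q by omega)
    have c3 := Nat.choose_mul_factorial_mul_factorial (show p - k ≤ p + r by omega)
    have c4 := Nat.choose_mul_factorial_mul_factorial (show q ≤ q + (p - k) by omega)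
    have c5 := Nat.choose_mul_factorial_mul_factorial (show r ≤ r + k by omega)
    rw [show p + q - k = q + (p - k) by omega] at c2
    rw [show p + r - (p - k) = r + k by omega] at c3
    rw [show q + (p - k) - q = p - k by omega] at c4
    rw [show r + k - r = k by omega] at c5
    have f : ∀ n : ℕ, (n.factorial : ℝ) ≠ 0 := fun n => by exact_mod_cast n.factorial_ne_zero
    have g : ∀ m n : ℕ, n ≤ m → (m.choose n : ℝ) ≠ 0 := fun m n hmn => by
      exact_mod_cast (Nat.choose_pos hmn).ne'
    have d1 : (p.choose k : ℝ) = p.factorial / (k.factorial * (p - k).factorial) := by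
      rw [eq_div_iff (mul_ne_zero (f _) (f _))]
      exact_mod_cast (mul_assoc _ _ _).symm.trans c1
    have d2 : ((p + q).choose k : ℝ) =
        (p + q).factorial / (k.factorial * (q + (p - k)).factorial) := by
      rw [eq_div_iff (mul_ne_zero (f _) (f _))]
      exact_mod_cast (mul_assoc _ _ _).symm.trans c2
    have d3 : ((p + r).choose (p - k) : ℝ) =
        (p + r).factorial / ((p - k).factorial * (r + k).factorial) := by
      rw [eq_div_iff (mul_ne_zero (f _) (f _))]
      exact_mod_cast (mul_assoc _ _ _).symm.trans c3
    have d4 : ((q + (p - k)).choose q : ℝ) =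
        (q + (p - k)).factorial / (q.factorial * (p - k).factorial) := by
      rw [eq_div_iff (mul_ne_zero (f _) (f _))]
      exact_mod_cast (mul_assoc _ _ _).symm.trans c4
    have d5 : ((r + k).choose r : ℝ) = (r + k).factorial / (r.factorial * k.factorial) := by
      rw [eq_div_iff (mul_ne_zero (f _) (f _))]
      exact_mod_cast (mul_assoc _ _ _).symm.trans c5
    push_cast
    rw [d1, d2, d3, d4, d5, Nat.choose_zero_right]
    have := f p
    have := f q
    have := f r
    have := f k
    have := f (p - k)
    have := f (q + (p - k))
    have := f (r + k)
    have := f (p + q)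
    have := f (p + r)
    have := f (p + q + r + 1)
    field_simp
    simp
  rw [Finset.sum_congr rfl hterm, ← Finset.sum_mul, ← Nat.cast_sum, sum_choose_mul_choose]
  have c := Nat.choose_mul_factorial_mul_factorial (show p ≤ p + q + r + 1 by omega)
  rw [show p + q + r + 1 - p = q + r + 1 by omega, Nat.factorial_succ (q + r)] at c
  have h1 : ((p + q + r + 1).factorial : ℝ) ≠ 0 := by
    exact_mod_cast (p + q + r + 1).factorial_ne_zero
  have h2 : ((q + r : ℕ) : ℝ) + 1 ≠ 0 := by positivity
  rw [← mul_div_assoc, div_eq_div_iff h1 h2, one_mul, ← c]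
  push_cast
  ring

lemma cgMatrix_mul_conjTranspose_self {n₁ n₂ p q r : ℕ} (h₁ : n₁ = p + q) (h₂ : n₂ = p + r) :
    cgMatrix n₁ n₂ (q + r) * (cgMatrix n₁ n₂ (q + r)).conjTranspose =
      (1 / ((q + r : ℕ) + 1 : ℂ)) • (1 : Matrix (Fin (q + r + 1)) (Fin (q + r + 1)) ℂ) := by
  subst h₁ h₂
  rw [intertwiner_eq_smul_one (cgMatrix_mul_conjTranspose_intertwines _ _ _ _)]
  congr 1
  have h1 := congrArg (fun x : ℝ => (x : ℂ)) (sum_cg_sq p q r)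
  push_cast at h1
  rw [Nat.cast_add, ← h1, Matrix.mul_apply, Fintype.sum_prod_type]
  refine Finset.sum_congr rfl fun k₁ _ => Finset.sum_congr rfl fun k₂ _ => ?_
  rw [Matrix.conjTranspose_apply, cgMatrix, Complex.star_def, Complex.conj_ofReal, sq]
  rfl

/-- With S = n₁ + n₂ and t = min n₁ n₂ + 1 this is the dimension count for V^{j₁} ⊗ V^{j₂}. -/
lemma sum_range_dim {S t : ℕ} (h : 2 * t ≤ S + 2) :
    ∑ p ∈ Finset.range t, (S - 2 * p + 1) = t * (S + 2 - t) := by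
  induction t with
  | zero => simp
  | succ t ih =>
    rw [Finset.sum_range_succ, ih (by omega)]
    obtain ⟨e, rfl⟩ : ∃ e, S = 2 * t + e := ⟨S - 2 * t, by omega⟩
    rw [show 2 * t + e + 2 - t = t + e + 2 by omega, show 2 * t + e - 2 * t + 1 = e + 1 by omega,
      show 2 * t + e + 2 - (t + 1) = t + e + 1 by omega]
    ring

/-- The decomposition of `V^{j₁} ⊗ V^{j₂}` into irreducible representations. -/
lemma sum_conjTranspose_mul_cgMatrix (n₁ n₂ : ℕ) :
    ∑ p : Fin (min n₁ n₂ + 1), ((n₁ + n₂ - 2 * p : ℕ) + 1 : ℂ) •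
      ((cgMatrix n₁ n₂ (n₁ + n₂ - 2 * p)).conjTranspose * cgMatrix n₁ n₂ (n₁ + n₂ - 2 * p)) = 1 := by
  -- All the maps stacked; the rows of C have squared norm 1/d_{j₃}, and the factor √d_{j₃} makes
  -- them orthonormal.
  let A : Matrix (Σ p : Fin (min n₁ n₂ + 1), Fin (n₁ + n₂ - 2 * p + 1))
      (Fin (n₁ + 1) × Fin (n₂ + 1)) ℂ := fun i k =>
    (Real.sqrt ((n₁ + n₂ - 2 * i.1 : ℕ) + 1) : ℂ) * cgMatrix n₁ n₂ (n₁ + n₂ - 2 * i.1) i.2 k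
  have hsq : ∀ n : ℕ, (Real.sqrt (n + 1) : ℂ) * Real.sqrt (n + 1) = n + 1 := fun n => by
    rw [← Complex.ofReal_mul, Real.mul_self_sqrt (by positivity)]
    push_cast
    rfl
  have hct : ∀ i k, A.conjTranspose k i = (Real.sqrt ((n₁ + n₂ - 2 * i.1 : ℕ) + 1) : ℂ) *
      star (cgMatrix n₁ n₂ (n₁ + n₂ - 2 * i.1) i.2 k) := fun i k => by
    rw [Matrix.conjTranspose_apply, star_mul', Complex.star_def, Complex.conj_ofReal]
  have hentry : ∀ i j, (A * A.conjTranspose) i j =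
      (Real.sqrt ((n₁ + n₂ - 2 * i.1 : ℕ) + 1) : ℂ) * Real.sqrt ((n₁ + n₂ - 2 * j.1 : ℕ) + 1) *
        (cgMatrix n₁ n₂ (n₁ + n₂ - 2 * i.1) *
          (cgMatrix n₁ n₂ (n₁ + n₂ - 2 * j.1)).conjTranspose) i.2 j.2 := by
    intro i j
    rw [Matrix.mul_apply, Matrix.mul_apply, Finset.mul_sum]
    refine Finset.sum_congr rfl fun k _ => ?_
    rw [hct, Matrix.conjTranspose_apply]
    simp only [A]
    ring
  have hA : A * A.conjTranspose = 1 := by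
    ext ⟨p, k⟩ ⟨p', k'⟩
    rw [hentry]
    have hp := p.2
    have hp' := p'.2
    by_cases hpp : p = p'
    · subst hpp
      obtain ⟨q, r, h1, h2, h3⟩ : ∃ q r, n₁ = p + q ∧ n₂ = p + r ∧ n₁ + n₂ - 2 * p = q + r :=
        ⟨n₁ - p, n₂ - p, by omega, by omega, by omega⟩
      have key : cgMatrix n₁ n₂ (n₁ + n₂ - 2 * p) *
          (cgMatrix n₁ n₂ (n₁ + n₂ - 2 * p)).conjTranspose =
          (1 / ((n₁ + n₂ - 2 * p : ℕ) + 1 : ℂ)) • 1 := by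
        rw [h3]
        exact cgMatrix_mul_conjTranspose_self h1 h2
      simp only
      rw [key, hsq, Matrix.smul_apply, smul_eq_mul, ← mul_assoc,
        mul_one_div_cancel (Nat.cast_add_one_ne_zero _), one_mul]
      by_cases hk : k = k'
      · subst hk
        simp
      · rw [Matrix.one_apply_ne hk, Matrix.one_apply_ne]
        intro hh
        exact hk (by simpa using hh)
    · rw [cgMatrix_mul_conjTranspose_of_ne, Matrix.zero_apply, mul_zero, Matrix.one_apply_ne]
      · intro hh
        exact hpp (congrArg Sigma.fst hh)
      · simp only
        intro hh
        exact hpp (Fin.ext (by omega))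
  have hcard : Fintype.card (Σ p : Fin (min n₁ n₂ + 1), Fin (n₁ + n₂ - 2 * p + 1)) =
      Fintype.card (Fin (n₁ + 1) × Fin (n₂ + 1)) := by
    rw [Fintype.card_sigma, Fintype.card_prod]
    simp only [Fintype.card_fin]
    rw [Fin.sum_univ_eq_sum_range (fun p => n₁ + n₂ - 2 * p + 1), sum_range_dim (by omega)]
    rcases le_total n₁ n₂ with h | h
    · rw [min_eq_left h, show n₁ + n₂ + 2 - (n₁ + 1) = n₂ + 1 by omega]
    · rw [min_eq_right h, show n₁ + n₂ + 2 - (n₂ + 1) = n₁ + 1 by omega, mul_comm]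
  -- Orthonormal rows plus the dimension count: A is square, so its columns are orthonormal too.
  -- This is completeness.
  have hA' : A.conjTranspose * A = 1 := (Matrix.mul_eq_one_comm_of_equiv (Fintype.card_eq.mp hcard).some).mp hA
  rw [← hA']
  ext k k'
  rw [Matrix.sum_apply, Matrix.mul_apply, Fintype.sum_sigma]
  refine Finset.sum_congr rfl fun p _ => ?_
  rw [Matrix.smul_apply, Matrix.mul_apply, smul_eq_mul, Finset.mul_sum]
  refine Finset.sum_congr rfl fun k₃ _ => ?_
  rw [hct, Matrix.conjTranspose_apply, ← hsq]
  simp only [A]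
  ring

open scoped Kronecker in
lemma wigner_kronecker (n₁ n₂ : ℕ) (g : SU2) : wigner n₁ g ⊗ₖ wigner n₂ g =
    ∑ p : Fin (min n₁ n₂ + 1), ((n₁ + n₂ - 2 * p : ℕ) + 1 : ℂ) •
      ((cgMatrix n₁ n₂ (n₁ + n₂ - 2 * p)).conjTranspose *
        (wigner (n₁ + n₂ - 2 * p) g * cgMatrix n₁ n₂ (n₁ + n₂ - 2 * p))) := by
  conv_lhs => rw [← Matrix.one_mul (wigner n₁ g ⊗ₖ wigner n₂ g), ←
    sum_conjTranspose_mul_cgMatrix n₁ n₂, Finset.sum_mul]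
  refine Finset.sum_congr rfl fun p _ => ?_
  rw [Matrix.smul_mul, Matrix.mul_assoc, cgMatrix_mul_wigner]

end DoubleSU2

end

noncomputable section

namespace DoubleSU2

open scoped Kronecker

/-! ### Configurations of one and two strands -/

/-- The configuration of one strand. -/
def singleConfig {A : Kind} (p : A.Point) : Config ![A] :=
  consConfig (A := A) p fun b => b.elim0

/-- The configuration of two strands. -/
def pairConfig {A B : Kind} (p : A.Point) (q : B.Point) : Config ![A, B] :=
  consConfig (A := A) p (singleConfig q)

lemma singleConfig_eta {A : Kind} (y : Config ![A]) : singleConfig (A := A) (y 0) = y := by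
  funext b
  refine Fin.cases rfl (fun b => b.elim0) b

lemma pairConfig_eta {A B : Kind} (y : Config ![A, B]) :
    pairConfig (A := A) (B := B) (y 0) (y 1) = y := by
  funext b
  refine Fin.cases rfl (fun b => ?_) b
  exact Fin.cases rfl (fun b => b.elim0) b

lemma update_pairConfig_zero {A B : Kind} (p p' : A.Point) (q : B.Point) :
    Function.update (pairConfig p q) 0 p' = pairConfig p' q := by
  funext b
  refine Fin.cases ?_ (fun b => ?_) b
  · exact Function.update_self _ _ _
  · exact Function.update_of_ne (Fin.succ_ne_zero b) _ _

lemma update_pairConfig_one {A B : Kind} (p : A.Point) (q q' : B.Point) :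
    Function.update (pairConfig p q) 1 q' = pairConfig p q' := by
  funext b
  refine Fin.cases ?_ (fun b => ?_) b
  · exact Function.update_of_ne (Fin.succ_ne_zero 0).symm _ _
  · refine Fin.cases ?_ (fun b => b.elim0) b
    exact Function.update_self _ _ _

lemma update_singleConfig {A : Kind} (p p' : A.Point) :
    Function.update (singleConfig p) 0 p' = singleConfig p' := by
  funext b
  refine Fin.cases ?_ (fun b => b.elim0) b
  exact Function.update_self _ _ _

/-! ### Fusion of two spins -/

/-- The components of a state of two spins. -/
def spinVec {n₁ n₂ : ℕ} (Φ : State ![.spin n₁, .spin n₂]) : Fin (n₁ + 1) × Fin (n₂ + 1) → ℂ :=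
  fun k => Φ (pairConfig (A := .spin n₁) (B := .spin n₂) k.1 k.2)

lemma slotAct_zero_pairConfig {n₁ n₂ : ℕ} (g : SU2) (Φ : State ![.spin n₁, .spin n₂])
    (k₁ : Fin (n₁ + 1)) (k₂ : Fin (n₂ + 1)) :
    slotAct ![.spin n₁, .spin n₂] 0 g Φ (pairConfig (A := .spin n₁) (B := .spin n₂) k₁ k₂) =
      ∑ l, wigner n₁ g k₁ l * spinVec Φ (l, k₂) :=
  congrArg (fun v => (wigner n₁ g).mulVec v k₁) (funext fun l : Fin (n₁ + 1) => congrArg Φ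
    (update_pairConfig_zero (A := .spin n₁) (B := .spin n₂) k₁ l k₂))

lemma slotAct_one_pairConfig {n₁ n₂ : ℕ} (g : SU2) (Φ : State ![.spin n₁, .spin n₂])
    (k₁ : Fin (n₁ + 1)) (k₂ : Fin (n₂ + 1)) :
    slotAct ![.spin n₁, .spin n₂] 1 g Φ (pairConfig (A := .spin n₁) (B := .spin n₂) k₁ k₂) =
      ∑ l, wigner n₂ g k₂ l * spinVec Φ (k₁, l) :=
  congrArg (fun v => (wigner n₂ g).mulVec v k₂) (funext fun l : Fin (n₂ + 1) => congrArg Φ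
    (update_pairConfig_one (A := .spin n₁) (B := .spin n₂) k₁ k₂ l))

lemma spinVec_slotAct_zero_one {n₁ n₂ : ℕ} (g : SU2) (Φ : State ![.spin n₁, .spin n₂]) :
    spinVec (slotAct ![.spin n₁, .spin n₂] 0 g (slotAct ![.spin n₁, .spin n₂] 1 g Φ)) =
      (wigner n₁ g ⊗ₖ wigner n₂ g).mulVec (spinVec Φ) := by
  funext k
  refine (slotAct_zero_pairConfig g _ k.1 k.2).trans ?_
  simp only [Matrix.mulVec, dotProduct, Fintype.sum_prod_type, Matrix.kroneckerMap_apply]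
  refine Finset.sum_congr rfl fun l₁ _ => ?_
  refine (congrArg (wigner n₁ g k.1 l₁ * ·) (slotAct_one_pairConfig g Φ l₁ k.2)).trans ?_
  rw [Finset.mul_sum]
  exact Finset.sum_congr rfl fun l₂ _ => (mul_assoc _ _ _).symm

lemma spinVec_slotAct_one_zero {n₁ n₂ : ℕ} (g : SU2) (Φ : State ![.spin n₁, .spin n₂]) :
    spinVec (slotAct ![.spin n₁, .spin n₂] 1 g (slotAct ![.spin n₁, .spin n₂] 0 g Φ)) =
      (wigner n₁ g ⊗ₖ wigner n₂ g).mulVec (spinVec Φ) := by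
  funext k
  refine (slotAct_one_pairConfig g _ k.1 k.2).trans ?_
  simp only [Matrix.mulVec, dotProduct, Fintype.sum_prod_type, Matrix.kroneckerMap_apply]
  rw [Finset.sum_comm]
  refine Finset.sum_congr rfl fun l₂ _ => ?_
  refine (congrArg (wigner n₂ g k.2 l₂ * ·) (slotAct_zero_pairConfig g Φ k.1 l₂)).trans ?_
  rw [Finset.mul_sum]
  refine Finset.sum_congr rfl fun l₁ _ => ?_
  ring

lemma spinCG_apply (n₁ n₂ n₃ : ℕ) (Φ : State ![.spin n₁, .spin n₂]) (k : Fin (n₃ + 1)) :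
    spinCG n₁ n₂ n₃ Φ (singleConfig (A := .spin n₃) k) =
      (cgMatrix n₁ n₂ n₃).mulVec (spinVec Φ) k := by
  simp only [Matrix.mulVec, dotProduct, Fintype.sum_prod_type]
  rfl

lemma spinCGDual_apply (n₁ n₂ n₃ : ℕ) (Φ : State ![.spin n₃])
    (y : Config ![.spin n₁, .spin n₂]) : spinCGDual n₁ n₂ n₃ Φ y =
      (cgMatrix n₁ n₂ n₃).conjTranspose.mulVec
        (fun k => Φ (singleConfig (A := .spin n₃) k))
        ((show Fin (n₁ + 1) from y 0), (show Fin (n₂ + 1) from y 1)) := by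
  simp only [Matrix.mulVec, dotProduct, Matrix.conjTranspose_apply, cgMatrix, Complex.star_def,
    Complex.conj_ofReal]
  rfl

lemma doubleAct_spin_two {n₁ n₂ : ℕ} (f : SU2 → ℂ) (g : SU2) (Φ : State ![.spin n₁, .spin n₂]) :
    spinVec (doubleAct ![.spin n₁, .spin n₂] ![0, 0] f g Φ) =
      f 1 • (wigner n₁ g ⊗ₖ wigner n₂ g).mulVec (spinVec Φ) := by
  rw [← spinVec_slotAct_zero_one]
  funext k
  refine congrArg₂ (· * ·) (congrArg f ?_) rfl
  exact (one_mul (1 * 1 : SU2)).trans (mul_one 1)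

lemma doubleAct_spin_one {n : ℕ} (f : SU2 → ℂ) (g : SU2) (Φ : State ![.spin n])
    (k : Fin (n + 1)) :
    doubleAct ![.spin n] ![0] f g Φ (singleConfig (A := .spin n) k) =
      f 1 * (wigner n g).mulVec (fun l => Φ (singleConfig (A := .spin n) l)) k := by
  refine congrArg₂ (· * ·) (congrArg f (mul_one (1 : SU2))) ?_
  exact congrArg (fun v => (wigner n g).mulVec v k) (funext fun l : Fin (n + 1) => congrArg Φ
    (update_singleConfig (A := .spin n) k l))

/-- The Clebsch-Gordan maps of two spins intertwine the actions of the double. -/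
theorem spinCG_doubleAct (n₁ n₂ n₃ : ℕ) (f : SU2 → ℂ) (g : SU2)
    (Φ : State ![.spin n₁, .spin n₂]) :
    spinCG n₁ n₂ n₃ (doubleAct ![.spin n₁, .spin n₂] ![0, 0] f g Φ) =
      doubleAct ![.spin n₃] ![0] f g (spinCG n₁ n₂ n₃ Φ) := by
  have key : ∀ k : Fin (n₃ + 1),
      spinCG n₁ n₂ n₃ (doubleAct ![.spin n₁, .spin n₂] ![0, 0] f g Φ)
        (singleConfig (A := .spin n₃) k) =
      doubleAct ![.spin n₃] ![0] f g (spinCG n₁ n₂ n₃ Φ) (singleConfig (A := .spin n₃) k) := by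
    intro k
    rw [spinCG_apply, doubleAct_spin_two, doubleAct_spin_one]
    simp only [spinCG_apply]
    rw [Matrix.mulVec_smul, Matrix.mulVec_mulVec, cgMatrix_mul_wigner, ← Matrix.mulVec_mulVec]
    rfl
  funext y
  have := key (y 0)
  rwa [singleConfig_eta] at this

/-- One of the two actions on slot 0 is trivial, which one depending on δ. The other combines with
slot 1 into the same group element acting on both spins. -/
lemma slotAct_aroundTwo {n₁ n₂ : ℕ} (δ : Bool) (g : SU2) (Φ : State ![.spin n₁, .spin n₂]) :
    spinVec (slotAct ![.spin n₁, .spin n₂] 0 (if δ then 1 else g⁻¹)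
      (slotAct ![.spin n₁, .spin n₂] 1 (signed δ g)
        (slotAct ![.spin n₁, .spin n₂] 0 (if δ then g else 1) Φ))) =
      (wigner n₁ (signed δ g) ⊗ₖ wigner n₂ (signed δ g)).mulVec (spinVec Φ) := by
  cases δ
  · simp only [signed, Bool.false_eq_true, if_false, slotAct_one]
    exact spinVec_slotAct_zero_one _ Φ
  · simp only [signed, if_true, slotAct_one]
    exact spinVec_slotAct_one_zero _ Φ

lemma wigner_kronecker_mulVec (n₁ n₂ : ℕ) (g : SU2) (v : Fin (n₁ + 1) × Fin (n₂ + 1) → ℂ)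
    (k : Fin (n₁ + 1) × Fin (n₂ + 1)) : (wigner n₁ g ⊗ₖ wigner n₂ g).mulVec v k =
      ∑ p : Fin (min n₁ n₂ + 1), ((n₁ + n₂ - 2 * p : ℕ) + 1 : ℂ) *
        ∑ k₃, (cgMatrix n₁ n₂ (n₁ + n₂ - 2 * p)).conjTranspose k k₃ *
          (wigner (n₁ + n₂ - 2 * p) g).mulVec ((cgMatrix n₁ n₂ (n₁ + n₂ - 2 * p)).mulVec v) k₃ := by
  rw [wigner_kronecker, Matrix.sum_mulVec, Finset.sum_apply]
  refine Finset.sum_congr rfl fun p _ => ?_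
  rw [Matrix.smul_mulVec, ← Matrix.mulVec_mulVec, ← Matrix.mulVec_mulVec]
  rfl

lemma integral_wigner_kronecker (n₁ n₂ : ℕ) (δ : Bool) (t : ℝ)
    (v : Fin (n₁ + 1) × Fin (n₂ + 1) → ℂ) (k : Fin (n₁ + 1) × Fin (n₂ + 1)) :
    ∫ x, (wigner n₁ (signed δ (x * h t * x⁻¹)) ⊗ₖ
      wigner n₂ (signed δ (x * h t * x⁻¹))).mulVec v k ∂haar =
    ∑ p : Fin (min n₁ n₂ + 1), ((n₁ + n₂ - 2 * p : ℕ) + 1 : ℂ) *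
      ∑ k₃, (cgMatrix n₁ n₂ (n₁ + n₂ - 2 * p)).conjTranspose k k₃ *
        ((chi (n₁ + n₂ - 2 * p) t / ((n₁ + n₂ - 2 * p : ℕ) + 1) : ℂ) *
          (cgMatrix n₁ n₂ (n₁ + n₂ - 2 * p)).mulVec v k₃) := by
  simp only [wigner_kronecker_mulVec, signed_conj_eq]
  have hc : ∀ (n : ℕ) (v : Fin (n + 1) → ℂ) k, Integrable
      (fun x => (wigner n (1 * (x * signed δ (h t) * x⁻¹) * 1)).mulVec v k) haar :=
    fun n v k => integrable_of_continuous (continuous_mulVec_conj n 1 1 _ v k)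
  rw [integral_finsetSum _ fun p _ =>
    (integrable_finsetSum _ fun k₃ _ => (hc _ _ _).const_mul _).const_mul _]
  refine Finset.sum_congr rfl fun p _ => ?_
  rw [integral_const_mul, integral_finsetSum _ fun k₃ _ => (hc _ _ _).const_mul _]
  congr 1
  refine Finset.sum_congr rfl fun k₃ _ => ?_
  rw [integral_const_mul, integral_mulVec_conj, character_signed_h, one_mul, wigner_one,
    Matrix.one_mulVec]

lemma fluxBraid_aroundTwo_spin (t : ℝ) (n₁ n₂ : ℕ) (δ : Bool) (Φ : State ![.spin n₁, .spin n₂])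
    (y : Config ![.spin n₁, .spin n₂]) (e : SU2 → ℂ) (x : SU2) :
    fluxBraid t ![.spin n₁, .spin n₂] ![0, 0] (aroundTwoWord δ) (tensorState (A := .flux 0) e Φ)
      (consConfig (A := .flux 0) x y) =
    e x * (wigner n₁ (signed δ (x * h t * x⁻¹)) ⊗ₖ wigner n₂ (signed δ (x * h t * x⁻¹))).mulVec
      (spinVec Φ) ((show Fin (n₁ + 1) from y 0), (show Fin (n₂ + 1) from y 1)) := by
  have hc : ∀ (b : Fin 2) (p : (![Kind.spin n₁, Kind.spin n₂] b).Point),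
      (![Kind.spin n₁, Kind.spin n₂] b).hol (![(0 : ℝ), 0] b) p = 1 := by
    intro b
    fin_cases b <;> exact fun _ => rfl
  refine (fluxBraid_aroundTwoWord t ![.spin n₁, .spin n₂] ![0, 0] hc δ Φ y e x).trans ?_
  refine congrArg (e x * ·) ?_
  rw [← slotAct_aroundTwo]
  exact congrArg _ (pairConfig_eta y).symm

lemma continuous_wigner_kronecker (n₁ n₂ : ℕ) (δ : Bool) (t : ℝ)
    (v : Fin (n₁ + 1) × Fin (n₂ + 1) → ℂ) (k : Fin (n₁ + 1) × Fin (n₂ + 1)) :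
    Continuous fun x => (wigner n₁ (signed δ (x * h t * x⁻¹)) ⊗ₖ
      wigner n₂ (signed δ (x * h t * x⁻¹))).mulVec v k := by
  simp only [wigner_kronecker_mulVec, signed_conj_eq]
  exact continuous_finsetSum _ fun p _ => continuous_const.mul
    (continuous_finsetSum _ fun k₃ _ => continuous_const.mul (continuous_mulVec_conj _ 1 1 _ _ _))

lemma isDiagonal_aroundTwoWord (t : ℝ) (n₁ n₂ : ℕ) (δ : Bool) :
    IsDiagonal (fluxBraid t ![.spin n₁, .spin n₂] ![0, 0] (aroundTwoWord δ)) :=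
  isDiagonal_of_forall (fun Φ _ => continuous_wigner_kronecker n₁ n₂ δ t (spinVec Φ) _)
    fun Φ y e x => fluxBraid_aroundTwo_spin t n₁ n₂ δ Φ y e x

/-- Fusion of two spins inside a circle `(θ, 0)`. -/
theorem fusion_spin (n₁ n₂ : ℕ) (t : ℝ) (δ : Bool) (Φ : State ![.spin n₁, .spin n₂])
    (y : Config ![.spin n₁, .spin n₂]) :
    HasSum (fun n₃ : ℕ => ((n₃ : ℂ) + 1) * spinCGDual n₁ n₂ n₃
        (evalFlux t ![.spin n₃] ![0] (circleWord δ) (spinCG n₁ n₂ n₃ Φ)) y)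
      (evalFlux t ![.spin n₁, .spin n₂] ![0, 0] (aroundTwoWord δ) Φ y) := by
  have hterm : ∀ n₃, spinCGDual n₁ n₂ n₃
      (evalFlux t ![.spin n₃] ![0] (circleWord δ) (spinCG n₁ n₂ n₃ Φ)) y =
      ∑ k₃, (cgMatrix n₁ n₂ n₃).conjTranspose
        ((show Fin (n₁ + 1) from y 0), (show Fin (n₂ + 1) from y 1)) k₃ *
        ((chi n₃ t / (n₃ + 1) : ℂ) * (cgMatrix n₁ n₂ n₃).mulVec (spinVec Φ) k₃) := by
    intro n₃
    rw [spinCGDual_apply, Matrix.mulVec, dotProduct]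
    refine Finset.sum_congr rfl fun k₃ _ => ?_
    rw [evalFlux_circleWord_spin, spinCG_apply]
  have hval : evalFlux t ![.spin n₁, .spin n₂] ![0, 0] (aroundTwoWord δ) Φ y =
      ∑ p : Fin (min n₁ n₂ + 1), (((n₁ + n₂ - 2 * p : ℕ) : ℂ) + 1) *
        spinCGDual n₁ n₂ (n₁ + n₂ - 2 * p) (evalFlux t ![.spin (n₁ + n₂ - 2 * p)] ![0]
          (circleWord δ) (spinCG n₁ n₂ (n₁ + n₂ - 2 * p) Φ)) y := by
    rw [evalFlux, reducedTrace_eq (continuous_wigner_kronecker n₁ n₂ δ t (spinVec Φ) _)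
      fun e x => fluxBraid_aroundTwo_spin t n₁ n₂ δ Φ y e x, integral_wigner_kronecker]
    simp only [hterm]
  have hinj : Function.Injective fun p : Fin (min n₁ n₂ + 1) => n₁ + n₂ - 2 * (p : ℕ) := by
    intro p p' hp
    have := p.2
    have := p'.2
    simp only at hp
    exact Fin.ext (by omega)
  rw [hval]
  -- Spins outside the Clebsch-Gordan range contribute zero, so the series over all j₃ is the finite
  -- sum over p.
  refine (hinj.hasSum_iff fun n₃ hn₃ => ?_).mp (hasSum_fintype _)
  have hcg : ∀ k₁ k₂ k₃, cg n₁ n₂ n₃ k₁ k₂ k₃ = 0 := by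
    rcases cg_cases n₁ n₂ n₃ with ⟨p, q, r, h1, h2, h3⟩ | h0
    · exact absurd ⟨⟨p, by omega⟩, by simp only; omega⟩ hn₃
    · exact h0
  simp [spinCGDual, hcg]

end DoubleSU2

end

noncomputable section

namespace DoubleSU2

/-! ### Conjugation to the maximal torus -/

lemma exists_of_first_column {u v : ℂ} (huv : ‖u‖ ^ 2 + ‖v‖ ^ 2 = 1) :
    ∃ w : SU2, w.1 0 0 = u ∧ w.1 1 0 = v := by
  have h1 : u * (starRingEnd ℂ) u + v * (starRingEnd ℂ) v = 1 := by
    rw [Complex.mul_conj', Complex.mul_conj']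
    exact_mod_cast huv
  refine ⟨⟨!![u, -(starRingEnd ℂ) v; v, (starRingEnd ℂ) u], ?_⟩, rfl, rfl⟩
  rw [Matrix.mem_specialUnitaryGroup_iff, Matrix.mem_unitaryGroup_iff]
  refine ⟨?_, ?_⟩
  · ext i j
    fin_cases i <;> fin_cases j <;>
      simp [Matrix.mul_apply, Fin.sum_univ_two, Matrix.star_apply] <;>
      first
        | linear_combination h1
        | ring
  · rw [Matrix.det_fin_two_of]
    linear_combination h1

lemma h_apply_zero_zero (t : ℝ) : (h t).1 0 0 = Complex.exp (Complex.I * t / 2) := rfl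

lemma h_apply_one_zero (t : ℝ) : (h t).1 1 0 = 0 := rfl

/-- The trace determines the class: z is an eigenvalue of g with eigenvector (g₀₁, z − g₀₀), which
after normalisation becomes the first column of w. -/
lemma exists_eq_conj_h {g : SU2} {t : ℝ} (hg : (g.1 0 0).re = Real.cos (t / 2)) :
    ∃ w, g = w * h t * w⁻¹ := by
  set z := Complex.exp (Complex.I * t / 2) with hz
  have hz1 : z * Complex.exp (-(Complex.I * t / 2)) = 1 := by
    rw [hz, ← Complex.exp_add, add_neg_cancel, Complex.exp_zero]
  have htr : g.1 0 0 + g.1 1 1 = z + Complex.exp (-(Complex.I * t / 2)) := by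
    rw [apply_one_one, Complex.star_def, Complex.add_conj, hg, hz]
    have := Complex.two_cos (t / 2 : ℂ)
    push_cast
    rw [this]
    congr 2 <;> ring
  have hdet : g.1 0 0 * g.1 1 1 - g.1 0 1 * g.1 1 0 = 1 := by
    rw [← Matrix.det_fin_two]
    exact (Matrix.mem_specialUnitaryGroup_iff.mp g.2).2
  -- If the eigenvector formula degenerates, g is already h t.
  by_cases hv : g.1 0 1 = 0 ∧ z - g.1 0 0 = 0
  · refine ⟨1, ?_⟩
    rw [one_mul, inv_one, mul_one]
    refine ext_of_first_column (sub_eq_zero.mp hv.2).symm ?_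
    have := apply_zero_one g
    rw [hv.1, zero_eq_neg, star_eq_zero] at this
    exact this
  · set N := ‖g.1 0 1‖ ^ 2 + ‖z - g.1 0 0‖ ^ 2 with hN
    have hNpos : 0 < N := by
      rcases not_and_or.mp hv with h1 | h1
      · have := norm_pos_iff.mpr h1
        positivity
      · have := norm_pos_iff.mpr h1
        positivity
    have hs : Real.sqrt N ^ 2 = N := Real.sq_sqrt hNpos.le
    have hs0 : (Real.sqrt N : ℂ) ≠ 0 := by exact_mod_cast (Real.sqrt_pos.mpr hNpos).ne'
    obtain ⟨w, hw0, hw1⟩ := exists_of_first_column (u := g.1 0 1 / Real.sqrt N)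
      (v := (z - g.1 0 0) / Real.sqrt N) (by
        rw [norm_div, norm_div, div_pow, div_pow, ← add_div, Complex.norm_real, Real.norm_eq_abs,
          sq_abs, hs, ← hN, div_self hNpos.ne'])
    refine ⟨w, eq_mul_inv_of_mul_eq ?_⟩
    refine ext_of_first_column ?_ ?_
    · simp only [Submonoid.coe_mul, Matrix.mul_apply, Fin.sum_univ_two, hw0, hw1,
        h_apply_zero_zero, h_apply_one_zero, ← hz]
      field_simp
      ring
    · simp only [Submonoid.coe_mul, Matrix.mul_apply, Fin.sum_univ_two, hw0, hw1,
        h_apply_zero_zero, h_apply_one_zero, ← hz]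
      field_simp
      linear_combination z * htr - hdet + hz1

lemma re_apply_zero_zero_mul (θ₁ θ₂ θ : ℝ) : ((h θ₁ * a θ * h θ₂ * (a θ)⁻¹).1 0 0).re =
    Real.cos (θ₁ / 2) * Real.cos (θ₂ / 2) -
      Real.cos θ * (Real.sin (θ₁ / 2) * Real.sin (θ₂ / 2)) := by
  have hexp : ∀ t : ℝ, Complex.exp (Complex.I * t / 2) =
      Real.cos (t / 2) + Real.sin (t / 2) * Complex.I := by
    intro t
    rw [show Complex.I * t / 2 = ((t / 2 : ℝ) : ℂ) * Complex.I by push_cast; ring,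
      Complex.exp_mul_I, Complex.ofReal_cos, Complex.ofReal_sin]
  have hexp' : ∀ t : ℝ, Complex.exp (-(Complex.I * t / 2)) =
      Real.cos (t / 2) - Real.sin (t / 2) * Complex.I := by
    intro t
    have := hexp (-t)
    rw [neg_div, Real.cos_neg, Real.sin_neg] at this
    rw [← neg_div, ← mul_neg, ← Complex.ofReal_neg, this]
    push_cast
    ring
  have hcos : Real.cos θ = Real.cos (θ / 2) ^ 2 - Real.sin (θ / 2) ^ 2 := by
    rw [← Real.cos_two_mul']
    congr 1
    ring
  have ha0 : ((a θ)⁻¹).1 0 0 = Real.cos (θ / 2) := by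
    rw [inv_apply]
    simp [a, Complex.conj_ofReal, -Complex.ofReal_cos, -Complex.ofReal_sin]
  have ha1 : ((a θ)⁻¹).1 1 0 = -Real.sin (θ / 2) := by
    rw [inv_apply]
    simp [a, Complex.conj_ofReal, -Complex.ofReal_cos, -Complex.ofReal_sin]
  have hval : (h θ₁ * a θ * h θ₂ * (a θ)⁻¹).1 0 0 =
      Complex.exp (Complex.I * θ₁ / 2) * (Real.cos (θ / 2) ^ 2 * Complex.exp (Complex.I * θ₂ / 2) +
        Real.sin (θ / 2) ^ 2 * Complex.exp (-(Complex.I * θ₂ / 2))) := by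
    simp only [Submonoid.coe_mul, Matrix.mul_apply, Fin.sum_univ_two, ha0, ha1]
    simp [a, h, -Complex.ofReal_cos, -Complex.ofReal_sin]
    ring
  have hsq := Real.cos_sq_add_sin_sq (θ / 2)
  rw [hval, hexp, hexp, hexp', hcos]
  have : ((Real.cos (θ₁ / 2) : ℂ) + Real.sin (θ₁ / 2) * Complex.I) *
      ((Real.cos (θ / 2) : ℂ) ^ 2 * (Real.cos (θ₂ / 2) + Real.sin (θ₂ / 2) * Complex.I) +
        (Real.sin (θ / 2) : ℂ) ^ 2 * (Real.cos (θ₂ / 2) - Real.sin (θ₂ / 2) * Complex.I)) =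
      ((Real.cos (θ₁ / 2) * Real.cos (θ₂ / 2) * (Real.cos (θ / 2) ^ 2 + Real.sin (θ / 2) ^ 2) -
        (Real.cos (θ / 2) ^ 2 - Real.sin (θ / 2) ^ 2) *
          (Real.sin (θ₁ / 2) * Real.sin (θ₂ / 2)) : ℝ) : ℂ) +
      ((Real.sin (θ₁ / 2) * Real.cos (θ₂ / 2) * (Real.cos (θ / 2) ^ 2 + Real.sin (θ / 2) ^ 2) +
        (Real.cos (θ / 2) ^ 2 - Real.sin (θ / 2) ^ 2) *
          (Real.cos (θ₁ / 2) * Real.sin (θ₂ / 2)) : ℝ) : ℂ) * Complex.I := by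
    push_cast [-Complex.ofReal_cos, -Complex.ofReal_sin]
    linear_combination (Real.sin (θ₁ / 2) * Real.sin (θ₂ / 2) *
      ((Real.cos (θ / 2) : ℂ) ^ 2 - (Real.sin (θ / 2) : ℂ) ^ 2)) * Complex.I_sq
  rw [this, Complex.add_re, Complex.re_ofReal_mul, Complex.I_re, Complex.ofReal_re, hsq]
  ring

/-- The relative angle is defined so that half the trace of the product is cos(θ₃/2); admissibility
keeps the argument of arccos in [−1, 1]. -/
lemma exists_isSection {θ₁ θ₂ : ℝ} (h₁ : 0 < θ₁) (h₁' : θ₁ < 2 * Real.pi) (h₂ : 0 < θ₂)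
    (h₂' : θ₂ < 2 * Real.pi) : ∃ w, IsSection θ₁ θ₂ w := by
  have key : ∀ θ₃, ∃ w, Admissible θ₁ θ₂ θ₃ →
      h θ₁ * a (relAngle θ₁ θ₂ θ₃) * h θ₂ * (a (relAngle θ₁ θ₂ θ₃))⁻¹ = w * h θ₃ * w⁻¹ := by
    intro θ₃
    by_cases ha : Admissible θ₁ θ₂ θ₃
    · obtain ⟨w, hw⟩ := exists_eq_conj_h (t := θ₃)
        (g := h θ₁ * a (relAngle θ₁ θ₂ θ₃) * h θ₂ * (a (relAngle θ₁ θ₂ θ₃))⁻¹) (by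
          have hB : 0 < Real.sin (θ₁ / 2) * Real.sin (θ₂ / 2) :=
            mul_pos (sin_half_pos h₁ h₁') (sin_half_pos h₂ h₂')
          obtain ⟨-, -, h3, h4⟩ := (admissible_iff h₁ h₁' h₂ h₂').mp ha
          rw [add_div, Real.cos_add] at h3
          rw [sub_div, Real.cos_sub] at h4
          rw [re_apply_zero_zero_mul, relAngle, Real.cos_arccos, div_mul_cancel₀ _ hB.ne']
          · ring
          · rw [le_div_iff₀ hB]
            linarith
          · rw [div_le_iff₀ hB]
            linarith)
      exact ⟨w, fun _ => hw⟩
    · exact ⟨1, fun h => absurd h ha⟩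
  choose w hw using key
  exact ⟨w, hw⟩

lemma h_mul_h (s t : ℝ) : h s * h t = h (s + t) := by
  refine ext_of_first_column ?_ ?_
  · simp only [Submonoid.coe_mul, Matrix.mul_apply, Fin.sum_univ_two, h_apply_zero_zero,
      h_apply_one_zero, mul_zero, add_zero, ← Complex.exp_add]
    congr 1
    push_cast
    ring
  · simp [h]

lemma conj_mul_h (x : SU2) (ξ t : ℝ) : x * h ξ * h t * (x * h ξ)⁻¹ = x * h t * x⁻¹ := by
  rw [mul_inv_rev, mul_assoc x, h_mul_h, add_comm, ← h_mul_h]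
  group

/-! ### The Clebsch-Gordan maps of two fluxes are intertwiners -/

lemma doubleAct_flux_two (θ₁ θ₂ : ℝ) (f : SU2 → ℂ) (g : SU2) (Φ : State ![.flux 0, .flux 0])
    (x y : SU2) : doubleAct ![.flux 0, .flux 0] ![θ₁, θ₂] f g Φ
      (pairConfig (A := .flux 0) (B := .flux 0) x y) =
    f (x * h θ₁ * x⁻¹ * (y * h θ₂ * y⁻¹)) *
      Φ (pairConfig (A := .flux 0) (B := .flux 0) (g⁻¹ * x : SU2) (g⁻¹ * y : SU2)) := by
  refine congrArg₂ (· * ·) (congrArg f ?_) (congrArg Φ ?_)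
  · exact congrArg (x * h θ₁ * x⁻¹ * ·) (mul_one (y * h θ₂ * y⁻¹))
  · refine (congrArg (fun z => Function.update z 1 (g⁻¹ * y : SU2))
      (update_pairConfig_zero (A := .flux 0) (B := .flux 0) x (g⁻¹ * x : SU2) y)).trans ?_
    exact update_pairConfig_one (A := .flux 0) (B := .flux 0) _ _ _

lemma doubleAct_flux_one (n : ℤ) (θ : ℝ) (f : SU2 → ℂ) (g : SU2) (Φ : State ![.flux n])
    (x : SU2) : doubleAct ![.flux n] ![θ] f g Φ (singleConfig (A := .flux n) x) =
      f (x * h θ * x⁻¹) * Φ (singleConfig (A := .flux n) (g⁻¹ * x : SU2)) :=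
  congrArg₂ (· * ·) (congrArg f (mul_one (x * h θ * x⁻¹)))
    (congrArg Φ (update_singleConfig (A := .flux n) x (g⁻¹ * x : SU2)))

/-- On the support of the kernel the section equation makes the product of the two holonomies equal
to x₃ h_{θ₃} x₃⁻¹. So f leaves the integral, while left translation by g commutes with all the right
multiplications. -/
theorem fluxCG_doubleAct {θ₁ θ₂ : ℝ} {w : ℝ → SU2} (hw : IsSection θ₁ θ₂ w) (θ₃ : ℝ) (n₃ : ℤ)
    (f : SU2 → ℂ) (g : SU2) (Φ : State ![.flux 0, .flux 0]) :
    fluxCG θ₁ θ₂ θ₃ n₃ (w θ₃) (doubleAct ![.flux 0, .flux 0] ![θ₁, θ₂] f g Φ) =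
      doubleAct ![.flux n₃] ![θ₃] f g (fluxCG θ₁ θ₂ θ₃ n₃ (w θ₃) Φ) := by
  have key : ∀ x : SU2, fluxCG θ₁ θ₂ θ₃ n₃ (w θ₃)
      (doubleAct ![.flux 0, .flux 0] ![θ₁, θ₂] f g Φ) (singleConfig (A := .flux n₃) x) =
      doubleAct ![.flux n₃] ![θ₃] f g (fluxCG θ₁ θ₂ θ₃ n₃ (w θ₃) Φ)
        (singleConfig (A := .flux n₃) x) := by
    intro x
    rw [doubleAct_flux_one]
    by_cases ha : Admissible θ₁ θ₂ θ₃
    · have hx : ∀ ξ₁ ξ₂ ξ₃ : ℝ, doubleAct ![.flux 0, .flux 0] ![θ₁, θ₂] f g Φ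
          (pairConfig (A := .flux 0) (B := .flux 0) (x * h ξ₃ * (w θ₃)⁻¹ * (h ξ₁)⁻¹ : SU2)
            (x * h ξ₃ * (w θ₃)⁻¹ * a (relAngle θ₁ θ₂ θ₃) * (h ξ₂)⁻¹ : SU2)) =
          f (x * h θ₃ * x⁻¹) * Φ (pairConfig (A := .flux 0) (B := .flux 0)
            (g⁻¹ * x * h ξ₃ * (w θ₃)⁻¹ * (h ξ₁)⁻¹ : SU2)
            (g⁻¹ * x * h ξ₃ * (w θ₃)⁻¹ * a (relAngle θ₁ θ₂ θ₃) * (h ξ₂)⁻¹ : SU2)) := by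
        intro ξ₁ ξ₂ ξ₃
        rw [doubleAct_flux_two, h_inv, h_inv, conj_mul_h, conj_mul_h]
        have hprod : x * h ξ₃ * (w θ₃)⁻¹ * h θ₁ * (x * h ξ₃ * (w θ₃)⁻¹)⁻¹ *
            (x * h ξ₃ * (w θ₃)⁻¹ * a (relAngle θ₁ θ₂ θ₃) * h θ₂ *
              (x * h ξ₃ * (w θ₃)⁻¹ * a (relAngle θ₁ θ₂ θ₃))⁻¹) = x * h θ₃ * x⁻¹ := by
          rw [← conj_mul_h x ξ₃ θ₃]
          have e : x * h ξ₃ * (w θ₃)⁻¹ * h θ₁ * (x * h ξ₃ * (w θ₃)⁻¹)⁻¹ *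
            (x * h ξ₃ * (w θ₃)⁻¹ * a (relAngle θ₁ θ₂ θ₃) * h θ₂ *
              (x * h ξ₃ * (w θ₃)⁻¹ * a (relAngle θ₁ θ₂ θ₃))⁻¹) = x * h ξ₃ * (w θ₃)⁻¹ *
              (h θ₁ * a (relAngle θ₁ θ₂ θ₃) * h θ₂ * (a (relAngle θ₁ θ₂ θ₃))⁻¹) *
              (x * h ξ₃ * (w θ₃)⁻¹)⁻¹ := by group
          rw [e, hw θ₃ ha]
          group
        rw [hprod]
        simp only [mul_assoc]
      refine (if_pos ha).trans ?_
      refine Eq.trans ?_ (congrArg (f (x * h θ₃ * x⁻¹) * ·) (if_pos ha)).symm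
      refine Eq.trans ?_ (mul_left_comm _ _ _)
      refine congrArg (HMul.hMul (α := ℂ) (β := ℂ) _) ?_
      rw [← intervalIntegral.integral_const_mul]
      congr 1
      funext ξ₁
      rw [← intervalIntegral.integral_const_mul]
      congr 1
      funext ξ₂
      rw [← intervalIntegral.integral_const_mul]
      congr 1
      funext ξ₃
      exact (congrArg (Complex.exp (-(Complex.I * n₃ * ξ₃ / 2)) * ·) (hx ξ₁ ξ₂ ξ₃)).trans (mul_left_comm _ _ _)
    · refine (if_neg ha).trans ?_
      refine Eq.trans ?_ (congrArg (f (x * h θ₃ * x⁻¹) * ·) (if_neg ha)).symm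
      exact (mul_zero _).symm
  funext y
  have := key (y 0)
  rwa [singleConfig_eta] at this

end DoubleSU2

end

noncomputable section

namespace DoubleSU2

/-! ### Fourier analysis along the maximal torus -/

instance fact_four_pi_pos : Fact (0 < 4 * Real.pi) := ⟨by positivity⟩

/-- The period is 4π and not 2π, so the characters of the circle are labelled by n = 2s and include
half-integral s. -/
lemma periodic_h : Function.Periodic h (4 * Real.pi) := by
  intro t
  rw [← h_mul_h]
  have : h (4 * Real.pi) = 1 := by
    refine ext_of_first_column ?_ ?_
    · rw [h_apply_zero_zero]
      refine (congrArg Complex.exp ?_).trans Complex.exp_two_pi_mul_I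
      push_cast
      ring
    · simp [h]
  rw [this, mul_one]

/-- The parametrisation of the maximal torus by the circle. -/
def torus : AddCircle (4 * Real.pi) → SU2 := periodic_h.lift

lemma torus_coe (t : ℝ) : torus t = h t := rfl

lemma continuous_torus : Continuous torus := continuous_h.quotient_liftOn' _

lemma torus_add (x y : AddCircle (4 * Real.pi)) : torus (x + y) = torus x * torus y := by
  induction x using QuotientAddGroup.induction_on with | _ x => ?_
  induction y using QuotientAddGroup.induction_on with | _ y => ?_
  exact (h_mul_h x y).symm

/-- The normalised Haar measure on the torus. -/
abbrev torusMeasure : Measure (AddCircle (4 * Real.pi)) := AddCircle.haarAddCircle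

lemma measurable_mul_torus :
    Measurable fun p : SU2 × AddCircle (4 * Real.pi) => p.1 * torus p.2 :=
  measurable_fst.mul (continuous_torus.measurable.comp measurable_snd)

/-- Right invariance holds for each fixed torus element, so averaging over the torus first does not
change a Haar integral. -/
lemma measurePreserving_mul_torus :
    MeasurePreserving (fun p : SU2 × AddCircle (4 * Real.pi) => p.1 * torus p.2)
      (haar.prod torusMeasure) haar := by
  refine ⟨measurable_mul_torus, Measure.ext fun s hs => ?_⟩
  rw [Measure.map_apply measurable_mul_torus hs, Measure.prod_apply_symm (measurable_mul_torus hs)]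
  have : ∀ ξ : AddCircle (4 * Real.pi), haar ((fun x => (x, ξ)) ⁻¹'
      ((fun p : SU2 × AddCircle (4 * Real.pi) => p.1 * torus p.2) ⁻¹' s)) = haar s := fun ξ =>
    measure_preimage_mul_right haar (torus ξ) s
  simp only [this, lintegral_const, measure_univ, mul_one]

/-- The component of weight `n` of a function on the group, under right translation by the
torus. -/
def torusCoeff (n : ℤ) (F : SU2 → ℂ) (x : SU2) : ℂ := fourierCoeff (fun ξ => F (x * torus ξ)) n

lemma torusCoeff_eq (n : ℤ) (F : SU2 → ℂ) (x : SU2) : torusCoeff n F x =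
    ((1 / (4 * Real.pi) : ℝ) : ℂ) * ∫ ξ in (-(2 * Real.pi))..(2 * Real.pi),
      Complex.exp (-(Complex.I * n * ξ / 2)) * F (x * h ξ) := by
  rw [torusCoeff, fourierCoeff_eq_intervalIntegral _ _ (-(2 * Real.pi)), Complex.real_smul,
    show -(2 * Real.pi) + 4 * Real.pi = 2 * Real.pi by ring]
  congr 2
  funext ξ
  rw [fourier_coe_apply, smul_eq_mul, torus_coe]
  congr 2
  have : (Real.pi : ℂ) ≠ 0 := by exact_mod_cast Real.pi_ne_zero
  push_cast
  field_simp
  ring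

lemma stronglyMeasurable_torusCoeff {F : SU2 → ℂ} (hF : Measurable F) (n : ℤ) :
    StronglyMeasurable (torusCoeff n F) := by
  refine StronglyMeasurable.integral_prod_right
    (f := fun (x : SU2) (ξ : AddCircle (4 * Real.pi)) => fourier (-n) ξ • F (x * torus ξ)) ?_
  refine Measurable.stronglyMeasurable ?_
  exact ((map_continuous (fourier (-n))).measurable.comp measurable_snd).smul
    (hF.comp measurable_mul_torus)

lemma torusCoeff_mul_torus (n : ℤ) (F : SU2 → ℂ) (x : SU2) (η : AddCircle (4 * Real.pi)) :
    torusCoeff n F (x * torus η) = fourier n η * torusCoeff n F x := by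
  have h1 := integral_add_left_eq_self (μ := torusMeasure)
    (fun ξ : AddCircle (4 * Real.pi) => fourier (-n) ξ • F (x * torus ξ)) η
  rw [torusCoeff, torusCoeff, fourierCoeff, fourierCoeff, ← h1, ← integral_const_mul]
  congr 1
  funext ξ
  have h2 : fourier n η * fourier (-n) η = 1 := by
    rw [← fourier_add, add_neg_cancel, fourier_zero]
  simp only [smul_eq_mul, torus_add, ← mul_assoc]
  rw [show fourier (-n) (η + ξ) = fourier (-n) η * fourier (-n) ξ by simp [fourier_apply, smul_add,
    AddCircle.toCircle_add], ← mul_assoc, h2, one_mul]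

lemma torusCoeff_mul_h (n : ℤ) (F : SU2 → ℂ) (x : SU2) (η : ℝ) :
    torusCoeff n F (x * h η) = Complex.exp (Complex.I * n * η / 2) * torusCoeff n F x := by
  rw [← torus_coe, torusCoeff_mul_torus, fourier_coe_apply]
  congr 2
  have : (Real.pi : ℂ) ≠ 0 := by exact_mod_cast Real.pi_ne_zero
  push_cast
  field_simp
  ring

lemma hasSum_fourierCoeff_mul {f g : AddCircle (4 * Real.pi) → ℂ} (hf : MemLp f 2 torusMeasure)
    (hg : MemLp g 2 torusMeasure) :
    HasSum (fun n => (starRingEnd ℂ) (fourierCoeff f n) * fourierCoeff g n)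
      (∫ ξ, (starRingEnd ℂ) (f ξ) * g ξ ∂torusMeasure) := by
  have hcoeff : ∀ {f : AddCircle (4 * Real.pi) → ℂ} (hf : MemLp f 2 torusMeasure) (n : ℤ),
      inner ℂ (fourierBasis (T := 4 * Real.pi) n) (hf.toLp f) = fourierCoeff f n := by
    intro f hf n
    rw [← HilbertBasis.repr_apply_apply, fourierBasis_repr]
    exact integral_congr_ae ((MemLp.coeFn_toLp hf).mono fun ξ hξ => by simp only [hξ])
  have h1 := (fourierBasis (T := 4 * Real.pi)).hasSum_inner_mul_inner (hf.toLp f) (hg.toLp g)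
  have h2 : inner ℂ (hf.toLp f) (hg.toLp g) =
      ∫ ξ, (starRingEnd ℂ) (f ξ) * g ξ ∂torusMeasure := by
    rw [L2.inner_def]
    refine integral_congr_ae ?_
    filter_upwards [MemLp.coeFn_toLp hf, MemLp.coeFn_toLp hg] with ξ h3 h4
    rw [h3, h4, RCLike.inner_apply, mul_comm]
  rw [h2] at h1
  have h3 : (fun n => inner ℂ (hf.toLp f) (fourierBasis (T := 4 * Real.pi) n) *
      inner ℂ (fourierBasis (T := 4 * Real.pi) n) (hg.toLp g)) =
      fun n => (starRingEnd ℂ) (fourierCoeff f n) * fourierCoeff g n := by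
    funext n
    rw [← inner_conj_symm, hcoeff hf, hcoeff hg]
  rwa [h3] at h1

section Parseval

variable {F G : SU2 → ℂ}

lemma memLp_comp_mul_torus (hF : MemLp F 2 haar) :
    MemLp (fun p : SU2 × AddCircle (4 * Real.pi) => F (p.1 * torus p.2)) 2
      (haar.prod torusMeasure) :=
  hF.comp_measurePreserving measurePreserving_mul_torus

lemma ae_memLp_mul_torus (hm : Measurable F) (hF : MemLp F 2 haar) :
    ∀ᵐ x ∂haar, MemLp (fun ξ => F (x * torus ξ)) 2 torusMeasure := by
  have h1 := (memLp_comp_mul_torus hF).integrable_norm_pow two_ne_zero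
  filter_upwards [h1.prod_right_ae] with x hx
  rw [memLp_two_iff_integrable_sq_norm]
  · exact hx
  · exact (hm.comp (measurable_const.mul continuous_torus.measurable)).aestronglyMeasurable

lemma ae_hasSum_torusCoeff (hmF : Measurable F) (hF : MemLp F 2 haar) (hmG : Measurable G)
    (hG : MemLp G 2 haar) :
    ∀ᵐ x ∂haar, HasSum (fun n => (starRingEnd ℂ) (torusCoeff n F x) * torusCoeff n G x)
      (∫ ξ, (starRingEnd ℂ) (F (x * torus ξ)) * G (x * torus ξ) ∂torusMeasure) := by
  filter_upwards [ae_memLp_mul_torus hmF hF, ae_memLp_mul_torus hmG hG] with x hx hx'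
  exact hasSum_fourierCoeff_mul hx hx'

lemma ae_hasSum_normSq_torusCoeff (hm : Measurable F) (hF : MemLp F 2 haar) :
    ∀ᵐ x ∂haar, HasSum (fun n => ‖torusCoeff n F x‖ ^ 2)
      (∫ ξ, ‖F (x * torus ξ)‖ ^ 2 ∂torusMeasure) := by
  filter_upwards [ae_hasSum_torusCoeff hm hF hm hF] with x hx
  simp only [Complex.conj_mul'] at hx
  rw [← Complex.hasSum_ofReal]
  have h1 : ((∫ ξ, ‖F (x * torus ξ)‖ ^ 2 ∂torusMeasure : ℝ) : ℂ) =
      ∫ ξ, (‖F (x * torus ξ)‖ : ℂ) ^ 2 ∂torusMeasure := by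
    refine integral_ofReal.symm.trans ?_
    push_cast
    rfl
  rw [h1]
  push_cast
  exact hx

lemma integrable_integral_normSq (hF : MemLp F 2 haar) :
    Integrable (fun x => ∫ ξ, ‖F (x * torus ξ)‖ ^ 2 ∂torusMeasure) haar :=
  ((memLp_comp_mul_torus hF).integrable_norm_pow two_ne_zero).integral_prod_left

lemma memLp_torusCoeff (hm : Measurable F) (hF : MemLp F 2 haar) (n : ℤ) :
    MemLp (torusCoeff n F) 2 haar := by
  have hs := (stronglyMeasurable_torusCoeff hm n).aestronglyMeasurable (μ := haar)
  rw [memLp_two_iff_integrable_sq_norm hs]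
  refine (integrable_integral_normSq hF).mono (hs.norm.pow 2) ?_
  filter_upwards [ae_hasSum_normSq_torusCoeff hm hF] with x hx
  have h1 := hx.nonneg fun i => sq_nonneg _
  rw [Real.norm_of_nonneg (sq_nonneg _), Real.norm_of_nonneg h1]
  exact le_hasSum hx n fun i _ => sq_nonneg _

lemma summable_integral_normSq_torusCoeff (hm : Measurable F) (hF : MemLp F 2 haar) :
    Summable fun n => ∫ x, ‖torusCoeff n F x‖ ^ 2 ∂haar := by
  refine summable_of_sum_le (c := ∫ x, ∫ ξ, ‖F (x * torus ξ)‖ ^ 2 ∂torusMeasure ∂haar)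
    (fun n => integral_nonneg fun x => sq_nonneg _) fun s => ?_
  have hi : ∀ n, Integrable (fun x => ‖torusCoeff n F x‖ ^ 2) haar := fun n =>
    (memLp_torusCoeff hm hF n).integrable_norm_pow two_ne_zero
  rw [← integral_finsetSum _ fun n _ => hi n]
  refine integral_mono_ae (integrable_finsetSum _ fun n _ => hi n)
    (integrable_integral_normSq hF) ?_
  filter_upwards [ae_hasSum_normSq_torusCoeff hm hF] with x hx
  exact sum_le_hasSum s (fun i _ => sq_nonneg _) hx

/-- The Parseval identity for the decomposition into weights of the torus. -/
lemma hasSum_integral_torusCoeff (hmF : Measurable F) (hF : MemLp F 2 haar) (hmG : Measurable G)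
    (hG : MemLp G 2 haar) :
    HasSum (fun n => ∫ x, (starRingEnd ℂ) (torusCoeff n F x) * torusCoeff n G x ∂haar)
      (∫ x, (starRingEnd ℂ) (F x) * G x ∂haar) := by
  have hint : ∀ n, Integrable
      (fun x => (starRingEnd ℂ) (torusCoeff n F x) * torusCoeff n G x) haar := fun n =>
    (memLp_torusCoeff hmF hF n).star.integrable_mul (memLp_torusCoeff hmG hG n)
  -- Sum and integral may be exchanged because |ab| ≤ |a|² + |b|², and both squares are summable by
  -- Bessel's inequality integrated over the group.
  have hsum : Summable fun n =>
      ∫ x, ‖(starRingEnd ℂ) (torusCoeff n F x) * torusCoeff n G x‖ ∂haar := by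
    refine Summable.of_nonneg_of_le (fun n => integral_nonneg fun x => norm_nonneg _) (fun n => ?_)
      ((summable_integral_normSq_torusCoeff hmF hF).add
        (summable_integral_normSq_torusCoeff hmG hG))
    have h1 := (memLp_torusCoeff hmF hF n).integrable_norm_pow two_ne_zero
    have h2 := (memLp_torusCoeff hmG hG n).integrable_norm_pow two_ne_zero
    rw [← integral_add h1 h2]
    refine integral_mono (hint n).norm (h1.add h2) fun x => ?_
    simp only [norm_mul, RCLike.norm_conj]
    nlinarith [sq_nonneg (‖torusCoeff n F x‖ - ‖torusCoeff n G x‖),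
      sq_nonneg ‖torusCoeff n F x‖, sq_nonneg ‖torusCoeff n G x‖]
  have h1 := hasSum_integral_of_summable_integral_norm hint hsum
  have h2 : ∫ x, ∑' n, (starRingEnd ℂ) (torusCoeff n F x) * torusCoeff n G x ∂haar =
      ∫ x, (starRingEnd ℂ) (F x) * G x ∂haar := by
    have h3 : Integrable (fun x => (starRingEnd ℂ) (F x) * G x) haar := hF.star.integrable_mul hG
    rw [integral_congr_ae ((ae_hasSum_torusCoeff hmF hF hmG hG).mono fun x hx => hx.tsum_eq)]
    have h4 := measurePreserving_mul_torus.integrable_comp_of_integrable h3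
    have h5 := integral_prod _ h4
    refine h5.symm.trans ?_
    have h6 := integral_map (μ := haar.prod torusMeasure)
      measurePreserving_mul_torus.measurable.aemeasurable
      (f := fun x => (starRingEnd ℂ) (F x) * G x)
      (by rw [measurePreserving_mul_torus.map_eq]; exact h3.aestronglyMeasurable)
    rw [measurePreserving_mul_torus.map_eq] at h6
    exact h6.symm
  rwa [h2] at h1

end Parseval

end DoubleSU2

end

noncomputable section

namespace DoubleSU2

/-! ### States of two fluxes as functions on the group -/

/-- A state of two fluxes as a function of two group elements. -/
def fluxFun (Φ : State ![.flux 0, .flux 0]) (x y : SU2) : ℂ :=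
  Φ (pairConfig (A := .flux 0) (B := .flux 0) x y)

section Carrier

variable {Φ Ψ : State ![.flux 0, .flux 0]}

lemma piFinTwo_symm_eq (p : SU2 × SU2) :
    (MeasurableEquiv.piFinTwo fun b => (![Kind.flux 0, Kind.flux 0] b).Point).symm p =
      pairConfig (A := .flux 0) (B := .flux 0) p.1 p.2 := by
  refine (MeasurableEquiv.piFinTwo fun b => (![Kind.flux 0, Kind.flux 0] b).Point).injective ?_
  exact MeasurableEquiv.apply_symm_apply _ _

lemma measurable_fluxFun (hΦ : IsCarrier ![.flux 0, .flux 0] Φ) :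
    Measurable fun p : SU2 × SU2 => fluxFun Φ p.1 p.2 := by
  have h1 : Measurable fun p : SU2 × SU2 => Φ
      ((MeasurableEquiv.piFinTwo fun b => (![Kind.flux 0, Kind.flux 0] b).Point).symm p) :=
    hΦ.measurable.comp (MeasurableEquiv.measurable _)
  simp only [piFinTwo_symm_eq] at h1
  exact h1

lemma memLp_fluxFun (hΦ : IsCarrier ![.flux 0, .flux 0] Φ) :
    MemLp (fun p : SU2 × SU2 => fluxFun Φ p.1 p.2) 2 (haar.prod haar) := by
  have he : MeasurePreserving
      (MeasurableEquiv.piFinTwo fun b => (![Kind.flux 0, Kind.flux 0] b).Point)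
      (configMeasure ![.flux 0, .flux 0]) (haar.prod haar) := measurePreserving_two _
  have h1 : MemLp (fun p : SU2 × SU2 => Φ
      ((MeasurableEquiv.piFinTwo fun b => (![Kind.flux 0, Kind.flux 0] b).Point).symm p)) 2
      (haar.prod haar) := hΦ.memLp.comp_measurePreserving (he.symm _)
  simp only [piFinTwo_symm_eq] at h1
  exact h1

lemma fluxFun_mul_h_left (hΦ : IsCarrier ![.flux 0, .flux 0] Φ) (x y : SU2) (ξ : ℝ) :
    fluxFun Φ (x * h ξ) y = fluxFun Φ x y := by
  have h1 := hΦ.covariant 0 ξ (pairConfig (A := .flux 0) (B := .flux 0) x y)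
  have h2 : Kind.phase (.flux 0) ξ = 1 := by simp [Kind.phase]
  refine (congrArg Φ (update_pairConfig_zero (A := .flux 0) (B := .flux 0) x
    (x * h ξ : SU2) y).symm).trans (h1.trans ?_)
  exact (congrArg (· * _) h2).trans (one_mul _)

lemma fluxFun_mul_h_right (hΦ : IsCarrier ![.flux 0, .flux 0] Φ) (x y : SU2) (ξ : ℝ) :
    fluxFun Φ x (y * h ξ) = fluxFun Φ x y := by
  have h1 := hΦ.covariant 1 ξ (pairConfig (A := .flux 0) (B := .flux 0) x y)
  have h2 : Kind.phase (.flux 0) ξ = 1 := by simp [Kind.phase]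
  refine (congrArg Φ (update_pairConfig_one (A := .flux 0) (B := .flux 0) x
    y (y * h ξ : SU2)).symm).trans (h1.trans ?_)
  exact (congrArg (· * _) h2).trans (one_mul _)

/-- The normalisation of the Clebsch-Gordan kernel. -/
def fluxNorm (θ₁ θ₂ θ₃ : ℝ) : ℝ :=
  1 / Real.sqrt (4 * Real.sin (θ₁ / 2) * Real.sin (θ₂ / 2) * Real.sin (θ₃ / 2))

/-- The Clebsch-Gordan map as a Fourier component along the torus. -/
lemma fluxCG_eq (hΦ : IsCarrier ![.flux 0, .flux 0] Φ) {θ₁ θ₂ θ₃ : ℝ}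
    (ha : Admissible θ₁ θ₂ θ₃) (n₃ : ℤ) (w : SU2) (y : Config ![.flux n₃]) :
    fluxCG θ₁ θ₂ θ₃ n₃ w Φ y = (fluxNorm θ₁ θ₂ θ₃ : ℂ) *
      torusCoeff n₃ (fun z => fluxFun Φ (z * w⁻¹) (z * w⁻¹ * a (relAngle θ₁ θ₂ θ₃))) (y 0) := by
  let x : SU2 := y 0
  -- Both fluxes have s = 0, so the integrals over ξ₁ and ξ₂ are of constants and cancel two of the
  -- three factors 1/(4π).
  have hF : ∀ ξ₁ ξ₂ ξ₃ : ℝ, fluxFun Φ (x * h ξ₃ * w⁻¹ * (h ξ₁)⁻¹)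
      (x * h ξ₃ * w⁻¹ * a (relAngle θ₁ θ₂ θ₃) * (h ξ₂)⁻¹) =
      fluxFun Φ (x * h ξ₃ * w⁻¹) (x * h ξ₃ * w⁻¹ * a (relAngle θ₁ θ₂ θ₃)) := by
    intro ξ₁ ξ₂ ξ₃
    rw [h_inv, h_inv, fluxFun_mul_h_left hΦ, fluxFun_mul_h_right hΦ]
  have key : (fluxNorm θ₁ θ₂ θ₃ : ℂ) * ((1 / (4 * Real.pi) ^ 3 : ℝ) : ℂ) *
      ∫ ξ₁ in (-(2 * Real.pi))..(2 * Real.pi), ∫ ξ₂ in (-(2 * Real.pi))..(2 * Real.pi),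
      ∫ ξ₃ in (-(2 * Real.pi))..(2 * Real.pi), Complex.exp (-(Complex.I * n₃ * ξ₃ / 2)) *
        fluxFun Φ (x * h ξ₃ * w⁻¹ * (h ξ₁)⁻¹)
          (x * h ξ₃ * w⁻¹ * a (relAngle θ₁ θ₂ θ₃) * (h ξ₂)⁻¹) =
      (fluxNorm θ₁ θ₂ θ₃ : ℂ) *
      torusCoeff n₃ (fun z => fluxFun Φ (z * w⁻¹) (z * w⁻¹ * a (relAngle θ₁ θ₂ θ₃))) x := by
    simp only [hF]
    rw [intervalIntegral.integral_const, intervalIntegral.integral_const, torusCoeff_eq]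
    simp only [Complex.real_smul]
    rw [mul_assoc]
    congr 1
    have : (Real.pi : ℂ) ≠ 0 := by exact_mod_cast Real.pi_ne_zero
    simp only [← mul_assoc]
    congr 1
    push_cast
    field_simp
    norm_num
  exact (if_pos ha).trans key

lemma fluxCG_of_not_admissible {θ₁ θ₂ θ₃ : ℝ} (ha : ¬Admissible θ₁ θ₂ θ₃) (n₃ : ℤ) (w : SU2)
    (Φ : State ![.flux 0, .flux 0]) : fluxCG θ₁ θ₂ θ₃ n₃ w Φ = fun _ => 0 :=
  funext fun _ => if_neg ha

/-! ### Restriction to a relative position -/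

/-- The coordinates (x, b) with y = x b separate the overall position x from the relative position
b. -/
lemma measurable_shear : Measurable fun p : SU2 × SU2 => (p.1, p.1 * p.2) :=
  measurable_fst.prodMk (measurable_fst.mul measurable_snd)

lemma measurable_fluxFun_shear (hΦ : IsCarrier ![.flux 0, .flux 0] Φ) :
    Measurable fun p : SU2 × SU2 => fluxFun Φ p.1 (p.1 * p.2) :=
  (measurable_fluxFun hΦ).comp measurable_shear

lemma memLp_fluxFun_shear (hΦ : IsCarrier ![.flux 0, .flux 0] Φ) :
    MemLp (fun p : SU2 × SU2 => fluxFun Φ p.1 (p.1 * p.2)) 2 (haar.prod haar) :=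
  (memLp_fluxFun hΦ).comp_measurePreserving (measurePreserving_prod_mul haar haar)

lemma measurable_fluxFun_slice (hΦ : IsCarrier ![.flux 0, .flux 0] Φ) (b : SU2) :
    Measurable fun x : SU2 => fluxFun Φ x (x * b) :=
  (measurable_fluxFun_shear hΦ).comp (measurable_id.prodMk measurable_const)

/-- Invariance of Φ in its first argument trades a left torus translation of b for a right
translation of x, which a Haar integral over x does not see. -/
lemma fluxFun_h_mul (hΦ : IsCarrier ![.flux 0, .flux 0] Φ) (x b : SU2) (ξ : ℝ) :
    fluxFun Φ x (x * (h ξ * b)) = fluxFun Φ (x * h ξ) (x * h ξ * b) := by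
  rw [fluxFun_mul_h_left hΦ, mul_assoc]

lemma fluxFun_mul_h (hΦ : IsCarrier ![.flux 0, .flux 0] Φ) (x b : SU2) (ξ : ℝ) :
    fluxFun Φ x (x * (b * h ξ)) = fluxFun Φ x (x * b) := by
  rw [← mul_assoc, fluxFun_mul_h_right hΦ]

/-- The squared norm of the slice at b is bi-invariant and has a finite integral over b. In the
variable θ₃ it is thus finite almost everywhere, the Jacobian being positive on (0, 2π). -/
lemma ae_memLp_slice {θ₁ θ₂ : ℝ} (h₁ : 0 < θ₁) (h₁' : θ₁ < 2 * Real.pi) (h₂ : 0 < θ₂)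
    (h₂' : θ₂ < 2 * Real.pi) (hΦ : IsCarrier ![.flux 0, .flux 0] Φ) :
    ∀ᵐ θ₃ ∂(volume.restrict (Set.Ioo 0 (2 * Real.pi))), Admissible θ₁ θ₂ θ₃ →
      MemLp (fun x => fluxFun Φ x (x * a (relAngle θ₁ θ₂ θ₃))) 2 haar := by
  let H : SU2 → ℝ≥0∞ := fun b => ∫⁻ x, ‖‖fluxFun Φ x (x * b)‖ ^ 2‖ₑ ∂haar
  have hm : Measurable fun p : SU2 × SU2 => ‖‖fluxFun Φ p.1 (p.1 * p.2)‖ ^ 2‖ₑ :=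
    ((measurable_fluxFun_shear hΦ).norm.pow_const 2).enorm
  have hH : Measurable H := hm.lintegral_prod_left'
  have hfin : ∫⁻ b, H b ∂haar ≠ ⊤ := by
    have h1 := ((memLp_fluxFun_shear hΦ).integrable_norm_pow two_ne_zero).2
    rw [hasFiniteIntegral_iff_enorm] at h1
    rw [← lintegral_prod_symm' _ hm]
    exact h1.ne
  have hl : ∀ ξ b, H (h ξ * b) = H b := by
    intro ξ b
    simp only [H, fluxFun_h_mul hΦ]
    exact lintegral_mul_right_eq_self (fun x => ‖‖fluxFun Φ x (x * b)‖ ^ 2‖ₑ) (h ξ)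
  have hr : ∀ ξ b, H (b * h ξ) = H b := by
    intro ξ b
    simp only [H, fluxFun_mul_h hΦ]
  rw [lintegral_of_invariant hH hl hr, lintegral_aSq_eq h₁ h₁' h₂ h₂'] at hfin
  have hmeas : Measurable fun θ₃ =>
      ENNReal.ofReal (relJacobian θ₁ θ₂ θ₃) * H (a (relAngle θ₁ θ₂ θ₃)) := by
    refine Measurable.mul (Measurable.ennreal_ofReal ?_) (hH.comp
      (continuous_a.measurable.comp ?_))
    · unfold relJacobian
      exact Continuous.measurable (by fun_prop)
    · unfold relAngle
      exact Continuous.measurable (by fun_prop)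
  have hae := ae_lt_top hmeas hfin
  rw [ae_restrict_iff' (measurableSet_admissible θ₁ θ₂)] at hae
  filter_upwards [ae_restrict_of_ae hae, ae_restrict_mem measurableSet_Ioo] with θ₃ h3 h4 ha
  have hjac : 0 < relJacobian θ₁ θ₂ θ₃ :=
    div_pos (sin_half_pos h4.1 h4.2) (mul_pos four_pos
      (mul_pos (sin_half_pos h₁ h₁') (sin_half_pos h₂ h₂')))
  have h5 : H (a (relAngle θ₁ θ₂ θ₃)) < ⊤ := by
    refine lt_top_iff_ne_top.mpr fun htop => ?_
    have h6 := h3 ha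
    rw [htop, ENNReal.mul_top (ENNReal.ofReal_pos.mpr hjac).ne'] at h6
    exact lt_irrefl _ h6
  have h7 := (measurable_fluxFun_slice hΦ (a (relAngle θ₁ θ₂ θ₃)))
  rw [memLp_two_iff_integrable_sq_norm h7.aestronglyMeasurable]
  exact ⟨(h7.norm.pow_const 2).aestronglyMeasurable, h5⟩

lemma measurable_section (hΦ : IsCarrier ![.flux 0, .flux 0] Φ) (w b : SU2) :
    Measurable fun z => fluxFun Φ (z * w) (z * w * b) :=
  (measurable_fluxFun_slice hΦ b).comp (measurable_mul_const w)

lemma memLp_section {b : SU2} (hb : MemLp (fun x => fluxFun Φ x (x * b)) 2 haar) (w : SU2) :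
    MemLp (fun z => fluxFun Φ (z * w) (z * w * b)) 2 haar :=
  hb.comp_measurePreserving (measurePreserving_mul_right haar w)

lemma isCarrier_single {n : ℤ} {G : SU2 → ℂ} (hm : Measurable G) (hG : MemLp G 2 haar)
    (hc : ∀ x ξ, G (x * h ξ) = Complex.exp (Complex.I * n * ξ / 2) * G x) :
    IsCarrier ![.flux n] fun y => G (y 0) where
  measurable := hm.comp
    (measurable_pi_apply (X := fun b : Fin 1 => (![Kind.flux n] b).Point) 0)
  memLp := hG.comp_measurePreserving (measurePreserving_one ![.flux n])
  covariant := fun b ξ y => by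
    refine Fin.cases ?_ (fun b => b.elim0) b
    exact (congrArg G (Function.update_self (β := fun b : Fin 1 => (![Kind.flux n] b).Point) _ _ _)).trans
      (hc (y 0) ξ)

/-- Each θ₃ is treated separately, so no measurability of w is needed; the exceptional null set
comes from the slices and serves all n₃ at once. -/
lemma isCarrier_fluxCG {θ₁ θ₂ : ℝ} (h₁ : 0 < θ₁) (h₁' : θ₁ < 2 * Real.pi) (h₂ : 0 < θ₂)
    (h₂' : θ₂ < 2 * Real.pi) (hΦ : IsCarrier ![.flux 0, .flux 0] Φ) (w : ℝ → SU2) :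
    ∀ᵐ θ₃ ∂(volume.restrict (Set.Ioo 0 (2 * Real.pi))), ∀ n₃ : ℤ,
      IsCarrier ![.flux n₃] (fluxCG θ₁ θ₂ θ₃ n₃ (w θ₃) Φ) := by
  filter_upwards [ae_memLp_slice h₁ h₁' h₂ h₂' hΦ] with θ₃ hL n₃
  by_cases ha : Admissible θ₁ θ₂ θ₃
  · rw [funext (fluxCG_eq hΦ ha n₃ (w θ₃))]
    have hm := measurable_section hΦ (w θ₃)⁻¹ (a (relAngle θ₁ θ₂ θ₃))
    have hF := memLp_section (hL ha) (w θ₃)⁻¹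
    refine isCarrier_single (G := fun x => (fluxNorm θ₁ θ₂ θ₃ : ℂ) * torusCoeff n₃ (fun z =>
      fluxFun Φ (z * (w θ₃)⁻¹) (z * (w θ₃)⁻¹ * a (relAngle θ₁ θ₂ θ₃))) x) ?_ ?_ fun x ξ => ?_
    · exact (stronglyMeasurable_torusCoeff hm n₃).measurable.const_mul _
    · exact (memLp_torusCoeff hm hF n₃).const_mul _
    · simp only [torusCoeff_mul_h]
      ring
  · rw [fluxCG_of_not_admissible ha]
    exact isCarrier_single (G := fun _ => 0) measurable_const MemLp.zero' fun x ξ => by simp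

end Carrier

end DoubleSU2

end

noncomputable section

namespace DoubleSU2

/-! ### Fusion of two fluxes -/

lemma continuous_character (n : ℕ) : Continuous (character n) := by
  change Continuous fun g => ∑ k, wigner n g k k
  exact continuous_finsetSum _ fun k _ => continuous_wigner n k k

lemma norm_character_le (n : ℕ) (g : SU2) : ‖character n g‖ ≤ n + 1 := by
  refine (norm_sum_le _ _).trans ((Finset.sum_le_sum fun k _ =>
    norm_wigner_le_one n g k k).trans ?_)
  simp

lemma continuous_signed (δ : Bool) : Continuous (signed δ) := by
  cases δ
  · exact continuous_inv
  · exact continuous_id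

/-- The evaluation of a circle of spin `n/2` around two fluxes in the relative position `b`. -/
def pairCharacter (n : ℕ) (δ : Bool) (θ₁ θ₂ : ℝ) (b : SU2) : ℂ :=
  character n (signed δ (h θ₁ * b * h θ₂ * b⁻¹))

lemma continuous_pairCharacter (n : ℕ) (δ : Bool) (θ₁ θ₂ : ℝ) :
    Continuous (pairCharacter n δ θ₁ θ₂) :=
  (continuous_character n).comp ((continuous_signed δ).comp
    (((continuous_const.mul continuous_id).mul continuous_const).mul continuous_inv))

lemma character_signed_conj' (n : ℕ) (δ : Bool) (x g : SU2) :
    character n (signed δ (x * g * x⁻¹)) = character n (signed δ g) := by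
  rw [signed_conj, character_conj]

lemma pairCharacter_h_mul (n : ℕ) (δ : Bool) (θ₁ θ₂ ξ : ℝ) (b : SU2) :
    pairCharacter n δ θ₁ θ₂ (h ξ * b) = pairCharacter n δ θ₁ θ₂ b := by
  rw [pairCharacter, pairCharacter, ← character_signed_conj' n δ (h ξ) (h θ₁ * b * h θ₂ * b⁻¹)]
  have hcomm : h θ₁ * h ξ = h ξ * h θ₁ := by rw [h_mul_h, h_mul_h, add_comm]
  congr 2
  rw [← mul_assoc (h θ₁), hcomm]
  group

lemma pairCharacter_mul_h (n : ℕ) (δ : Bool) (θ₁ θ₂ ξ : ℝ) (b : SU2) :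
    pairCharacter n δ θ₁ θ₂ (b * h ξ) = pairCharacter n δ θ₁ θ₂ b := by
  rw [pairCharacter, pairCharacter]
  have := conj_mul_h b ξ θ₂
  congr 2
  simp only [mul_assoc] at this ⊢
  rw [this]

section Fusion

variable {Φ Ψ : State ![.flux 0, .flux 0]}

/-- The inner product of two states restricted to the relative position `b`. -/
def relInner (Ψ Φ : State ![.flux 0, .flux 0]) (b : SU2) : ℂ :=
  ∫ x, (starRingEnd ℂ) (fluxFun Ψ x (x * b)) * fluxFun Φ x (x * b) ∂haar

lemma relInner_h_mul (hΨ : IsCarrier ![.flux 0, .flux 0] Ψ)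
    (hΦ : IsCarrier ![.flux 0, .flux 0] Φ) (ξ : ℝ) (b : SU2) :
    relInner Ψ Φ (h ξ * b) = relInner Ψ Φ b := by
  simp only [relInner, fluxFun_h_mul hΦ, fluxFun_h_mul hΨ]
  exact integral_mul_right_eq_self
    (fun x => (starRingEnd ℂ) (fluxFun Ψ x (x * b)) * fluxFun Φ x (x * b)) (h ξ)

lemma relInner_mul_h (hΨ : IsCarrier ![.flux 0, .flux 0] Ψ)
    (hΦ : IsCarrier ![.flux 0, .flux 0] Φ) (ξ : ℝ) (b : SU2) :
    relInner Ψ Φ (b * h ξ) = relInner Ψ Φ b := by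
  simp only [relInner, fluxFun_mul_h hΦ, fluxFun_mul_h hΨ]

lemma integrable_shear (hΨ : IsCarrier ![.flux 0, .flux 0] Ψ)
    (hΦ : IsCarrier ![.flux 0, .flux 0] Φ) :
    Integrable (fun p : SU2 × SU2 => (starRingEnd ℂ) (fluxFun Ψ p.1 (p.1 * p.2)) *
      fluxFun Φ p.1 (p.1 * p.2)) (haar.prod haar) :=
  (memLp_fluxFun_shear hΨ).star.integrable_mul (memLp_fluxFun_shear hΦ)

lemma stronglyMeasurable_relInner (hΨ : IsCarrier ![.flux 0, .flux 0] Ψ)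
    (hΦ : IsCarrier ![.flux 0, .flux 0] Φ) : StronglyMeasurable (relInner Ψ Φ) := by
  refine StronglyMeasurable.integral_prod_right
    (f := fun b x : SU2 => (starRingEnd ℂ) (fluxFun Ψ x (x * b)) * fluxFun Φ x (x * b)) ?_
  refine Measurable.stronglyMeasurable (Measurable.mul ?_ ?_)
  · exact Complex.continuous_conj.measurable.comp
      ((measurable_fluxFun_shear hΨ).comp measurable_swap)
  · exact (measurable_fluxFun_shear hΦ).comp measurable_swap

lemma integrable_relInner (hΨ : IsCarrier ![.flux 0, .flux 0] Ψ)
    (hΦ : IsCarrier ![.flux 0, .flux 0] Φ) : Integrable (relInner Ψ Φ) haar :=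
  (integrable_shear hΨ hΦ).integral_prod_right

lemma integrable_pairCharacter_mul_relInner (hΨ : IsCarrier ![.flux 0, .flux 0] Ψ)
    (hΦ : IsCarrier ![.flux 0, .flux 0] Φ) (n : ℕ) (δ : Bool) (θ₁ θ₂ : ℝ) :
    Integrable (fun b => pairCharacter n δ θ₁ θ₂ b * relInner Ψ Φ b) haar :=
  (integrable_relInner hΨ hΦ).bdd_mul (c := n + 1)
    (continuous_pairCharacter n δ θ₁ θ₂).aestronglyMeasurable
    (Eventually.of_forall fun _ => norm_character_le n _)

/-- After the shear y = x b the total holonomy is the conjugate by x of h_{θ₁} b h_{θ₂} b⁻¹. Its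
character depends on b only, and the integral over x is `relInner`. -/
lemma braket_aroundTwo (hΨ : IsCarrier ![.flux 0, .flux 0] Ψ)
    (hΦ : IsCarrier ![.flux 0, .flux 0] Φ) (n : ℕ) (δ : Bool) (θ₁ θ₂ : ℝ) :
    braket ![.flux 0, .flux 0] Ψ
        (evalSpin n ![.flux 0, .flux 0] ![θ₁, θ₂] (aroundTwoWord δ) Φ) =
      ∫ b, pairCharacter n δ θ₁ θ₂ b * relInner Ψ Φ b ∂haar := by
  let e := MeasurableEquiv.piFinTwo fun b => (![Kind.flux 0, Kind.flux 0] b).Point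
  have he : MeasurePreserving e (configMeasure ![.flux 0, .flux 0]) (haar.prod haar) :=
    measurePreserving_two _
  let g : SU2 × SU2 → ℂ := fun p => (starRingEnd ℂ) (fluxFun Ψ p.1 p.2) *
    (character n (signed δ (p.1 * h θ₁ * p.1⁻¹ * (p.2 * h θ₂ * p.2⁻¹))) * fluxFun Φ p.1 p.2)
  have hpt : ∀ y : Config ![.flux 0, .flux 0], (starRingEnd ℂ) (Ψ y) *
      evalSpin n ![.flux 0, .flux 0] ![θ₁, θ₂] (aroundTwoWord δ) Φ y = g (e y) := by
    intro y
    have hy := (pairConfig_eta y).symm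
    refine congrArg₂ (· * ·) (congrArg (fun y => (starRingEnd ℂ) (Ψ y)) hy) ?_
    refine (evalSpin_aroundTwoWord n ![.flux 0, .flux 0] ![θ₁, θ₂] δ Φ y).trans ?_
    exact congrArg (_ * ·) (congrArg Φ hy)
  have hgm : Measurable g := by
    refine Measurable.mul (Complex.continuous_conj.measurable.comp (measurable_fluxFun hΨ))
      (Measurable.mul ?_ (measurable_fluxFun hΦ))
    refine ((continuous_character n).comp (continuous_signed δ)).measurable.comp ?_
    exact ((measurable_fst.mul_const _).mul measurable_fst.inv).mul
      ((measurable_snd.mul_const _).mul measurable_snd.inv)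
  have hshear := measurePreserving_prod_mul haar haar
  have hgs : ∀ p : SU2 × SU2, g (p.1, p.1 * p.2) = pairCharacter n δ θ₁ θ₂ p.2 *
      ((starRingEnd ℂ) (fluxFun Ψ p.1 (p.1 * p.2)) * fluxFun Φ p.1 (p.1 * p.2)) := by
    intro p
    have hconj : p.1 * h θ₁ * p.1⁻¹ * (p.1 * p.2 * h θ₂ * (p.1 * p.2)⁻¹) =
        p.1 * (h θ₁ * p.2 * h θ₂ * p.2⁻¹) * p.1⁻¹ := by group
    simp only [g, pairCharacter]
    rw [hconj, character_signed_conj', mul_left_comm]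
  have hint : Integrable (fun p : SU2 × SU2 => pairCharacter n δ θ₁ θ₂ p.2 *
      ((starRingEnd ℂ) (fluxFun Ψ p.1 (p.1 * p.2)) * fluxFun Φ p.1 (p.1 * p.2)))
      (haar.prod haar) :=
    (integrable_shear hΨ hΦ).bdd_mul (c := n + 1)
      ((continuous_pairCharacter n δ θ₁ θ₂).measurable.comp measurable_snd).aestronglyMeasurable
      (Eventually.of_forall fun _ => norm_character_le n _)
  have h1 : ∫ p, g p ∂(haar.prod haar) = ∫ p : SU2 × SU2, g (p.1, p.1 * p.2) ∂(haar.prod haar) := by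
    have h2 := integral_map (μ := haar.prod haar) hshear.measurable.aemeasurable (f := g)
      hgm.aestronglyMeasurable
    rwa [hshear.map_eq] at h2
  have h2 : braket ![.flux 0, .flux 0] Ψ
      (evalSpin n ![.flux 0, .flux 0] ![θ₁, θ₂] (aroundTwoWord δ) Φ) =
      ∫ p, g p ∂(haar.prod haar) :=
    (integral_congr_ae (Eventually.of_forall hpt)).trans (he.integral_comp' g)
  rw [h2, h1]
  simp only [hgs]
  rw [integral_prod_symm _ hint]
  simp only [integral_const_mul, relInner]

variable {θ₁ θ₂ θ₃ : ℝ}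

lemma pairCharacter_section {w : ℝ → SU2} (hw : IsSection θ₁ θ₂ w) (ha : Admissible θ₁ θ₂ θ₃)
    (n : ℕ) (δ : Bool) : pairCharacter n δ θ₁ θ₂ (a (relAngle θ₁ θ₂ θ₃)) = chi n θ₃ := by
  rw [pairCharacter, hw θ₃ ha, character_signed_conj]

lemma fluxFusionTerm_eq (hΨ : IsCarrier ![.flux 0, .flux 0] Ψ)
    (hΦ : IsCarrier ![.flux 0, .flux 0] Φ) (ha : Admissible θ₁ θ₂ θ₃) (w : ℝ → SU2) (n : ℕ)
    (δ : Bool) (n₃ : ℤ) : fluxFusionTerm n δ θ₁ θ₂ w Ψ Φ θ₃ n₃ =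
      ((chi n θ₃ * fluxNorm θ₁ θ₂ θ₃ ^ 2 : ℝ) : ℂ) * ∫ x, (starRingEnd ℂ) (torusCoeff n₃ (fun z =>
          fluxFun Ψ (z * (w θ₃)⁻¹) (z * (w θ₃)⁻¹ * a (relAngle θ₁ θ₂ θ₃))) x) *
        torusCoeff n₃ (fun z =>
          fluxFun Φ (z * (w θ₃)⁻¹) (z * (w θ₃)⁻¹ * a (relAngle θ₁ θ₂ θ₃))) x ∂haar := by
  let e := MeasurableEquiv.piUnique fun b => (![Kind.flux n₃] b).Point
  have he : MeasurePreserving e (configMeasure ![.flux n₃]) haar := measurePreserving_one _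
  rw [← integral_const_mul]
  refine Eq.trans ?_ (he.integral_comp' _)
  refine integral_congr_ae (Eventually.of_forall fun y => ?_)
  have h1 : evalSpin n ![.flux n₃] ![θ₃] (circleWord δ) (fluxCG θ₁ θ₂ θ₃ n₃ (w θ₃) Φ) y =
      chi n θ₃ * fluxCG θ₁ θ₂ θ₃ n₃ (w θ₃) Φ y :=
    (evalSpin_circleWord n ![.flux n₃] ![θ₃] δ _ y).trans
      (congrArg (· * _) (character_signed_conj n δ (y 0) θ₃))
  have key : ∀ u v : ℂ, (starRingEnd ℂ) ((fluxNorm θ₁ θ₂ θ₃ : ℂ) * u) *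
      (chi n θ₃ * ((fluxNorm θ₁ θ₂ θ₃ : ℂ) * v)) =
      ((chi n θ₃ * fluxNorm θ₁ θ₂ θ₃ ^ 2 : ℝ) : ℂ) * ((starRingEnd ℂ) u * v) := by
    intro u v
    rw [map_mul, Complex.conj_ofReal]
    push_cast
    ring
  simp only
  rw [h1, fluxCG_eq hΨ ha, fluxCG_eq hΦ ha]
  exact key _ _

/-- Parseval along the torus sums over s₃, and right invariance of Haar measure removes the
translation by w⁻¹: any choice of w gives the same value. -/
lemma hasSum_fluxFusionTerm (hΨ : IsCarrier ![.flux 0, .flux 0] Ψ)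
    (hΦ : IsCarrier ![.flux 0, .flux 0] Φ) (ha : Admissible θ₁ θ₂ θ₃)
    (hLΨ : MemLp (fun x => fluxFun Ψ x (x * a (relAngle θ₁ θ₂ θ₃))) 2 haar)
    (hLΦ : MemLp (fun x => fluxFun Φ x (x * a (relAngle θ₁ θ₂ θ₃))) 2 haar) (w : ℝ → SU2) (n : ℕ)
    (δ : Bool) : HasSum (fluxFusionTerm n δ θ₁ θ₂ w Ψ Φ θ₃)
      (((chi n θ₃ * fluxNorm θ₁ θ₂ θ₃ ^ 2 : ℝ) : ℂ) * relInner Ψ Φ (a (relAngle θ₁ θ₂ θ₃))) := by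
  have h1 := (hasSum_integral_torusCoeff (measurable_section hΨ (w θ₃)⁻¹ _)
    (memLp_section hLΨ (w θ₃)⁻¹) (measurable_section hΦ (w θ₃)⁻¹ _)
    (memLp_section hLΦ (w θ₃)⁻¹)).mul_left ((chi n θ₃ * fluxNorm θ₁ θ₂ θ₃ ^ 2 : ℝ) : ℂ)
  have h2 := integral_mul_right_eq_self (μ := haar) (fun x => (starRingEnd ℂ)
    (fluxFun Ψ x (x * a (relAngle θ₁ θ₂ θ₃))) * fluxFun Φ x (x * a (relAngle θ₁ θ₂ θ₃))) (w θ₃)⁻¹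
  rw [h2] at h1
  rw [funext (fluxFusionTerm_eq hΨ hΦ ha w n δ)]
  exact h1

/-- This identity dictates the normalisation of the kernel: the measure sin²(θ₃/2) dθ₃ times its
square is the uniform measure in cos²(θ/2). -/
lemma deltaSq_mul_fluxNorm (h₁ : 0 < θ₁) (h₁' : θ₁ < 2 * Real.pi) (h₂ : 0 < θ₂)
    (h₂' : θ₂ < 2 * Real.pi) (h₃ : 0 < θ₃) (h₃' : θ₃ < 2 * Real.pi) :
    deltaSq θ₃ * fluxNorm θ₁ θ₂ θ₃ ^ 2 = relJacobian θ₁ θ₂ θ₃ := by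
  have s1 := sin_half_pos h₁ h₁'
  have s2 := sin_half_pos h₂ h₂'
  have s3 := sin_half_pos h₃ h₃'
  rw [deltaSq, fluxNorm, relJacobian, div_pow, Real.sq_sqrt (by positivity)]
  field_simp

/-- Fusion of two fluxes inside a circle of spin `n/2`. -/
theorem fusion_flux (h₁ : 0 < θ₁) (h₁' : θ₁ < 2 * Real.pi) (h₂ : 0 < θ₂)
    (h₂' : θ₂ < 2 * Real.pi) {w : ℝ → SU2} (hw : IsSection θ₁ θ₂ w) (n : ℕ) (δ : Bool)
    (hΨ : IsCarrier ![.flux 0, .flux 0] Ψ) (hΦ : IsCarrier ![.flux 0, .flux 0] Φ) :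
    (∀ᵐ θ₃ ∂(volume.restrict (Set.Ioo 0 (2 * Real.pi))),
      Summable (fluxFusionTerm n δ θ₁ θ₂ w Ψ Φ θ₃)) ∧
    IntervalIntegrable (fun θ₃ => ((deltaSq θ₃ : ℝ) : ℂ) *
      ∑' n₃ : ℤ, fluxFusionTerm n δ θ₁ θ₂ w Ψ Φ θ₃ n₃) volume 0 (2 * Real.pi) ∧
    braket ![.flux 0, .flux 0] Ψ
        (evalSpin n ![.flux 0, .flux 0] ![θ₁, θ₂] (aroundTwoWord δ) Φ) =
      ∫ θ₃ in (0 : ℝ)..(2 * Real.pi), ((deltaSq θ₃ : ℝ) : ℂ) *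
        ∑' n₃ : ℤ, fluxFusionTerm n δ θ₁ θ₂ w Ψ Φ θ₃ n₃ := by
  let K : SU2 → ℂ := fun b => pairCharacter n δ θ₁ θ₂ b * relInner Ψ Φ b
  let S : Set ℝ := {θ₃ | Admissible θ₁ θ₂ θ₃}
  let f : ℝ → ℂ := fun θ₃ => (relJacobian θ₁ θ₂ θ₃ : ℂ) * K (a (relAngle θ₁ θ₂ θ₃))
  have hS : MeasurableSet S := measurableSet_admissible θ₁ θ₂
  have hzero : ∀ θ₃, ¬Admissible θ₁ θ₂ θ₃ → ∀ n₃, fluxFusionTerm n δ θ₁ θ₂ w Ψ Φ θ₃ n₃ = 0 := by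
    intro θ₃ ha n₃
    simp [fluxFusionTerm, braket, fluxCG_of_not_admissible ha]
  -- Almost everywhere only: the slices must be square integrable, and θ₃ must lie in the open
  -- interval, where the kernel normalisation does not degenerate.
  have hsum : ∀ᵐ θ₃ ∂(volume.restrict (Set.Ioo 0 (2 * Real.pi))),
      Summable (fluxFusionTerm n δ θ₁ θ₂ w Ψ Φ θ₃) ∧ S.indicator f θ₃ = ((deltaSq θ₃ : ℝ) : ℂ) *
        ∑' n₃ : ℤ, fluxFusionTerm n δ θ₁ θ₂ w Ψ Φ θ₃ n₃ := by
    filter_upwards [ae_memLp_slice h₁ h₁' h₂ h₂' hΨ, ae_memLp_slice h₁ h₁' h₂ h₂' hΦ,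
      ae_restrict_mem measurableSet_Ioo] with θ₃ hLΨ hLΦ hθ
    by_cases ha : Admissible θ₁ θ₂ θ₃
    · have hs := hasSum_fluxFusionTerm hΨ hΦ ha (hLΨ ha) (hLΦ ha) w n δ
      refine ⟨hs.summable, ?_⟩
      rw [hs.tsum_eq, Set.indicator_of_mem (show θ₃ ∈ S from ha)]
      simp only [f, K]
      rw [pairCharacter_section hw ha, ← deltaSq_mul_fluxNorm h₁ h₁' h₂ h₂' hθ.1 hθ.2]
      push_cast
      ring
    · rw [Set.indicator_of_notMem (show θ₃ ∉ S from ha)]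
      have h0 : fluxFusionTerm n δ θ₁ θ₂ w Ψ Φ θ₃ = fun _ => 0 := funext (hzero θ₃ ha)
      rw [h0]
      exact ⟨summable_zero, by simp⟩
  have hKm : StronglyMeasurable K :=
    (continuous_pairCharacter n δ θ₁ θ₂).stronglyMeasurable.mul
      (stronglyMeasurable_relInner hΨ hΦ)
  have hKl : ∀ ξ g, K (h ξ * g) = K g := fun ξ g => by
    simp only [K, pairCharacter_h_mul, relInner_h_mul hΨ hΦ]
  have hKr : ∀ ξ g, K (g * h ξ) = K g := fun ξ g => by
    simp only [K, pairCharacter_mul_h, relInner_mul_h hΨ hΦ]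
  have hf : IntegrableOn f S := (integrableOn_aSq_iff h₁ h₁' h₂ h₂' K).mp
    (integrableOn_of_invariant hKm hKl hKr
      (integrable_pairCharacter_mul_relInner hΨ hΦ n δ θ₁ θ₂))
  have hpi : (0 : ℝ) ≤ 2 * Real.pi := by positivity
  refine ⟨hsum.mono fun _ h => h.1, ?_, ?_⟩
  · rw [intervalIntegrable_iff_integrableOn_Ioo_of_le hpi]
    exact ((integrable_indicator_iff hS).mpr hf).integrableOn.congr_fun_ae
      (hsum.mono fun _ h => h.2)
  -- The admissible set can contain the endpoints 0 and 2π, so the open interval is traded for the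
  -- closed one before intersecting.
  · rw [braket_aroundTwo hΨ hΦ, integral_of_invariant hKm hKl hKr,
      integral_aSq_eq h₁ h₁' h₂ h₂', intervalIntegral.integral_of_le hpi,
      integral_Ioc_eq_integral_Ioo, ← integral_congr_ae (hsum.mono fun _ h => h.2),
      ← integral_Icc_eq_integral_Ioo, setIntegral_indicator hS]
    congr 2
    refine (Set.inter_eq_right.mpr fun θ₃ ha => ?_).symm
    obtain ⟨h3, h4, -⟩ := (admissible_iff h₁ h₁' h₂ h₂').mp ha
    exact ⟨h3, h4⟩

end Fusion

end DoubleSU2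

end

/-! ### The proposition, assembled -/

theorem mainTheorem8 :
    -- sliding of a strand `(0, j)` over a circle `Ω` around a strand `(θ, s)`
    (∀ (n : ℕ) (s : ℤ) (δ ε ε' : Bool),
      DoubleSU2.OmegaEvaluatesTo ![.spin n, .flux s]
        (fun k t => DoubleSU2.evalSpin k ![.spin n, .flux s] ![0, t]
          (DoubleSU2.slideWord δ ε ε'))
        (DoubleSU2.deltaId ![.spin n, .flux s])) ∧
    -- sliding of a strand `(θ, s)` over a circle `Ω*` around a strand `(0, j)`
    (∀ (n : ℕ) (s : ℤ) (θ : ℝ), 0 < θ → θ < 2 * Real.pi → ∀ δ : Bool,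
      (∀ (ε ε' : Bool) (t : ℝ), DoubleSU2.IsDiagonal
        (DoubleSU2.fluxBraid t ![.flux s, .spin n] ![θ, 0] (DoubleSU2.slideWord δ ε ε'))) ∧
      ∀ (Φ : DoubleSU2.State ![.flux s, .spin n]),
        DoubleSU2.IsCarrier ![.flux s, .spin n] Φ → ∀ y,
        (∀ ε ε' : Bool, IntervalIntegrable (fun t => DoubleSU2.evalFlux t ![.flux s, .spin n]
          ![θ, 0] (DoubleSU2.slideWord δ ε ε') Φ y) volume 0 (2 * Real.pi)) ∧
        ∀ ε₁ ε₁' ε₂ ε₂' : Bool,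
          DoubleSU2.omegaStar (fun t => DoubleSU2.evalFlux t ![.flux s, .spin n] ![θ, 0]
            (DoubleSU2.slideWord δ ε₁ ε₁') Φ) y =
          DoubleSU2.omegaStar (fun t => DoubleSU2.evalFlux t ![.flux s, .spin n] ![θ, 0]
            (DoubleSU2.slideWord δ ε₂ ε₂') Φ) y) ∧
    -- killing: a circle `Ω*` around a strand `(0, j)` gives `δ_{j,0}`
    (∀ (n : ℕ) (δ : Bool),
      (∀ t : ℝ, DoubleSU2.IsDiagonal
        (DoubleSU2.fluxBraid t ![.spin n] ![0] (DoubleSU2.circleWord δ))) ∧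
      ∀ (Φ : DoubleSU2.State ![.spin n]) (y : DoubleSU2.Config ![.spin n]),
        IntervalIntegrable (fun t => DoubleSU2.evalFlux t ![.spin n] ![0]
          (DoubleSU2.circleWord δ) Φ y) volume 0 (2 * Real.pi) ∧
        DoubleSU2.omegaStar (fun t => DoubleSU2.evalFlux t ![.spin n] ![0]
          (DoubleSU2.circleWord δ) Φ) y = (if n = 0 then 1 else 0) * Φ y) ∧
    -- killing: a circle `Ω` around a strand `(θ, s)` gives `δ(h_θ)`
    (∀ (s : ℤ) (δ : Bool),
      DoubleSU2.OmegaEvaluatesTo ![.flux s]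
        (fun k t => DoubleSU2.evalSpin k ![.flux s] ![t] (DoubleSU2.circleWord δ))
        (DoubleSU2.deltaId ![.flux s])) ∧
    -- the Clebsch-Gordan maps of `(0, j₁) ⊗ (0, j₂)` intertwine the actions of the double
    (∀ (n₁ n₂ n₃ : ℕ) (f : DoubleSU2.SU2 → ℂ) (g : DoubleSU2.SU2)
      (Φ : DoubleSU2.State ![.spin n₁, .spin n₂]),
      DoubleSU2.spinCG n₁ n₂ n₃ (DoubleSU2.doubleAct ![.spin n₁, .spin n₂] ![0, 0] f g Φ) =
        DoubleSU2.doubleAct ![.spin n₃] ![0] f g (DoubleSU2.spinCG n₁ n₂ n₃ Φ)) ∧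
    -- fusion of `(0, j₁)` and `(0, j₂)` inside a circle `(θ, 0)`
    (∀ (n₁ n₂ : ℕ) (θ : ℝ), 0 < θ → θ < 2 * Real.pi → ∀ δ : Bool,
      DoubleSU2.IsDiagonal (DoubleSU2.fluxBraid θ ![.spin n₁, .spin n₂] ![0, 0]
        (DoubleSU2.aroundTwoWord δ)) ∧
      (∀ n₃ : ℕ, DoubleSU2.IsDiagonal
        (DoubleSU2.fluxBraid θ ![.spin n₃] ![0] (DoubleSU2.circleWord δ))) ∧
      ∀ (Φ : DoubleSU2.State ![.spin n₁, .spin n₂]) (y : DoubleSU2.Config ![.spin n₁, .spin n₂]),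
        HasSum (fun n₃ : ℕ => ((n₃ : ℂ) + 1) * DoubleSU2.spinCGDual n₁ n₂ n₃
            (DoubleSU2.evalFlux θ ![.spin n₃] ![0] (DoubleSU2.circleWord δ)
              (DoubleSU2.spinCG n₁ n₂ n₃ Φ)) y)
          (DoubleSU2.evalFlux θ ![.spin n₁, .spin n₂] ![0, 0]
            (DoubleSU2.aroundTwoWord δ) Φ y)) ∧
    -- fusion of `(θ₁, 0)` and `(θ₂, 0)` inside a circle `(0, j)`
    (∀ θ₁ θ₂ : ℝ, 0 < θ₁ → θ₁ < 2 * Real.pi → 0 < θ₂ → θ₂ < 2 * Real.pi →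
      (∃ w : ℝ → DoubleSU2.SU2, DoubleSU2.IsSection θ₁ θ₂ w) ∧
      ∀ w : ℝ → DoubleSU2.SU2, DoubleSU2.IsSection θ₁ θ₂ w →
        -- the Clebsch-Gordan maps are intertwiners into the carrier spaces of `(θ₃, s₃)`
        (∀ (θ₃ : ℝ) (n₃ : ℤ) (f : DoubleSU2.SU2 → ℂ) (g : DoubleSU2.SU2)
          (Φ : DoubleSU2.State ![.flux 0, .flux 0]),
          DoubleSU2.fluxCG θ₁ θ₂ θ₃ n₃ (w θ₃)
              (DoubleSU2.doubleAct ![.flux 0, .flux 0] ![θ₁, θ₂] f g Φ) =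
            DoubleSU2.doubleAct ![.flux n₃] ![θ₃] f g
              (DoubleSU2.fluxCG θ₁ θ₂ θ₃ n₃ (w θ₃) Φ)) ∧
        (∀ Φ : DoubleSU2.State ![.flux 0, .flux 0], DoubleSU2.IsCarrier ![.flux 0, .flux 0] Φ →
          ∀ᵐ θ₃ ∂(volume.restrict (Set.Ioo 0 (2 * Real.pi))), ∀ n₃ : ℤ,
            DoubleSU2.IsCarrier ![.flux n₃] (DoubleSU2.fluxCG θ₁ θ₂ θ₃ n₃ (w θ₃) Φ)) ∧
        ∀ (n : ℕ) (δ : Bool) (Ψ Φ : DoubleSU2.State ![.flux 0, .flux 0]),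
          DoubleSU2.IsCarrier ![.flux 0, .flux 0] Ψ →
          DoubleSU2.IsCarrier ![.flux 0, .flux 0] Φ →
          (∀ᵐ θ₃ ∂(volume.restrict (Set.Ioo 0 (2 * Real.pi))),
            Summable (DoubleSU2.fluxFusionTerm n δ θ₁ θ₂ w Ψ Φ θ₃)) ∧
          IntervalIntegrable (fun θ₃ => ((DoubleSU2.deltaSq θ₃ : ℝ) : ℂ) *
            ∑' n₃ : ℤ, DoubleSU2.fluxFusionTerm n δ θ₁ θ₂ w Ψ Φ θ₃ n₃)
            volume 0 (2 * Real.pi) ∧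
          DoubleSU2.braket ![.flux 0, .flux 0] Ψ
              (DoubleSU2.evalSpin n ![.flux 0, .flux 0] ![θ₁, θ₂]
                (DoubleSU2.aroundTwoWord δ) Φ) =
            ∫ θ₃ in (0 : ℝ)..(2 * Real.pi), ((DoubleSU2.deltaSq θ₃ : ℝ) : ℂ) *
              ∑' n₃ : ℤ, DoubleSU2.fluxFusionTerm n δ θ₁ θ₂ w Ψ Φ θ₃ n₃) := by
  refine ⟨DoubleSU2.slide_spin, fun n s θ _ _ δ =>
    ⟨fun ε ε' t => DoubleSU2.isDiagonal_slideWord t n s θ δ ε ε',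
      fun Φ _ y => DoubleSU2.slide_flux n s θ δ Φ y⟩,
    fun n δ => ⟨fun t => DoubleSU2.isDiagonal_circleWord_spin t n δ,
      fun Φ y => DoubleSU2.kill_spin n δ Φ y⟩,
    DoubleSU2.kill_flux, DoubleSU2.spinCG_doubleAct,
    fun n₁ n₂ θ _ _ δ => ⟨DoubleSU2.isDiagonal_aroundTwoWord θ n₁ n₂ δ,
      fun n₃ => DoubleSU2.isDiagonal_circleWord_spin θ n₃ δ,
      fun Φ y => DoubleSU2.fusion_spin n₁ n₂ θ δ Φ y⟩,
    fun θ₁ θ₂ h₁ h₁' h₂ h₂' => ⟨DoubleSU2.exists_isSection h₁ h₁' h₂ h₂', fun w hw =>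
      ⟨DoubleSU2.fluxCG_doubleAct hw,
        fun Φ hΦ => DoubleSU2.isCarrier_fluxCG h₁ h₁' h₂ h₂' hΦ w,
        fun n δ Ψ Φ hΨ hΦ => DoubleSU2.fusion_flux h₁ h₁' h₂ h₂' hw n δ hΨ hΦ⟩⟩⟩
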